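/- **Conventions.** The Fourier transform on $\mathbb R^2$ is $\mathcal F u(\tau,\xi)=\int e^{-i(\tau\alpha+\xi\beta)}u(\alpha,\beta)\,d\alpha\,d\beta$, extended to tempered distributions, and $\langle x\rangle=(1+x^2)^{1/2}$. For $a,b\in\mathbb R$ let $\|u\|_{H^a_\alpha H^b_\beta}^2=\int\langle\tau\rangle^{2a}\langle\xi\rangle^{2b}|\mathcal Fu(\tau,\xi)|^2\,d\tau\,d\xi$ (and $=\infty$ if $\mathcal Fu$ is not a function), $\|u\|_{H^a_\beta H^b_\alpha}=\|u\|_{H^b_\alpha H^a_\beta}$, and let $\mathbb H^{a,b}$ be the space of tempered distributions $u$ with $\|u\|_{\mathbb H^{a,b}}^2=\|u\|^2_{H^a_\alpha H^b_\beta}+\|u\|^2_{H^a_\beta H^b_\alpha}<\infty$. Distributions take values in $\mathbb C^n$, for any $n$. A dyadic partition of unity is a sequence $\varphi=(\varphi_j)_{j\ge0}$ in $\mathcal S(\mathbb R)$ with $\operatorname{supp}\varphi_0\subset\{|x|\le2\}$, $\operatorname{supp}\varphi_j\subset\{2^{j-1}\le|x|\le2^{j+1}\}$ for $j\ge1$,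 $\sup_{j,x}2^{jm}|\varphi_j^{(m)}(x)|<\infty$ for every $m\ge0$, and $\sum_j\varphi_j=1$. A cut-off is an even function $\eta\in C^\infty(\mathbb R;[0,1])$ with $\operatorname{supp}\eta\subset[-4,4]$ and $\eta=1$ on $[-2,2]$; $\eta_T(x)=\eta(x/T)$. **Formula.** For $\varphi$ and $f$ write $\Delta_{0,0}f=\mathcal F^{-1}[\varphi_0(\tau)\varphi_0(\xi)\mathcal Ff]$, and $$K=\sum_{k\ge1}\mathcal F^{-1}\Big[\tfrac{\varphi_0(\tau)\varphi_k(\xi)}{i\xi}\mathcal Ff\Big],\quad L=\sum_{j\ge1}\mathcal F^{-1}\Big[\tfrac{\varphi_j(\tau)\varphi_0(\xi)}{i\tau}\mathcal Ff\Big],\quad M=\sum_{j,k\ge1}\mathcal F^{-1}\Big[\tfrac{\varphi_j(\tau)\varphi_k(\xi)}{(i\tau)(i\xi)}\mathcal Ff\Big],$$ $$A(\gamma)=\sum_{j,k\ge1}\mathcal F^{-1}\Big[\tfrac{\varphi_j(\tau)\varphi_k(\xi)}{i\xi}\mathcal Ff\Big](\gamma,-\gamma),\qquad B(\gamma)=\sum_{j,k\ge1}\mathcal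 F^{-1}\Big[\tfrac{\varphi_j(\tau)\varphi_k(\xi)}{i\tau}\mathcal Ff\Big](\gamma,-\gamma),$$ where the series $K,L,M$ are pointwise and $A,B$ are series in $\mathcal S'(\mathbb R)$. The integral over an interval of a distribution on $\mathbb R$ that has a continuous primitive is the increment of that primitive. Put $F=H+I+J+G$ with $$H(\alpha,\beta)=\int_{-\beta}^{\alpha}\int_{-\gamma}^{\beta}\Delta_{0,0}f(\gamma,\tau)\,d\tau\,d\gamma,$$ $$I(\alpha,\beta)=\int_{-\beta}^{\alpha}K(\gamma,\beta)\,d\gamma-\int_{-\beta}^{\alpha}K(\gamma,-\gamma)\,d\gamma,\qquad J(\alpha,\beta)=\int_{-\alpha}^{\beta}L(\alpha,\gamma)\,d\gamma-\int_{-\alpha}^{\beta}L(-\gamma,\gamma)\,d\gamma,$$ $$G(\alpha,\beta)=M(\alpha,\beta)-\tfrac12M(\alpha,-\alpha)-\tfrac12M(-\beta,\beta)-\tfrac12\int_{-\beta}^{\alpha}A-\tfrac12\int_{-\beta}^{\alpha}B.$$ **Traces.** A tempered distribution $u$ on $\mathbb R^2$ has the trace $u(x,-x)=S(x)$ if, in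 the coordinates $\alpha=t+x$, $\beta=t-x$, it is a weakly continuous function of $t\in\mathbb R$ with values in $\mathcal S'(\mathbb R_x)$ whose value at $t=0$ is $S$. **Proposition.** Let $s,\delta\in(\tfrac34,1)$ with $s\ge\delta$. There are constants $C(\eta,\chi,T)>0$, for cut-offs $\eta,\chi$ and $T>0$, such that for every dyadic partition of unity $\varphi$ and every $f\in\mathbb H^{s-1,\delta-1}$ the following holds. 1. The formula makes sense: $\Delta_{0,0}f$ is continuous, $K,L,M$ converge (absolutely) at every point to continuous functions, $A$ and $B$ converge in $\mathcal S'(\mathbb R)$ to distributions with continuous primitives. The function $F$ is continuous, it is $\mathbb R^n$-valued if $f$ is, and $F(\alpha,-\alpha)=0$ for all $\alpha$. 2. $F$ defines a tempered distribution, and it is the unique tempered distribution on $\mathbb R^2$ with $$\frac{\partial^2F}{\partial\alpha\,\partial\beta}=f,\qquad F(\alpha,-\alpha)=0,\qquad \frac{\partial F}{\partial\alpha}(\alpha,-\alpha)+\frac{\partial F}{\partial\beta}(\alpha,-\alpha)=0,$$ the last two conditions in the sense of traces. 3. For all cut-offs $\eta,\chi$ and all $T>0$, $\ \|\eta_T(\alpha)\chi_T(\beta)F\|_{\mathbb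 H^{s,\delta}}\le C(\eta,\chi,T)\,\|f\|_{\mathbb H^{s-1,\delta-1}}.$ Notation: $\int_{-\beta}^{\alpha}\int_{-a}^{\beta}f(da,db):=F(\alpha,\beta)$. -/

import Mathlib

open MeasureTheory Set Filter Topology
open scoped SchwartzMap FourierTransform LineDeriv ENNReal

noncomputable section

namespace NullWave

/-- The plane of null coordinates; a point `p` has `α = p 0` and `β = p 1`. -/
abbrev Plane : Type := EuclideanSpace ℝ (Fin 2)

/-- Values: `ℂⁿ`. Real (`ℝⁿ`-valued) distributions are singled out by `IsRealDistribution`. -/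
abbrev Vec (n : ℕ) : Type := EuclideanSpace ℂ (Fin n)

/-- The unit vectors of the `α`-axis and of the `β`-axis. -/
def eα : Plane := !₂[1, 0]
def eβ : Plane := !₂[0, 1]

variable {n : ℕ}

/-! ### Fourier transform and product Sobolev spaces -/

/-- The Fourier transform `û(τ, ξ) = ∫∫ e^{-i(τα + ξβ)} u(α, β) dα dβ` of the tempered
distribution `u` is the function `g`. Mathlib's `𝓕` has the kernel `e^{-2πi⟨x, ζ⟩}`, so that
`𝓕 u (ζ) = û(2πζ)`. -/
def IsFourierDensity (u : 𝓢'(Plane, Vec n)) (g : Plane → Vec n) : Prop :=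
  ∀ θ : 𝓢(Plane, ℂ),
    Integrable (fun ζ : Plane => θ ζ • g ((2 * Real.pi) • ζ)) ∧
      (𝓕 u) θ = ∫ ζ : Plane, θ ζ • g ((2 * Real.pi) • ζ)

open Classical in
/-- The function `û`, when `û` is a function (it is then unique almost everywhere). -/
def fourierDensity (u : 𝓢'(Plane, Vec n)) : Plane → Vec n :=
  if h : ∃ g, IsFourierDensity u g then h.choose else 0

/-- `∫∫ ⟨τ⟩^{2a} ⟨ξ⟩^{2b} |û(τ, ξ)|² dτ dξ`, the square of the norm of `u` in `H^a_α H^b_β`;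
it is `∞` if `û` is not a function. As `û` is unique almost everywhere, the infimum runs over
equal values. -/
def prodSobolevSq (a b : ℝ) (u : 𝓢'(Plane, Vec n)) : ℝ≥0∞ :=
  ⨅ (g : Plane → Vec n) (_ : IsFourierDensity u g),
    ∫⁻ ζ : Plane,
      ENNReal.ofReal ((1 + (ζ 0) ^ 2) ^ a * (1 + (ζ 1) ^ 2) ^ b * ‖g ζ‖ ^ 2)

/-- The norm of `ℍ^{a,b} = H^a_α H^b_β ∩ H^a_β H^b_α`, with values in `[0, ∞]`. -/
def hypNorm (a b : ℝ) (u : 𝓢'(Plane, Vec n)) : ℝ≥0∞ :=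
  (prodSobolevSq a b u + prodSobolevSq b a u) ^ (1 / 2 : ℝ)

/-- `u ∈ ℍ^{a,b}`. -/
def MemHyp (a b : ℝ) (u : 𝓢'(Plane, Vec n)) : Prop := hypNorm a b u < ∞

/-- `u` is `ℝⁿ`-valued: it takes real values on real test functions. -/
def IsRealDistribution (u : 𝓢'(Plane, Vec n)) : Prop :=
  ∀ θ : 𝓢(Plane, ℂ), (∀ p, (θ p).im = 0) → ∀ i, (u θ i).im = 0

/-! ### Dyadic partitions of unity and frequency-localised pieces -/

/-- `φ` is a smooth dyadic partition of unity of the line. -/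
structure IsDyadicPartition (φ : ℕ → 𝓢(ℝ, ℂ)) : Prop where
  tsupport_zero : tsupport (φ 0) ⊆ {x | |x| ≤ 2}
  tsupport_succ : ∀ j : ℕ, 1 ≤ j →
    tsupport (φ j) ⊆ {x | (2 : ℝ) ^ ((j : ℤ) - 1) ≤ |x| ∧ |x| ≤ (2 : ℝ) ^ (j + 1)}
  deriv_bound : ∀ m : ℕ, ∃ c : ℝ, 0 < c ∧
    ∀ (j : ℕ) (x : ℝ), (2 : ℝ) ^ (j * m) * ‖iteratedDeriv m (φ j) x‖ ≤ c
  hasSum_one : ∀ x : ℝ, HasSum (fun j => φ j x) 1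

/-- The function `𝓕⁻¹[m(τ, ξ) û(τ, ξ)](α, β)`, for bounded compactly supported `m`. -/
def symbolPiece (m : ℝ → ℝ → ℂ) (u : 𝓢'(Plane, Vec n)) (α β : ℝ) : Vec n :=
  (((2 * Real.pi) ^ 2 : ℝ) : ℂ)⁻¹ • ∫ ζ : Plane,
    (Complex.exp (Complex.I * ((α * ζ 0 + β * ζ 1 : ℝ) : ℂ)) * m (ζ 0) (ζ 1)) •
      fourierDensity u ζ

/-- The Littlewood-Paley block `Δ_{j,k} u = 𝓕⁻¹[φ_j(τ) φ_k(ξ) û]`. -/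
def block (φ : ℕ → 𝓢(ℝ, ℂ)) (j k : ℕ) (u : 𝓢'(Plane, Vec n)) : ℝ → ℝ → Vec n :=
  symbolPiece (fun τ ξ => φ j τ * φ k ξ) u

/-- `𝓕⁻¹[(iξ)⁻¹ φ_j(τ) φ_k(ξ) û]`, used for `k ≥ 1` only, where `ξ ≠ 0` on the support. -/
def blockIntβ (φ : ℕ → 𝓢(ℝ, ℂ)) (j k : ℕ) (u : 𝓢'(Plane, Vec n)) : ℝ → ℝ → Vec n :=
  symbolPiece (fun τ ξ => 1 / (Complex.I * ξ) * φ j τ * φ k ξ) u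

/-- `𝓕⁻¹[(iτ)⁻¹ φ_j(τ) φ_k(ξ) û]`, used for `j ≥ 1` only. -/
def blockIntα (φ : ℕ → 𝓢(ℝ, ℂ)) (j k : ℕ) (u : 𝓢'(Plane, Vec n)) : ℝ → ℝ → Vec n :=
  symbolPiece (fun τ ξ => 1 / (Complex.I * τ) * φ j τ * φ k ξ) u

/-- `𝓕⁻¹[((iτ)(iξ))⁻¹ φ_j(τ) φ_k(ξ) û]`, used for `j, k ≥ 1` only. -/
def blockIntαβ (φ : ℕ → 𝓢(ℝ, ℂ)) (j k : ℕ) (u : 𝓢'(Plane, Vec n)) : ℝ → ℝ → Vec n :=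
  symbolPiece (fun τ ξ => 1 / ((Complex.I * τ) * (Complex.I * ξ)) * φ j τ * φ k ξ) u

/-! ### Integrals over an interval of a series that converges as a distribution -/

/-- The series of functions `p` on the line converges to `T` in the tempered distributions. -/
def HasDistribSum {ι : Type*} (p : ι → ℝ → Vec n) (T : 𝓢'(ℝ, Vec n)) : Prop :=
  ∀ θ : 𝓢(ℝ, ℂ), (∀ i, Integrable (fun x => θ x • p i x)) ∧
    HasSum (fun i => ∫ x, θ x • p i x) (T θ)

open Classical in
/-- The sum of a series of functions in the tempered distributions (`0` if it diverges). -/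
def distribSum {ι : Type*} (p : ι → ℝ → Vec n) : 𝓢'(ℝ, Vec n) :=
  if h : ∃ T, HasDistribSum p T then h.choose else 0

/-- `P` is a continuous function with distributional derivative `T`. -/
def IsPrimitive (T : 𝓢'(ℝ, Vec n)) (P : ℝ → Vec n) : Prop :=
  Continuous P ∧ ∀ θ : 𝓢(ℝ, ℂ), HasCompactSupport θ → T θ = -∫ x, deriv θ x • P x

open Classical in
/-- `∫_a^b T` for a distribution `T` with a continuous primitive `P`, that is `P(b) - P(a)`; this
does not depend on `P`, and it is the usual integral if `T` is a locally integrable function. -/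
def distribIntegral (T : 𝓢'(ℝ, Vec n)) (a b : ℝ) : Vec n :=
  if h : ∃ P, IsPrimitive T P then h.choose b - h.choose a else 0

/-! ### The explicit formula -/

section Formula

variable (φ : ℕ → 𝓢(ℝ, ℂ)) (f : 𝓢'(Plane, Vec n))

/-- `∑_{k ≥ 1} 𝓕⁻¹[(iξ)⁻¹ φ_0(τ) φ_k(ξ) f̂]`. -/
def sumI (α β : ℝ) : Vec n := ∑' k : ℕ, blockIntβ φ 0 (k + 1) f α β

/-- `∑_{j ≥ 1} 𝓕⁻¹[(iτ)⁻¹ φ_j(τ) φ_0(ξ) f̂]`. -/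
def sumJ (α β : ℝ) : Vec n := ∑' j : ℕ, blockIntα φ (j + 1) 0 f α β

/-- `∑_{j, k ≥ 1} 𝓕⁻¹[((iτ)(iξ))⁻¹ φ_j(τ) φ_k(ξ) f̂]`. -/
def sumG (α β : ℝ) : Vec n := ∑' q : ℕ × ℕ, blockIntαβ φ (q.1 + 1) (q.2 + 1) f α β

/-- The terms `𝓕⁻¹[(iξ)⁻¹ φ_j(τ) φ_k(ξ) f̂](γ, -γ)`, `j, k ≥ 1`. -/
def antidiagβ (q : ℕ × ℕ) (γ : ℝ) : Vec n := blockIntβ φ (q.1 + 1) (q.2 + 1) f γ (-γ)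

/-- The terms `𝓕⁻¹[(iτ)⁻¹ φ_j(τ) φ_k(ξ) f̂](γ, -γ)`, `j, k ≥ 1`. -/
def antidiagα (q : ℕ × ℕ) (γ : ℝ) : Vec n := blockIntα φ (q.1 + 1) (q.2 + 1) f γ (-γ)

def termH (α β : ℝ) : Vec n := ∫ γ in (-β)..α, ∫ τ in (-γ)..β, block φ 0 0 f γ τ

def termI (α β : ℝ) : Vec n :=
  (∫ γ in (-β)..α, sumI φ f γ β) - ∫ γ in (-β)..α, sumI φ f γ (-γ)

def termJ (α β : ℝ) : Vec n :=
  (∫ γ in (-α)..β, sumJ φ f α γ) - ∫ γ in (-α)..β, sumJ φ f (-γ) γ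

def termG (α β : ℝ) : Vec n :=
  sumG φ f α β - (1 / 2 : ℂ) • sumG φ f α (-α) - (1 / 2 : ℂ) • sumG φ f (-β) β
    - (1 / 2 : ℂ) • distribIntegral (distribSum (antidiagβ φ f)) (-β) α
    - (1 / 2 : ℂ) • distribIntegral (distribSum (antidiagα φ f)) (-β) α

/-- `F = H + I + J + G`, the pathwise integral `∫_{-β}^α ∫_{-a}^β f(da, db)`. -/
def pathwiseIntegral (α β : ℝ) : Vec n :=
  termH φ f α β + termI φ f α β + termJ φ f α β + termG φ f α β

/-- Every series and every integral in the formula for `F` makes sense: the integrands are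
continuous, the pointwise series converge to continuous functions, and the two series under the
last two integrals converge to tempered distributions that have continuous primitives. -/
structure FormulaWellDefined : Prop where
  continuous_low : Continuous fun p : ℝ × ℝ => block φ 0 0 f p.1 p.2
  summable_I : ∀ α β : ℝ, Summable fun k : ℕ => blockIntβ φ 0 (k + 1) f α β
  continuous_I : Continuous fun p : ℝ × ℝ => sumI φ f p.1 p.2
  summable_J : ∀ α β : ℝ, Summable fun j : ℕ => blockIntα φ (j + 1) 0 f α β
  continuous_J : Continuous fun p : ℝ × ℝ => sumJ φ f p.1 p.2
  summable_G : ∀ α β : ℝ,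
    Summable fun q : ℕ × ℕ => blockIntαβ φ (q.1 + 1) (q.2 + 1) f α β
  continuous_G : Continuous fun p : ℝ × ℝ => sumG φ f p.1 p.2
  trace_β : ∃ T, HasDistribSum (antidiagβ φ f) T ∧ ∃ P, IsPrimitive T P
  trace_α : ∃ T, HasDistribSum (antidiagα φ f) T ∧ ∃ P, IsPrimitive T P

end Formula

/-! ### Distributions given by functions, traces, cut-offs -/

/-- The tempered distribution `U` is the function `F`. -/
def IsGivenBy (U : 𝓢'(Plane, Vec n)) (F : ℝ → ℝ → Vec n) : Prop :=
  ∀ θ : 𝓢(Plane, ℂ), Integrable (fun p : Plane => θ p • F (p 0) (p 1)) ∧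
    U θ = ∫ p : Plane, θ p • F (p 0) (p 1)

/-- `u(x, -x) = T(x)` in the sense of Cauchy data: in the coordinates `α = t + x`, `β = t - x`
(`dα dβ = 2 dt dx`), `u` is a weakly continuous function `t ↦ w t` of `t` with values in the
tempered distributions of `x`, and `w 0 = T`. Such a `w` is unique. -/
def HasAntidiagonalTrace (u : 𝓢'(Plane, Vec n)) (T : 𝓢'(ℝ, Vec n)) : Prop :=
  ∃ w : ℝ → 𝓢'(ℝ, Vec n),
    (∀ φ : 𝓢(ℝ, ℂ), Continuous fun t => w t φ) ∧
    (∀ (Θ : 𝓢(Plane, ℂ)) (ψ φ : 𝓢(ℝ, ℂ)), HasCompactSupport ψ →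
      (∀ t x : ℝ, Θ !₂[t + x, t - x] = ψ t * φ x) →
        u Θ = (2 : ℂ) • ∫ t : ℝ, ψ t • w t φ) ∧
    w 0 = T

/-- `U` solves `∂²U/∂α∂β = f` with `U(α, -α) = 0` and `(∂U/∂α + ∂U/∂β)(α, -α) = 0`. -/
structure IsHomogeneousSolution (f U : 𝓢'(Plane, Vec n)) : Prop where
  equation : ∂_{eα} (∂_{eβ} U) = f
  trace : HasAntidiagonalTrace U 0
  trace_deriv : HasAntidiagonalTrace (∂_{eα} U + ∂_{eβ} U) 0

/-- Even smooth cut-off functions of the line. -/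
structure IsCutoff (η : ℝ → ℝ) : Prop where
  smooth : ContDiff ℝ (⊤ : ℕ∞) η
  even : ∀ x, η (-x) = η x
  mem_Icc : ∀ x, η x ∈ Icc (0 : ℝ) 1
  tsupport_subset : tsupport η ⊆ Icc (-4 : ℝ) 4
  eq_one : ∀ x ∈ Icc (-2 : ℝ) 2, η x = 1

/-- The distribution `η(α/T) χ(β/T) U`. -/
def localize (η χ : ℝ → ℝ) (T : ℝ) (U : 𝓢'(Plane, Vec n)) : 𝓢'(Plane, Vec n) :=
  TemperedDistribution.smulLeftCLM (Vec n)
    (fun p : Plane => ((η (p 0 / T) * χ (p 1 / T) : ℝ) : ℂ)) U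

end NullWave

end

noncomputable section

namespace NullWave

variable {n : ℕ}

/-! ### The weight `1 + |x|` -/

/-! Everything reduces to one kernel on the frequency plane. If the right-hand side is the character
e^{i(τα+ξβ)}, the solution with zero Cauchy data on the antidiagonal is `Ek τ ξ α β`, the signed
integral of the character over the triangle between the point and the antidiagonal. By superposition
the solution for f with Fourier density g is `rep g` = (2π)⁻² ∫ Ek g.

The formula is this superposition cut into four frequency regions. The identities `integral_eq_Ek`,
`I_mul_Ek_right`, `I_mul_Ek_left` and `I_mul_I_mul_Ek` write Ek, iξ Ek, iτ Ek and (iτ)(iξ) Ek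
through characters and their primitives. Dividing by iξ, iτ or both, where the frequency is high,
turns H, I, J, G into the integral of Ek g against low·low, low·high, high·low and high·high. These
multipliers add up to 1, so the partition of unity drops out (`pathwiseIntegral_eq`).

All convergence rests on `norm_Ek_le`: up to polynomial growth in (α, β), |Ek| is bounded by `wt`,
that is ⟨τ⟩⁻¹⟨ξ⟩⁻¹ + (⟨τ⟩⁻¹ + ⟨ξ⟩⁻¹)⟨τ-ξ⟩⁻¹. By Cauchy-Schwarz g is integrable against `wt` as soon
as both exponents exceed 1/2 and their sum exceeds 3/2 (`lintegral_wt_mul_lt_top`); the condition on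
the sum is the price of the terms in τ-ξ and the source of the bound 3/4. The series A and B, and
the traces, are not controlled pointwise by `wt`. They are after pairing with a Schwartz function
along the antidiagonal, which supplies the factor ⟨τ-ξ⟩⁻¹ (`exists_antidiag`,
`hasAntidiagonalTrace_zero`).

For uniqueness, a solution V of the homogeneous equation has a Fourier transform carried by the two
axes, so V = a(α) + b(β) in the sense of distributions (`exists_axes`). Vanishing Cauchy data give
a(x) + b(-x) = 0 and make b constant, hence V = 0 (`eq_zero_of_trace_eq_zero`).

For the Sobolev bound, the Fourier transform of the localised solution is an integral operator
applied to g. Its kernel is dominated by `kerSum` (`exists_enorm_locE_le`), and Schur's test with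
power weights bounds that kernel between the weighted L² spaces (`kerBdd_kerSum`). -/

def brk (x : ℝ) : ℝ := 1 + |x|

lemma one_le_brk (x : ℝ) : 1 ≤ brk x := by simp [brk]

lemma brk_pos (x : ℝ) : 0 < brk x := lt_of_lt_of_le one_pos (one_le_brk x)

lemma brk_ne_zero (x : ℝ) : brk x ≠ 0 := (brk_pos x).ne'

@[simp] lemma brk_neg (x : ℝ) : brk (-x) = brk x := by simp [brk]

lemma brk_sub_comm (x y : ℝ) : brk (x - y) = brk (y - x) := by simp [brk, abs_sub_comm]

lemma brk_add_le (x y : ℝ) : brk (x + y) ≤ brk x * brk y := by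
  unfold brk
  nlinarith [abs_add_le x y, abs_nonneg x, abs_nonneg y, mul_nonneg (abs_nonneg x) (abs_nonneg y)]

lemma brk_le_mul_brk_sub (x y : ℝ) : brk x ≤ brk y * brk (x - y) := by
  simpa using brk_add_le y (x - y)

lemma continuous_brk : Continuous brk := by unfold brk; fun_prop

@[fun_prop] lemma measurable_brk : Measurable brk := continuous_brk.measurable

lemma brk_rpow_pos (p x : ℝ) : 0 < brk x ^ p := Real.rpow_pos_of_pos (brk_pos x) p

lemma integrable_brk {p : ℝ} (hp : 1 < p) : Integrable (fun x : ℝ => brk x ^ (-p)) := by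
  have := integrable_one_add_norm (E := ℝ) (μ := volume) (r := p) (by simpa using hp)
  simpa [brk] using this

/-- The weight `(1 + |x|) ^ p` with values in `[0, ∞]`. -/
def bw (p x : ℝ) : ℝ≥0∞ := ENNReal.ofReal (brk x ^ p)

lemma bw_ne_zero (p x : ℝ) : bw p x ≠ 0 := by
  simp [bw, brk_rpow_pos]

lemma bw_ne_top (p x : ℝ) : bw p x ≠ ∞ := ENNReal.ofReal_ne_top

@[fun_prop] lemma measurable_bw (p : ℝ) : Measurable (bw p) := by
  unfold bw; fun_prop

lemma bw_mul (p q x : ℝ) : bw p x * bw q x = bw (p + q) x := by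
  rw [bw, bw, bw, ← ENNReal.ofReal_mul (brk_rpow_pos p x).le, Real.rpow_add (brk_pos x)]

@[simp] lemma bw_zero (x : ℝ) : bw 0 x = 1 := by simp [bw]

lemma bw_inv (p x : ℝ) : (bw p x)⁻¹ = bw (-p) x := by
  rw [bw, bw, ← ENNReal.ofReal_inv_of_pos (brk_rpow_pos p x), Real.rpow_neg (brk_pos x).le]

lemma bw_mono {p q : ℝ} (h : p ≤ q) (x : ℝ) : bw p x ≤ bw q x :=
  ENNReal.ofReal_le_ofReal (Real.rpow_le_rpow_of_exponent_le (one_le_brk x) h)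

lemma bw_add_le {p : ℝ} (hp : 0 ≤ p) (x y : ℝ) : bw p (x + y) ≤ bw p x * bw p y := by
  rw [bw, bw, bw, ← ENNReal.ofReal_mul (brk_rpow_pos p x).le,
    ← Real.mul_rpow (brk_pos x).le (brk_pos y).le]
  exact ENNReal.ofReal_le_ofReal (Real.rpow_le_rpow (brk_pos _).le (brk_add_le x y) hp)

/-- Peetre's inequality, from the submultiplicativity of `brk`. It moves a negative power from one
frequency to another at the cost of a positive power of the difference. -/
lemma bw_neg_le {p : ℝ} (hp : 0 ≤ p) (x y : ℝ) : bw (-p) y ≤ bw (-p) x * bw p (x - y) := by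
  rw [bw, bw, bw, ← ENNReal.ofReal_mul (brk_rpow_pos _ x).le, Real.rpow_neg (brk_pos y).le,
    Real.rpow_neg (brk_pos x).le]
  apply ENNReal.ofReal_le_ofReal
  rw [inv_mul_eq_div, le_div_iff₀ (brk_rpow_pos p x), inv_mul_le_iff₀ (brk_rpow_pos p y),
    ← Real.mul_rpow (brk_pos _).le (brk_pos _).le]
  exact Real.rpow_le_rpow (brk_pos _).le (brk_le_mul_brk_sub x y) hp

lemma lintegral_bw_lt_top {p : ℝ} (hp : p < -1) : ∫⁻ x, bw p x < ∞ := by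
  have := (integrable_brk (p := -p) (by linarith)).lintegral_lt_top
  simpa [bw] using this

/-! ### Integrals over the plane -/

def planeEquiv : Plane ≃ᵐ ℝ × ℝ :=
  (MeasurableEquiv.toLp 2 (Fin 2 → ℝ)).symm.trans MeasurableEquiv.finTwoArrow

lemma planeEquiv_apply (p : Plane) : planeEquiv p = (p 0, p 1) := rfl

lemma planeEquiv_symm_apply (q : ℝ × ℝ) : planeEquiv.symm q = !₂[q.1, q.2] := by
  apply planeEquiv.injective
  simp [planeEquiv_apply]

lemma measurePreserving_planeEquiv : MeasurePreserving planeEquiv volume volume :=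
  (EuclideanSpace.volume_preserving_symm_measurableEquiv_toLp (Fin 2)).trans
    (volume_preserving_finTwoArrow ℝ)

lemma lintegral_plane {h : ℝ → ℝ → ℝ≥0∞} (hh : Measurable (Function.uncurry h)) :
    ∫⁻ ζ : Plane, h (ζ 0) (ζ 1) = ∫⁻ x, ∫⁻ y, h x y := by
  have := measurePreserving_planeEquiv.lintegral_comp hh
  exact this.trans (lintegral_prod _ hh.aemeasurable)

lemma lintegral_plane' {h : ℝ → ℝ → ℝ≥0∞} (hh : Measurable (Function.uncurry h)) :
    ∫⁻ ζ : Plane, h (ζ 0) (ζ 1) = ∫⁻ y, ∫⁻ x, h x y := by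
  rw [lintegral_plane hh, lintegral_lintegral_swap hh.aemeasurable]

lemma integral_plane {V : Type*} [NormedAddCommGroup V] [NormedSpace ℝ V] (h : Plane → V) :
    ∫ p : Plane, h p = ∫ q : ℝ × ℝ, h !₂[q.1, q.2] := by
  have := measurePreserving_planeEquiv.integral_comp' (g := fun q => h (planeEquiv.symm q))
  simpa [planeEquiv_symm_apply] using this

lemma integrable_plane_iff {V : Type*} [NormedAddCommGroup V] {h : Plane → V} :
    Integrable h ↔ Integrable (fun q : ℝ × ℝ => h !₂[q.1, q.2]) := by
  rw [← measurePreserving_planeEquiv.symm.integrable_comp_emb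
    planeEquiv.symm.measurableEmbedding]
  simp [Function.comp_def, planeEquiv_symm_apply]

/-! ### Schur test -/

/-- Cauchy-Schwarz for the splitting K h = (K p)^{1/2} (K p⁻¹ h²)^{1/2}. -/
lemma sq_lintegral_mul_le {Y : Type*} [MeasurableSpace Y] {ν : Measure Y} {K p h : Y → ℝ≥0∞}
    (hK : AEMeasurable K ν) (hp : AEMeasurable p ν) (hh : AEMeasurable h ν)
    (hp0 : ∀ y, p y ≠ 0) (hpt : ∀ y, p y ≠ ∞) :
    (∫⁻ y, K y * h y ∂ν) ^ 2 ≤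
      (∫⁻ y, K y * p y ∂ν) * ∫⁻ y, K y * ((p y)⁻¹ * h y ^ 2) ∂ν := by
  have key := ENNReal.lintegral_mul_le_Lp_mul_Lq ν Real.HolderConjugate.two_two
    (f := fun y => (K y * p y) ^ (1 / 2 : ℝ)) (g := fun y => (K y * ((p y)⁻¹ * h y ^ 2)) ^ (1 / 2 : ℝ))
    (by fun_prop) (by fun_prop)
  have e1 : ∀ x : ℝ≥0∞, (x ^ (1 / 2 : ℝ)) ^ (2 : ℝ) = x := fun x => by
    rw [← ENNReal.rpow_mul]; norm_num
  have e2 : ∀ y, ((fun y => (K y * p y) ^ (1 / 2 : ℝ)) *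
      fun y => (K y * ((p y)⁻¹ * h y ^ 2)) ^ (1 / 2 : ℝ)) y = K y * h y := fun y => by
    have : K y * p y * (K y * ((p y)⁻¹ * h y ^ 2)) = (K y * h y) ^ (2 : ℝ) := by
      rw [ENNReal.rpow_two, mul_pow]
      calc _ = K y ^ 2 * h y ^ 2 * (p y * (p y)⁻¹) := by ring
        _ = _ := by rw [ENNReal.mul_inv_cancel (hp0 y) (hpt y), mul_one]
    simp only [Pi.mul_apply]
    rw [← ENNReal.mul_rpow_of_nonneg _ _ (by norm_num), this, ← ENNReal.rpow_mul]
    norm_num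
  simp only [e1, e2] at key
  calc _ ≤ ((∫⁻ y, K y * p y ∂ν) ^ (1 / 2 : ℝ) *
        (∫⁻ y, K y * ((p y)⁻¹ * h y ^ 2) ∂ν) ^ (1 / 2 : ℝ)) ^ 2 := by gcongr
    _ = _ := by rw [mul_pow, ← ENNReal.rpow_two, ← ENNReal.rpow_two, e1, e1]

/-- After Cauchy-Schwarz with the auxiliary weight p, the row bound `h1` absorbs the output weight
m; Tonelli and the column bound `h2` leave the input weight q p⁻¹. -/
lemma schur_test {X Y : Type*} [MeasurableSpace X] [MeasurableSpace Y] {μ : Measure X}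
    {ν : Measure Y} [SFinite μ] [SFinite ν] {K : X → Y → ℝ≥0∞} {m : X → ℝ≥0∞} {p q h : Y → ℝ≥0∞}
    {A : ℝ≥0∞} (hK : Measurable (Function.uncurry K)) (hp : Measurable p)
    (hh : AEMeasurable h ν) (hp0 : ∀ y, p y ≠ 0) (hpt : ∀ y, p y ≠ ∞)
    (h1 : ∀ x, m x * ∫⁻ y, K x y * p y ∂ν ≤ A) (h2 : ∀ y, ∫⁻ x, K x y ∂μ ≤ q y) :
    ∫⁻ x, m x * (∫⁻ y, K x y * h y ∂ν) ^ 2 ∂μ ≤ A * ∫⁻ y, q y * (p y)⁻¹ * h y ^ 2 ∂ν := by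
  have hKx : ∀ x, Measurable (K x) := fun x => hK.comp measurable_prodMk_left
  have hKy : ∀ y, Measurable (fun x => K x y) := fun y => hK.comp measurable_prodMk_right
  calc ∫⁻ x, m x * (∫⁻ y, K x y * h y ∂ν) ^ 2 ∂μ
      ≤ ∫⁻ x, A * ∫⁻ y, K x y * ((p y)⁻¹ * h y ^ 2) ∂ν ∂μ := by
        refine lintegral_mono fun x => ?_
        calc _ ≤ m x * ((∫⁻ y, K x y * p y ∂ν) * ∫⁻ y, K x y * ((p y)⁻¹ * h y ^ 2) ∂ν) := by
              gcongr
              exact sq_lintegral_mul_le (hKx x).aemeasurable hp.aemeasurable hh hp0 hpt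
          _ = (m x * ∫⁻ y, K x y * p y ∂ν) * ∫⁻ y, K x y * ((p y)⁻¹ * h y ^ 2) ∂ν := by ring
          _ ≤ _ := by gcongr; exact h1 x
    _ = A * ∫⁻ x, ∫⁻ y, K x y * ((p y)⁻¹ * h y ^ 2) ∂ν ∂μ := by
        have hmeas : AEMeasurable (Function.uncurry fun x y => K x y * ((p y)⁻¹ * h y ^ 2))
            (μ.prod ν) := by
          have : AEMeasurable (fun z : X × Y => h z.2) (μ.prod ν) :=
            hh.comp_quasiMeasurePreserving Measure.quasiMeasurePreserving_snd
          have h3 : Measurable (fun z : X × Y => (p z.2)⁻¹) := by fun_prop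
          exact hK.aemeasurable.mul (h3.aemeasurable.mul (this.pow_const 2))
        exact lintegral_const_mul'' _ hmeas.lintegral_prod_right'
    _ = A * ∫⁻ y, ∫⁻ x, K x y * ((p y)⁻¹ * h y ^ 2) ∂μ ∂ν := by
        rw [lintegral_lintegral_swap]
        have : AEMeasurable (fun z : X × Y => h z.2) (μ.prod ν) :=
          hh.comp_quasiMeasurePreserving Measure.quasiMeasurePreserving_snd
        have h3 : Measurable (fun z : X × Y => (p z.2)⁻¹) := by fun_prop
        exact hK.aemeasurable.mul (h3.aemeasurable.mul (this.pow_const 2))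
    _ ≤ _ := by
        gcongr with y
        rw [lintegral_mul_const _ (hKy y), mul_assoc]
        gcongr
        exact h2 y

/-! ### The one-dimensional kernel and its integrals -/

/-- The size at frequency x of a cut-off times ∫_0 e^{iyγ} dγ: there is a gain (1+|y|)⁻¹, and the
mass sits near frequency y (the moving endpoint) and near 0 (the fixed one). The power 4 is a
convenient integer that beats every output weight used here. -/
def k0 (x y : ℝ) : ℝ≥0∞ := bw (-1) y * (bw (-4) (x - y) + bw (-4) x)

@[fun_prop] lemma Measurable.k0 {X : Type*} [MeasurableSpace X] {u v : X → ℝ} (hu : Measurable u)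
    (hv : Measurable v) : Measurable fun x => k0 (u x) (v x) := by
  unfold NullWave.k0; fun_prop

@[fun_prop] lemma Measurable.bw {X : Type*} [MeasurableSpace X] {u : X → ℝ} (p : ℝ)
    (hu : Measurable u) : Measurable fun x => bw p (u x) := (measurable_bw p).comp hu

/-- The factor (1+|y|)⁻¹ in `k0` raises the decay of the test weight to 2r. Near y = x Peetre's
inequality transfers that decay to x; near x = 0 the fourth power already beats it, and 2r > 1 makes
the remaining integral in y converge. -/
lemma exists_lintegral_k0_mul_le {r : ℝ} (h1 : 1 / 2 < r) (h2 : r < 1) :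
    ∃ A : ℝ≥0∞, A ≠ ∞ ∧ ∀ x, ∫⁻ y, k0 x y * bw (1 - 2 * r) y ≤ A * bw (-(2 * r)) x := by
  refine ⟨(∫⁻ y, bw (2 * r - 4) y) + ∫⁻ y, bw (-(2 * r)) y, ?_, fun x => ?_⟩
  · exact ENNReal.add_ne_top.2 ⟨(lintegral_bw_lt_top (by linarith)).ne,
      (lintegral_bw_lt_top (by linarith)).ne⟩
  calc ∫⁻ y, k0 x y * bw (1 - 2 * r) y
      ≤ ∫⁻ y, (bw (-(2 * r)) x * bw (2 * r - 4) (x - y) + bw (-(2 * r)) x * bw (-(2 * r)) y) := by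
        refine lintegral_mono fun y => ?_
        have e : k0 x y * bw (1 - 2 * r) y =
            bw (-(2 * r)) y * bw (-4) (x - y) + bw (-4) x * bw (-(2 * r)) y := by
          have : bw (-(2 * r)) y = bw (-1) y * bw (1 - 2 * r) y := by
            rw [bw_mul]; congr 1; ring
          rw [k0, this]; ring
        rw [e]
        refine add_le_add ?_ (mul_le_mul_left (bw_mono (by linarith) x) _)
        calc _ ≤ bw (-(2 * r)) x * bw (2 * r) (x - y) * bw (-4) (x - y) :=
              mul_le_mul_left (bw_neg_le (by linarith) x y) _
          _ = _ := by rw [mul_assoc, bw_mul]; rfl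
    _ = _ := by
        rw [lintegral_add_left (by fun_prop), lintegral_const_mul _ (by fun_prop),
          lintegral_const_mul _ (by fun_prop),
          lintegral_sub_left_eq_self (fun y => bw (2 * r - 4) y) x]
        ring

lemma lintegral_k0_left (y : ℝ) : ∫⁻ x, k0 x y = bw (-1) y * (2 * ∫⁻ x, bw (-4) x) := by
  unfold k0
  rw [lintegral_const_mul _ (by fun_prop), lintegral_add_left (by fun_prop),
    lintegral_sub_right_eq_self (fun x => bw (-4) x) y, two_mul]

/-- `∫ (1+|ω+ξ|)^{2-2r₁} (1+|ξ|)^{-2r₂} dξ ≤ C (1+|ω|)^{2-2r₁}`. -/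
lemma lintegral_bw_add_mul_le {r₁ r₂ : ℝ} (h1 : r₁ ≤ 1) (ω : ℝ) :
    ∫⁻ ξ, bw (2 - 2 * r₁) (ω + ξ) * bw (-(2 * r₂)) ξ ≤
      bw (2 - 2 * r₁) ω * ∫⁻ ξ, bw (2 - 2 * r₁ - 2 * r₂) ξ := by
  rw [← lintegral_const_mul _ (by fun_prop)]
  refine lintegral_mono fun ξ => ?_
  calc _ ≤ bw (2 - 2 * r₁) ω * bw (2 - 2 * r₁) ξ * bw (-(2 * r₂)) ξ := by
        gcongr; exact bw_add_le (by linarith) _ _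
    _ = _ := by rw [mul_assoc, bw_mul]; rfl

/-! ### Weighted bounds for the kernels in the plane -/

/-- These kernels dominate the transform of the localised `Ek`. The product comes from the
frequencies τ and ξ separately; `kerα` and `kerβ` come from the primitives at the difference
frequency τ-ξ inside the two `Q` terms, where the other variable carries only a cut-off. -/
def kerProd (x y : Plane) : ℝ≥0∞ := k0 (x 0) (y 0) * k0 (x 1) (y 1)

def kerα (x y : Plane) : ℝ≥0∞ := bw (-1) (y 1) * k0 (x 0) (y 0 - y 1) * bw (-4) (x 1)

def kerβ (x y : Plane) : ℝ≥0∞ := bw (-1) (y 0) * k0 (x 1) (y 1 - y 0) * bw (-4) (x 0)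

lemma measurable_kerProd : Measurable (Function.uncurry kerProd) := by
  unfold kerProd Function.uncurry; fun_prop

lemma measurable_kerα : Measurable (Function.uncurry kerα) := by
  unfold kerα Function.uncurry; fun_prop

/-- The weight `(1+|τ|)^{2a} (1+|ξ|)^{2b}`. -/
def pw (a b : ℝ) (ζ : Plane) : ℝ≥0∞ := bw (2 * a) (ζ 0) * bw (2 * b) (ζ 1)

@[fun_prop] lemma measurable_pw (a b : ℝ) : Measurable (pw a b) := by
  unfold pw; fun_prop

/-- The operator with kernel `K` is bounded from `L²(pw a' b')` to `L²(pw a b)`. -/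
def KerBdd (K : Plane → Plane → ℝ≥0∞) (a b a' b' : ℝ) : Prop :=
  ∃ A : ℝ≥0∞, A ≠ ∞ ∧ ∀ h : Plane → ℝ≥0∞, AEMeasurable h →
    ∫⁻ x, pw a b x * (∫⁻ y, K x y * h y) ^ 2 ≤ A * ∫⁻ y, pw a' b' y * h y ^ 2

/-- Schur's test in the form used below: the weight p is free, subject only to the quotient q/p
reproducing the input weight. -/
lemma kerBdd_of_schur {K : Plane → Plane → ℝ≥0∞} {a b a' b' : ℝ} {p q : Plane → ℝ≥0∞}
    {A B : ℝ≥0∞} (hA : A ≠ ∞) (hB : B ≠ ∞) (hK : Measurable (Function.uncurry K))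
    (hp : Measurable p) (hp0 : ∀ y, p y ≠ 0) (hpt : ∀ y, p y ≠ ∞)
    (h1 : ∀ x, pw a b x * ∫⁻ y, K x y * p y ≤ A) (h2 : ∀ y, ∫⁻ x, K x y ≤ B * q y)
    (h3 : ∀ y, q y * (p y)⁻¹ = pw a' b' y) : KerBdd K a b a' b' := by
  refine ⟨A * B, ENNReal.mul_ne_top hA hB, fun h hh => ?_⟩
  refine (schur_test hK hp hh hp0 hpt h1 h2).trans (le_of_eq ?_)
  have e : ∀ y, B * q y * (p y)⁻¹ * h y ^ 2 = B * (pw a' b' y * h y ^ 2) := fun y => by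
    rw [← h3 y]; ring
  simp only [e]
  rw [lintegral_const_mul' _ _ hB, mul_assoc]

lemma kerBdd_kerProd {r₁ r₂ : ℝ} (h1 : 1 / 2 < r₁) (h1' : r₁ < 1) (h2 : 1 / 2 < r₂)
    (h2' : r₂ < 1) : KerBdd kerProd r₁ r₂ (r₁ - 1) (r₂ - 1) := by
  obtain ⟨A₁, hA₁, hk₁⟩ := exists_lintegral_k0_mul_le h1 h1'
  obtain ⟨A₂, hA₂, hk₂⟩ := exists_lintegral_k0_mul_le h2 h2'
  set I : ℝ≥0∞ := 2 * ∫⁻ x, bw (-4) x with hI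
  have hIt : I ≠ ∞ := ENNReal.mul_ne_top (by simp) (lintegral_bw_lt_top (by norm_num)).ne
  -- The column integrals of `k0` force q = ⟨τ⟩⁻¹⟨ξ⟩⁻¹, and q/p has to be ⟨τ⟩^{2r₁-2}⟨ξ⟩^{2r₂-2};
  -- this determines p.
  refine kerBdd_of_schur (p := fun y => bw (1 - 2 * r₁) (y 0) * bw (1 - 2 * r₂) (y 1))
    (q := fun y => bw (-1) (y 0) * bw (-1) (y 1)) (A := A₁ * A₂) (B := I * I)
    (ENNReal.mul_ne_top hA₁ hA₂) (ENNReal.mul_ne_top hIt hIt) measurable_kerProd (by fun_prop)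
    (fun y => mul_ne_zero (bw_ne_zero _ _) (bw_ne_zero _ _))
    (fun y => ENNReal.mul_ne_top (bw_ne_top _ _) (bw_ne_top _ _)) (fun x => ?_) (fun y => ?_)
    (fun y => ?_)
  · have e : ∫⁻ y, kerProd x y * (bw (1 - 2 * r₁) (y 0) * bw (1 - 2 * r₂) (y 1)) =
        (∫⁻ u, k0 (x 0) u * bw (1 - 2 * r₁) u) * ∫⁻ v, k0 (x 1) v * bw (1 - 2 * r₂) v := by
      rw [← lintegral_mul_const _ (by fun_prop)]
      rw [show (∫⁻ y, kerProd x y * (bw (1 - 2 * r₁) (y 0) * bw (1 - 2 * r₂) (y 1))) =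
        ∫⁻ u, ∫⁻ v, k0 (x 0) u * k0 (x 1) v * (bw (1 - 2 * r₁) u * bw (1 - 2 * r₂) v) from
        lintegral_plane (h := fun u v => k0 (x 0) u * k0 (x 1) v *
          (bw (1 - 2 * r₁) u * bw (1 - 2 * r₂) v)) (by unfold Function.uncurry; fun_prop)]
      refine lintegral_congr fun u => ?_
      rw [← lintegral_const_mul _ (by fun_prop)]
      exact lintegral_congr fun v => by ring
    rw [e]
    calc _ ≤ pw r₁ r₂ x * ((A₁ * bw (-(2 * r₁)) (x 0)) * (A₂ * bw (-(2 * r₂)) (x 1))) := by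
          gcongr
          · exact hk₁ _
          · exact hk₂ _
      _ = A₁ * A₂ * (bw (2 * r₁) (x 0) * bw (-(2 * r₁)) (x 0)) *
            (bw (2 * r₂) (x 1) * bw (-(2 * r₂)) (x 1)) := by unfold pw; ring
      _ = A₁ * A₂ := by rw [bw_mul, bw_mul]; simp
      _ ≤ _ := le_rfl
  · rw [show (∫⁻ x, kerProd x y) = ∫⁻ u, ∫⁻ v, k0 u (y 0) * k0 v (y 1) from
      lintegral_plane (h := fun u v => k0 u (y 0) * k0 v (y 1))
        (by unfold Function.uncurry; fun_prop)]
    refine le_of_eq ?_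
    calc _ = ∫⁻ u, k0 u (y 0) * ∫⁻ v, k0 v (y 1) :=
          lintegral_congr fun u => lintegral_const_mul _ (by fun_prop)
      _ = _ := by
          rw [lintegral_mul_const _ (by fun_prop), lintegral_k0_left, lintegral_k0_left]; ring
  · rw [ENNReal.mul_inv (Or.inl (bw_ne_zero _ _)) (Or.inl (bw_ne_top _ _)), bw_inv, bw_inv, pw]
    calc _ = (bw (-1) (y 0) * bw (-(1 - 2 * r₁)) (y 0)) *
          (bw (-1) (y 1) * bw (-(1 - 2 * r₂)) (y 1)) := by ring
      _ = _ := by rw [bw_mul, bw_mul]; congr 2 <;> ring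

/-- With ω = u - v, the inner integral over v at fixed ω has total decay 2r₁ + 2r₂ - 2, which must
exceed 1: this is the condition r₁ + r₂ > 3/2. What remains in ω is the one-dimensional row bound
for `k0`. -/
lemma exists_lintegral_shear_le {r₁ r₂ : ℝ} (h1 : 1 / 2 < r₁) (h1' : r₁ < 1)
    (h : 3 / 2 < r₁ + r₂) : ∃ A : ℝ≥0∞, A ≠ ∞ ∧ ∀ x, ∫⁻ v, ∫⁻ u,
      bw (-1) v * k0 x (u - v) * (bw (-1) (u - v) * bw (2 - 2 * r₁) u * bw (1 - 2 * r₂) v) ≤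
        A * bw (-(2 * r₁)) x := by
  obtain ⟨A, hA, hk⟩ := exists_lintegral_k0_mul_le h1 h1'
  set I : ℝ≥0∞ := ∫⁻ ξ, bw (2 - 2 * r₁ - 2 * r₂) ξ
  have hI : I ≠ ∞ := (lintegral_bw_lt_top (by linarith)).ne
  refine ⟨I * A, ENNReal.mul_ne_top hI hA, fun x => ?_⟩
  calc _ = ∫⁻ v, ∫⁻ ω, bw (-1) v * k0 x ω *
        (bw (-1) ω * bw (2 - 2 * r₁) (ω + v) * bw (1 - 2 * r₂) v) := by
        refine lintegral_congr fun v => ?_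
        rw [← lintegral_sub_right_eq_self (fun ω => bw (-1) v * k0 x ω *
          (bw (-1) ω * bw (2 - 2 * r₁) (ω + v) * bw (1 - 2 * r₂) v)) v]
        simp only [sub_add_cancel]
    _ = ∫⁻ ω, ∫⁻ v, bw (-1) v * k0 x ω *
        (bw (-1) ω * bw (2 - 2 * r₁) (ω + v) * bw (1 - 2 * r₂) v) := by
        rw [lintegral_lintegral_swap]
        apply Measurable.aemeasurable
        unfold Function.uncurry; fun_prop
    _ = ∫⁻ ω, k0 x ω * bw (-1) ω *
          ∫⁻ v, bw (2 - 2 * r₁) (ω + v) * bw (-(2 * r₂)) v := by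
        refine lintegral_congr fun ω => ?_
        rw [← lintegral_const_mul _ (by fun_prop)]
        refine lintegral_congr fun v => ?_
        have : bw (-(2 * r₂)) v = bw (-1) v * bw (1 - 2 * r₂) v := by
          rw [bw_mul]; congr 1; ring
        rw [this]; ring
    _ ≤ ∫⁻ ω, k0 x ω * bw (-1) ω * (bw (2 - 2 * r₁) ω * I) := by
        gcongr with ω
        exact lintegral_bw_add_mul_le h1'.le ω
    _ = I * ∫⁻ ω, k0 x ω * bw (1 - 2 * r₁) ω := by
        rw [← lintegral_const_mul _ (by fun_prop)]
        refine lintegral_congr fun ω => ?_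
        have : bw (1 - 2 * r₁) ω = bw (-1) ω * bw (2 - 2 * r₁) ω := by
          rw [bw_mul]; congr 1; ring
        rw [this]; ring
    _ ≤ I * (A * bw (-(2 * r₁)) x) := by gcongr; exact hk x
    _ = _ := by ring

/-- The output in the second variable is only the transform of a cut-off, so the fourth power there
pays for any exponent up to 2; the first variable is handled by the shear estimate. -/
lemma kerBdd_kerα {r₁ r₂ o₁ o₂ : ℝ} (h1 : 1 / 2 < r₁) (h1' : r₁ < 1)
    (h : 3 / 2 < r₁ + r₂) (ho₁ : o₁ ≤ r₁) (ho₂ : o₂ ≤ 2) :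
    KerBdd kerα o₁ o₂ (r₁ - 1) (r₂ - 1) := by
  obtain ⟨A, hA, hk⟩ := exists_lintegral_shear_le h1 h1' h
  set J : ℝ≥0∞ := ∫⁻ x, bw (-4) x with hJ
  have hJt : J ≠ ∞ := (lintegral_bw_lt_top (by norm_num)).ne
  -- The column integral produces ⟨τ-ξ⟩⁻¹, which is absent from the input weight; p therefore
  -- carries the same factor, and the two cancel in q/p.
  refine kerBdd_of_schur
    (p := fun y => bw (-1) (y 0 - y 1) * bw (2 - 2 * r₁) (y 0) * bw (1 - 2 * r₂) (y 1))
    (q := fun y => bw (-1) (y 1) * bw (-1) (y 0 - y 1)) (A := A) (B := 2 * J * J)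
    hA (ENNReal.mul_ne_top (ENNReal.mul_ne_top (by simp) hJt) hJt) measurable_kerα (by fun_prop)
    (fun y => mul_ne_zero (mul_ne_zero (bw_ne_zero _ _) (bw_ne_zero _ _)) (bw_ne_zero _ _))
    (fun y => ENNReal.mul_ne_top (ENNReal.mul_ne_top (bw_ne_top _ _) (bw_ne_top _ _))
      (bw_ne_top _ _)) (fun x => ?_) (fun y => ?_) (fun y => ?_)
  · have e : ∫⁻ y, kerα x y *
          (bw (-1) (y 0 - y 1) * bw (2 - 2 * r₁) (y 0) * bw (1 - 2 * r₂) (y 1)) =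
        bw (-4) (x 1) * ∫⁻ v, ∫⁻ u, bw (-1) v * k0 (x 0) (u - v) *
          (bw (-1) (u - v) * bw (2 - 2 * r₁) u * bw (1 - 2 * r₂) v) := by
      rw [← lintegral_const_mul' _ _ (bw_ne_top _ _)]
      rw [show (∫⁻ y, kerα x y *
          (bw (-1) (y 0 - y 1) * bw (2 - 2 * r₁) (y 0) * bw (1 - 2 * r₂) (y 1))) =
          ∫⁻ v, ∫⁻ u, bw (-1) v * k0 (x 0) (u - v) * bw (-4) (x 1) *
          (bw (-1) (u - v) * bw (2 - 2 * r₁) u * bw (1 - 2 * r₂) v) from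
        lintegral_plane' (h := fun u v => bw (-1) v * k0 (x 0) (u - v) * bw (-4) (x 1) *
          (bw (-1) (u - v) * bw (2 - 2 * r₁) u * bw (1 - 2 * r₂) v))
          (by unfold Function.uncurry; fun_prop)]
      refine lintegral_congr fun v => ?_
      rw [← lintegral_const_mul' _ _ (bw_ne_top _ _)]
      exact lintegral_congr fun u => by ring
    rw [e]
    calc _ ≤ (bw (2 * r₁) (x 0) * bw 4 (x 1)) * (bw (-4) (x 1) * (A * bw (-(2 * r₁)) (x 0))) := by
          unfold pw
          gcongr
          · exact bw_mono (by linarith) _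
          · exact bw_mono (by linarith) _
          · exact hk _
      _ = A * (bw (2 * r₁) (x 0) * bw (-(2 * r₁)) (x 0)) * (bw 4 (x 1) * bw (-4) (x 1)) := by ring
      _ = A := by rw [bw_mul, bw_mul]; simp
      _ ≤ _ := le_rfl
  · rw [show (∫⁻ x, kerα x y) = ∫⁻ u, ∫⁻ v, bw (-1) (y 1) * k0 u (y 0 - y 1) * bw (-4) v from
      lintegral_plane (h := fun u v => bw (-1) (y 1) * k0 u (y 0 - y 1) * bw (-4) v)
        (by unfold Function.uncurry; fun_prop)]
    refine le_of_eq ?_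
    calc _ = ∫⁻ u, bw (-1) (y 1) * k0 u (y 0 - y 1) * J :=
          lintegral_congr fun u => lintegral_const_mul _ (by fun_prop)
      _ = _ := by
          rw [lintegral_mul_const _ (by fun_prop), lintegral_const_mul _ (by fun_prop),
            lintegral_k0_left, ← hJ]; ring
  · rw [ENNReal.mul_inv (Or.inr (bw_ne_top _ _)) (Or.inr (bw_ne_zero _ _)),
      ENNReal.mul_inv (Or.inl (bw_ne_zero _ _)) (Or.inl (bw_ne_top _ _)), bw_inv, bw_inv, bw_inv,
      pw]
    calc _ = (bw (-1) (y 0 - y 1) * bw (- -1) (y 0 - y 1)) * bw (-(2 - 2 * r₁)) (y 0) *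
          (bw (-1) (y 1) * bw (-(1 - 2 * r₂)) (y 1)) := by ring
      _ = _ := by rw [bw_mul, bw_mul]; simp only [add_neg_cancel, bw_zero, one_mul]; congr 2 <;> ring

/-- The swap of the two coordinates. -/
def swapPlane (ζ : Plane) : Plane := !₂[ζ 1, ζ 0]

@[simp] lemma swapPlane_zero (ζ : Plane) : swapPlane ζ 0 = ζ 1 := rfl
@[simp] lemma swapPlane_one (ζ : Plane) : swapPlane ζ 1 = ζ 0 := rfl

lemma measurePreserving_swapPlane : MeasurePreserving swapPlane volume volume := by
  have h : swapPlane = planeEquiv.symm ∘ Prod.swap ∘ planeEquiv := by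
    funext ζ
    simp [planeEquiv_symm_apply, planeEquiv_apply, swapPlane]
  rw [h]
  exact measurePreserving_planeEquiv.symm.comp
    (Measure.measurePreserving_swap.comp measurePreserving_planeEquiv)

lemma measurableEmbedding_swapPlane : MeasurableEmbedding swapPlane := by
  have h : swapPlane = planeEquiv.symm ∘ MeasurableEquiv.prodComm ∘ planeEquiv := by
    funext ζ
    exact (planeEquiv_symm_apply (ζ 1, ζ 0)).symm
  rw [h]
  exact planeEquiv.symm.measurableEmbedding.comp
    (MeasurableEquiv.prodComm.measurableEmbedding.comp planeEquiv.measurableEmbedding)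

lemma lintegral_swapPlane (h : Plane → ℝ≥0∞) : ∫⁻ ζ, h (swapPlane ζ) = ∫⁻ ζ, h ζ :=
  measurePreserving_swapPlane.lintegral_comp_emb measurableEmbedding_swapPlane h

/-- The exchange of the two coordinates turns this kernel into the previous one with the exponents
exchanged. -/
lemma kerBdd_kerβ {r₁ r₂ o₁ o₂ : ℝ} (h2 : 1 / 2 < r₂) (h2' : r₂ < 1)
    (h : 3 / 2 < r₁ + r₂) (ho₂ : o₂ ≤ r₂) (ho₁ : o₁ ≤ 2) :
    KerBdd kerβ o₁ o₂ (r₁ - 1) (r₂ - 1) := by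
  obtain ⟨A, hA, hk⟩ := kerBdd_kerα (r₁ := r₂) (r₂ := r₁) (o₁ := o₂) (o₂ := o₁) h2 h2'
    (by linarith) ho₂ ho₁
  refine ⟨A, hA, fun h hh => ?_⟩
  have := hk (fun ζ => h (swapPlane ζ))
    (hh.comp_quasiMeasurePreserving measurePreserving_swapPlane.quasiMeasurePreserving)
  rw [← lintegral_swapPlane, ← lintegral_swapPlane (fun y => pw _ _ y * h y ^ 2)]
  have e1 : ∀ (a b : ℝ) x, pw a b (swapPlane x) = pw b a x := fun a b x => by
    simp [pw, mul_comm]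
  simp only [e1]
  refine le_trans (le_of_eq (lintegral_congr fun x => ?_)) this
  rw [← lintegral_swapPlane]
  rfl

/-! ### The characters -/

/-- `ex x = e^{ix}`. -/
def ex (x : ℝ) : ℂ := Complex.exp (Complex.I * x)

@[simp] lemma ex_zero : ex 0 = 1 := by simp [ex]

lemma ex_add (x y : ℝ) : ex (x + y) = ex x * ex y := by
  simp [ex, mul_add, Complex.exp_add]

@[simp] lemma norm_ex (x : ℝ) : ‖ex x‖ = 1 := by
  rw [ex, mul_comm]; exact Complex.norm_exp_ofReal_mul_I x

lemma hasDerivAt_ex (x : ℝ) : HasDerivAt ex (Complex.I * ex x) x := by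
  have h : HasDerivAt (fun y : ℝ => Complex.I * (y : ℂ)) (Complex.I * 1) x :=
    (Complex.ofRealCLM.hasDerivAt (x := x)).const_mul Complex.I
  have := h.cexp
  rw [mul_one, mul_comm] at this
  exact this

@[fun_prop] lemma continuous_ex : Continuous ex := by unfold ex; fun_prop

lemma conj_ex (x : ℝ) : (starRingEnd ℂ) (ex x) = ex (-x) := by
  simp [ex, ← Complex.exp_conj]

lemma hasDerivAt_ex_mul (ω x : ℝ) : HasDerivAt (fun y => ex (ω * y)) (Complex.I * ω * ex (ω * x)) x := by
  have := (hasDerivAt_ex (ω * x)).scomp x ((hasDerivAt_id x).const_mul ω)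
  refine this.congr_deriv ?_
  simp; ring

/-! ### Interchange of integrals -/

lemma intervalIntegral_integral_smul_swap {X V : Type*} [TopologicalSpace X]
    [SecondCountableTopology X] [MeasurableSpace X] [BorelSpace X] {μ : Measure X} [SFinite μ]
    [NormedAddCommGroup V] [NormedSpace ℂ V] [CompleteSpace V] {a b : ℝ} {k : ℝ → X → ℂ} {G : X → V} {v : X → ℝ}
    (hk : Continuous (Function.uncurry k)) (hG : AEStronglyMeasurable G μ)
    (hb : ∀ t ∈ uIcc a b, ∀ x, ‖k t x‖ ≤ v x) (hv : Integrable (fun x => v x * ‖G x‖) μ) :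
    ∫ t in a..b, ∫ x, k t x • G x ∂μ = ∫ x, (∫ t in a..b, k t x) • G x ∂μ := by
  have : IsFiniteMeasure (volume.restrict (uIoc a b)) := ⟨by simp [uIoc]⟩
  have hint : Integrable (Function.uncurry fun t x => k t x • G x)
      ((volume.restrict (uIoc a b)).prod μ) := by
    refine Integrable.mono' (hv.comp_snd _) ?_ ?_
    · refine hk.aestronglyMeasurable.smul ?_
      exact hG.comp_quasiMeasurePreserving Measure.quasiMeasurePreserving_snd
    · have h1 : ∀ᵐ p : ℝ × X ∂((volume.restrict (uIoc a b)).prod μ), p.1 ∈ uIoc a b := by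
        have : ∀ᵐ t ∂(volume.restrict (uIoc a b)), t ∈ uIoc a b :=
          ae_restrict_mem measurableSet_uIoc
        exact Measure.quasiMeasurePreserving_fst.ae this
      filter_upwards [h1] with p hp
      simp only [Function.uncurry, norm_smul]
      gcongr
      exact hb _ (uIoc_subset_uIcc hp) _
  simp only [intervalIntegral.intervalIntegral_eq_integral_uIoc]
  rw [integral_integral_swap hint, ← integral_smul]
  refine integral_congr_ae (ae_of_all _ fun x => ?_)
  simp only
  rw [integral_smul_const, smul_assoc]

/-- All identities between `D`, `Q` and `Ek` are proved by comparing derivatives and one value.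
Stated with the frequency as a factor rather than a divisor, they hold at frequency zero as well. -/
lemma eq_of_hasDerivAt_eq {u v u' : ℝ → ℂ} (hu : ∀ x, HasDerivAt u (u' x) x)
    (hv : ∀ x, HasDerivAt v (u' x) x) (a : ℝ) (h : u a = v a) (x : ℝ) : u x = v x := by
  have hd : ∀ y, HasDerivAt (fun y => u y - v y) 0 y := fun y => by
    have := (hu y).sub (hv y)
    rwa [sub_self] at this
  have := is_const_of_deriv_eq_zero (fun y => (hd y).differentiableAt) (fun y => (hd y).deriv) x a
  rw [h, sub_self] at this
  exact sub_eq_zero.1 this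

/-! ### The primitives `D` and `Q` -/

/-- `∫_0^x e^{iωγ} dγ`. -/
def D (ω x : ℝ) : ℂ := ∫ γ in (0 : ℝ)..x, ex (ω * γ)

@[fun_prop] lemma _root_.Continuous.nullD {X : Type*} [TopologicalSpace X] {f g : X → ℝ}
    (hf : Continuous f) (hg : Continuous g) : Continuous fun x => D (f x) (g x) :=
  intervalIntegral.continuous_parametric_intervalIntegral_of_continuous
    (f := fun x γ => ex (f x * γ)) (by unfold Function.uncurry; fun_prop) hg

lemma hasDerivAt_D (ω x : ℝ) : HasDerivAt (D ω) (ex (ω * x)) x := by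
  have hc : Continuous fun γ => ex (ω * γ) := by fun_prop
  exact (hc.integral_hasStrictDerivAt 0 x).hasDerivAt

@[simp] lemma D_zero (ω : ℝ) : D ω 0 = 0 := by simp [D]

lemma hasDerivAt_D_neg (ω x : ℝ) : HasDerivAt (fun y => D ω (-y)) (-ex (-(ω * x))) x := by
  have := (hasDerivAt_D ω (-x)).scomp x (hasDerivAt_neg x)
  simpa [Function.comp_def] using this

lemma D_neg (ω x : ℝ) : D ω (-x) = -D (-ω) x := by
  have h (y : ℝ) : HasDerivAt (fun x => -D (-ω) x) (-ex (-(ω * y))) y := by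
    have := (hasDerivAt_D (-ω) y).neg
    rwa [neg_mul] at this
  exact eq_of_hasDerivAt_eq (hasDerivAt_D_neg ω) h 0 (by simp) x

lemma I_mul_D (ω x : ℝ) : Complex.I * ω * D ω x = ex (ω * x) - 1 := by
  refine eq_of_hasDerivAt_eq (u := fun x => Complex.I * ω * D ω x) (v := fun x => ex (ω * x) - 1)
    (u' := fun x => Complex.I * ω * ex (ω * x))
    (fun y => (hasDerivAt_D ω y).const_mul _) (fun y => (hasDerivAt_ex_mul ω y).sub_const 1)
    0 (by simp) x

lemma norm_D_le (ω x : ℝ) : ‖D ω x‖ ≤ |x| := by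
  have := intervalIntegral.norm_integral_le_of_norm_le_const (a := 0) (b := x) (C := 1)
    (f := fun γ => ex (ω * γ)) (fun γ _ => (norm_ex _).le)
  simpa [D] using this

lemma abs_mul_norm_D_le (ω x : ℝ) : |ω| * ‖D ω x‖ ≤ 2 := by
  have : ‖Complex.I * ω * D ω x‖ ≤ 2 := by
    rw [I_mul_D]
    exact (norm_sub_le _ _).trans (by simp; norm_num)
  simpa using this

/-- Sum of the trivial bound |x| and of the bound 2/|ω| obtained by integrating the character. -/
lemma norm_D_le_brk (ω x : ℝ) : ‖D ω x‖ ≤ (|x| + 2) * (brk ω)⁻¹ := by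
  rw [le_mul_inv_iff₀ (brk_pos ω), brk]
  nlinarith [norm_D_le ω x, abs_mul_norm_D_le ω x]

lemma conj_D (ω x : ℝ) : (starRingEnd ℂ) (D ω x) = D (-ω) x := by
  unfold D
  simp only [intervalIntegral, map_sub, ← integral_conj, conj_ex, neg_mul]

/-- `∫_0^x e^{iτγ} ∫_{-γ}^0 e^{iξσ} dσ dγ`. -/
def Q (τ ξ x : ℝ) : ℂ := -∫ γ in (0 : ℝ)..x, ex (τ * γ) * D ξ (-γ)

@[fun_prop] lemma _root_.Continuous.nullQ {X : Type*} [TopologicalSpace X] {f g h : X → ℝ}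
    (hf : Continuous f) (hg : Continuous g) (hh : Continuous h) :
    Continuous fun x => Q (f x) (g x) (h x) :=
  (intervalIntegral.continuous_parametric_intervalIntegral_of_continuous
    (f := fun x γ => ex (f x * γ) * D (g x) (-γ)) (by unfold Function.uncurry; fun_prop) hh).neg

@[simp] lemma Q_zero (τ ξ : ℝ) : Q τ ξ 0 = 0 := by simp [Q]

lemma hasDerivAt_Q (τ ξ x : ℝ) : HasDerivAt (Q τ ξ) (-(ex (τ * x) * D ξ (-x))) x := by
  have hc : Continuous fun γ => ex (τ * γ) * D ξ (-γ) := by fun_prop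
  exact (hc.integral_hasStrictDerivAt 0 x).hasDerivAt.neg

/-- Multiplication by iξ evaluates the inner integral to a difference of characters, and each
character is integrated once more. -/
lemma I_mul_Q_right (τ ξ x : ℝ) : Complex.I * ξ * Q τ ξ x = D τ x - D (τ - ξ) x := by
  refine eq_of_hasDerivAt_eq (u := fun x => Complex.I * ξ * Q τ ξ x)
    (v := fun x => D τ x - D (τ - ξ) x) (u' := fun x => Complex.I * ξ * (-(ex (τ * x) * D ξ (-x))))
    (fun y => (hasDerivAt_Q τ ξ y).const_mul _) (fun y => ?_) 0 (by simp) x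
  refine ((hasDerivAt_D τ y).sub (hasDerivAt_D (τ - ξ) y)).congr_deriv ?_
  have h1 := I_mul_D ξ (-y)
  have h2 : ex ((τ - ξ) * y) = ex (τ * y) * ex (ξ * -y) := by rw [← ex_add]; ring_nf
  rw [h2]
  linear_combination ex (τ * y) * h1

/-- This is integration by parts in the outer variable, where iτ falls on e^{iτγ}. -/
lemma I_mul_Q_left (τ ξ x : ℝ) :
    Complex.I * τ * Q τ ξ x = -(ex (τ * x) * D ξ (-x)) - D (τ - ξ) x := by
  refine eq_of_hasDerivAt_eq (u := fun x => Complex.I * τ * Q τ ξ x)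
    (v := fun x => -(ex (τ * x) * D ξ (-x)) - D (τ - ξ) x)
    (u' := fun x => Complex.I * τ * (-(ex (τ * x) * D ξ (-x))))
    (fun y => (hasDerivAt_Q τ ξ y).const_mul _) (fun y => ?_) 0 (by simp) x
  refine (((hasDerivAt_ex_mul τ y).mul (hasDerivAt_D_neg ξ y)).neg.sub
    (hasDerivAt_D (τ - ξ) y)).congr_deriv ?_
  have h2 : ex ((τ - ξ) * y) = ex (τ * y) * ex (-(ξ * y)) := by rw [← ex_add]; ring_nf
  rw [h2]; ring

lemma norm_Q_le (τ ξ x : ℝ) : ‖Q τ ξ x‖ ≤ |x| * |x| := by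
  have := intervalIntegral.norm_integral_le_of_norm_le_const (a := 0) (b := x) (C := |x|)
    (f := fun γ => ex (τ * γ) * D ξ (-γ)) (fun γ hγ => by
      rw [norm_mul, norm_ex, one_mul]
      refine (norm_D_le _ _).trans ?_
      rw [abs_neg]
      have := abs_sub_left_of_mem_uIcc (uIoc_subset_uIcc hγ)
      simpa using this)
  simpa [Q] using this

lemma conj_Q (τ ξ x : ℝ) : (starRingEnd ℂ) (Q τ ξ x) = Q (-τ) (-ξ) x := by
  unfold Q
  simp only [intervalIntegral, map_neg, map_sub, ← integral_conj, map_mul, conj_ex, conj_D, neg_mul]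

lemma inv_abs_le {x : ℝ} (hx : 1 ≤ |x|) : |x|⁻¹ ≤ 2 * (brk x)⁻¹ := by
  rw [brk, ← div_eq_mul_inv, inv_eq_one_div, div_le_div_iff₀ (by linarith) (by positivity)]
  linarith

lemma one_le_two_mul_inv_brk {x : ℝ} (hx : |x| ≤ 1) : 1 ≤ 2 * (brk x)⁻¹ := by
  rw [brk, ← div_eq_mul_inv, le_div_iff₀ (by positivity)]
  linarith

lemma inv_brk_pos (x : ℝ) : 0 < (brk x)⁻¹ := inv_pos.2 (brk_pos x)

/-- For |ξ| ≥ 1 one divides `I_mul_Q_right` by ξ. For |ξ| ≤ 1 the factor in ξ is harmless, and the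
decay in τ comes from `I_mul_Q_left` together with the trivial bound. -/
lemma norm_Q_le_brk (τ ξ x : ℝ) :
    ‖Q τ ξ x‖ ≤ 2 * (|x| + 2) ^ 2 * ((brk ξ)⁻¹ * ((brk τ)⁻¹ + (brk (τ - ξ))⁻¹)) := by
  have hτ := inv_brk_pos τ
  have hξ := inv_brk_pos ξ
  have hd := inv_brk_pos (τ - ξ)
  have hx := abs_nonneg x
  rcases le_total 1 |ξ| with h | h
  · have h1 : |ξ| * ‖Q τ ξ x‖ ≤ (|x| + 2) * ((brk τ)⁻¹ + (brk (τ - ξ))⁻¹) := by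
      have : ‖Complex.I * ξ * Q τ ξ x‖ ≤ (|x| + 2) * ((brk τ)⁻¹ + (brk (τ - ξ))⁻¹) := by
        rw [I_mul_Q_right, mul_add]
        exact (norm_sub_le _ _).trans (add_le_add (norm_D_le_brk _ _) (norm_D_le_brk _ _))
      simpa using this
    calc ‖Q τ ξ x‖ = |ξ|⁻¹ * (|ξ| * ‖Q τ ξ x‖) := by
          rw [inv_mul_cancel_left₀ (by positivity)]
      _ ≤ 2 * (brk ξ)⁻¹ * ((|x| + 2) * ((brk τ)⁻¹ + (brk (τ - ξ))⁻¹)) := by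
          gcongr; exact inv_abs_le h
      _ = 2 * (|x| + 2) * ((brk ξ)⁻¹ * ((brk τ)⁻¹ + (brk (τ - ξ))⁻¹)) := by ring
      _ ≤ _ := by gcongr; nlinarith
  · have h1 : |τ| * ‖Q τ ξ x‖ ≤ |x| + |x| := by
      have : ‖Complex.I * τ * Q τ ξ x‖ ≤ |x| + |x| := by
        rw [I_mul_Q_left]
        refine (norm_sub_le _ _).trans (add_le_add ?_ (norm_D_le _ _))
        simpa using norm_D_le ξ (-x)
      simpa using this
    -- The trivial bound |x|² and the bound 2|x| for |τ||Q| add up to less than (|x|+2)².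
    have h2 : ‖Q τ ξ x‖ ≤ (|x| + 2) ^ 2 * (brk τ)⁻¹ := by
      rw [le_mul_inv_iff₀ (brk_pos τ), brk]
      nlinarith [norm_Q_le τ ξ x]
    calc ‖Q τ ξ x‖ ≤ (|x| + 2) ^ 2 * (brk τ)⁻¹ := h2
      _ ≤ (|x| + 2) ^ 2 * ((brk τ)⁻¹ + (brk (τ - ξ))⁻¹) := by gcongr; linarith
      _ ≤ (|x| + 2) ^ 2 * ((brk τ)⁻¹ + (brk (τ - ξ))⁻¹) * (2 * (brk ξ)⁻¹) :=
          le_mul_of_one_le_right (by positivity) (one_le_two_mul_inv_brk h)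
      _ = _ := by ring

/-! ### The solution with right-hand side a character -/

/-- `∫_{-β}^α ∫_{-γ}^β e^{i(τγ + ξσ)} dσ dγ`. -/
def Ek (τ ξ α β : ℝ) : ℂ := D τ α * D ξ β + Q τ ξ α + Q ξ τ β

@[fun_prop] lemma _root_.Continuous.nullE {X : Type*} [TopologicalSpace X] {f g h k : X → ℝ}
    (hf : Continuous f) (hg : Continuous g) (hh : Continuous h) (hk : Continuous k) :
    Continuous fun x => Ek (f x) (g x) (h x) (k x) := by
  unfold Ek; fun_prop

lemma Ek_swap (τ ξ α β : ℝ) : Ek τ ξ α β = Ek ξ τ β α := by unfold Ek; ring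

lemma conj_Ek (τ ξ α β : ℝ) : (starRingEnd ℂ) (Ek τ ξ α β) = Ek (-τ) (-ξ) α β := by
  simp [Ek, conj_D, conj_Q]

lemma hasDerivAt_Ek_left (τ ξ α β : ℝ) :
    HasDerivAt (fun x => Ek τ ξ x β) (ex (τ * α) * (D ξ β - D ξ (-α))) α := by
  refine ((((hasDerivAt_D τ α).mul_const (D ξ β)).add (hasDerivAt_Q τ ξ α)).add_const
    (Q ξ τ β)).congr_deriv ?_
  ring

lemma hasDerivAt_Ek_right (τ ξ α β : ℝ) :
    HasDerivAt (fun y => Ek τ ξ α y) (ex (ξ * β) * (D τ α - D τ (-β))) β := by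
  simp only [Ek_swap τ ξ]
  exact hasDerivAt_Ek_left ξ τ β α

/-- The derivative along the antidiagonal vanishes identically, and so does the value at the origin.
-/
lemma Ek_antidiag (τ ξ α : ℝ) : Ek τ ξ α (-α) = 0 := by
  refine eq_of_hasDerivAt_eq (u := fun x => Ek τ ξ x (-x)) (v := fun _ => 0) (u' := fun _ => 0)
    (fun y => ?_) (fun y => hasDerivAt_const y 0) 0 (by simp [Ek]) α
  have h3 : HasDerivAt (fun x => Q ξ τ (-x)) (ex (-(ξ * y)) * D τ y) y := by
    have := (hasDerivAt_Q ξ τ (-y)).scomp y (hasDerivAt_neg y)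
    simpa [Function.comp_def] using this
  refine ((((hasDerivAt_D τ y).mul (hasDerivAt_D_neg ξ y)).add (hasDerivAt_Q τ ξ y)).add
    h3).congr_deriv ?_
  ring

lemma integral_eq_Ek (τ ξ α β : ℝ) :
    ∫ γ in (-β)..α, ex (τ * γ) * (D ξ β - D ξ (-γ)) = Ek τ ξ α β := by
  have hc : Continuous fun γ => ex (τ * γ) * (D ξ β - D ξ (-γ)) := by fun_prop
  rw [intervalIntegral.integral_eq_sub_of_hasDerivAt
    (fun x _ => hasDerivAt_Ek_left τ ξ x β) (hc.intervalIntegrable _ _)]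
  have := Ek_antidiag τ ξ (-β)
  rw [neg_neg] at this
  rw [this, sub_zero]

lemma I_mul_Ek_right (τ ξ α β : ℝ) : Complex.I * ξ * Ek τ ξ α β =
    ex (ξ * β) * (D τ α - D τ (-β)) - (D (τ - ξ) α - D (τ - ξ) (-β)) := by
  have h1 := I_mul_D ξ β
  have h2 := I_mul_Q_right τ ξ α
  have h3 := I_mul_Q_left ξ τ β
  have h4 : D (ξ - τ) β = -D (τ - ξ) (-β) := by rw [D_neg]; simp
  rw [h4] at h3
  unfold Ek
  linear_combination D τ α * h1 + h2 + h3

lemma I_mul_Ek_left (τ ξ α β : ℝ) : Complex.I * τ * Ek τ ξ α β =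
    ex (τ * α) * (D ξ β - D ξ (-α)) - (D (ξ - τ) β - D (ξ - τ) (-α)) := by
  rw [Ek_swap, I_mul_Ek_right]

/-- This is the source of the halves in G. Multiplying `I_mul_Ek_right` by iτ leaves iτ times a
primitive at frequency τ-ξ. Writing iτ as ½iτ + ½iξ + ½i(τ-ξ), the last part acts on that primitive
as differentiation and gives characters, which halve the boundary terms and make the formula
symmetric. -/
lemma I_mul_I_mul_Ek (τ ξ α β : ℝ) : (Complex.I * τ) * (Complex.I * ξ) * Ek τ ξ α β =
    ex (τ * α + ξ * β) - 1 / 2 * ex (τ * α + ξ * (-α)) - 1 / 2 * ex (τ * (-β) + ξ * β)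
      - 1 / 2 * (Complex.I * τ) * (D (τ - ξ) α - D (τ - ξ) (-β))
      - 1 / 2 * (Complex.I * ξ) * (D (τ - ξ) α - D (τ - ξ) (-β)) := by
  have h1 := I_mul_Ek_right τ ξ α β
  have h2 := I_mul_D τ α
  have h3 := I_mul_D τ (-β)
  have h4 := I_mul_D (τ - ξ) α
  have h5 := I_mul_D (τ - ξ) (-β)
  have e1 : ex (τ * α + ξ * β) = ex (τ * α) * ex (ξ * β) := ex_add _ _
  have e2 : ex (τ * (-β) + ξ * β) = ex (τ * (-β)) * ex (ξ * β) := ex_add _ _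
  have e3 : ex ((τ - ξ) * α) = ex (τ * α + ξ * (-α)) := by ring_nf
  have e4 : ex ((τ - ξ) * (-β)) = ex (τ * (-β)) * ex (ξ * β) := by rw [← ex_add]; ring_nf
  rw [e1, e2]
  rw [e3] at h4
  rw [e4] at h5
  push_cast at h4 h5
  linear_combination Complex.I * τ * h1 + ex (ξ * β) * h2 - ex (ξ * β) * h3 - (1 / 2) * h4 +
    (1 / 2) * h5

/-- The Cauchy problem is invariant under translation along the antidiagonal, and such a translation
multiplies the source by e^{i(τ-ξ)x}; the solution is multiplied by the same factor. In the proof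
both sides satisfy the same first-order equation in x, the difference of the identities for iξ Ek
and iτ Ek. -/
lemma Ek_translate (τ ξ t x : ℝ) :
    Ek τ ξ (t + x) (t - x) = ex ((τ - ξ) * x) * Ek τ ξ t t := by
  have hE : ∀ y, HasDerivAt (fun x => Ek τ ξ (t + x) (t - x))
      (Complex.I * (τ - ξ : ℝ) * Ek τ ξ (t + y) (t - y)) y := fun y => by
    have p1 : HasDerivAt (fun x : ℝ => t + x) 1 y := (hasDerivAt_id y).const_add t
    have p2 : HasDerivAt (fun x : ℝ => t - x) (-1) y := by
      simpa using (hasDerivAt_id y).const_sub t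
    have d1 := (hasDerivAt_D τ (t + y)).scomp y p1
    have d2 := (hasDerivAt_D ξ (t - y)).scomp y p2
    have d3 := (hasDerivAt_Q τ ξ (t + y)).scomp y p1
    have d4 := (hasDerivAt_Q ξ τ (t - y)).scomp y p2
    refine (((d1.mul d2).add d3).add d4).congr_deriv ?_
    have h1 := I_mul_Ek_right τ ξ (t + y) (t - y)
    have h2 := I_mul_Ek_left τ ξ (t + y) (t - y)
    have h4 : D (ξ - τ) (t - y) = -D (τ - ξ) (-(t - y)) := by rw [D_neg]; simp
    have h5 : D (ξ - τ) (-(t + y)) = -D (τ - ξ) (t + y) := by rw [D_neg]; simp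
    rw [h4, h5] at h2
    simp only [Function.comp_apply, one_smul, neg_smul]
    push_cast
    linear_combination h1 - h2
  have h0 : ∀ y, HasDerivAt (fun x => ex ((ξ - τ) * x) * Ek τ ξ (t + x) (t - x)) 0 y :=
    fun y => by
      refine ((hasDerivAt_ex_mul (ξ - τ) y).mul (hE y)).congr_deriv ?_
      push_cast; ring
  have := eq_of_hasDerivAt_eq (v := fun _ => Ek τ ξ t t) h0 (fun y => hasDerivAt_const y _) 0
    (by simp) x
  rw [← this, ← mul_assoc, ← ex_add, show (τ - ξ) * x + (ξ - τ) * x = 0 by ring, ex_zero, one_mul]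

/-- The weight that controls `Ek` at high frequencies. -/
def wt (ζ : Plane) : ℝ := (brk (ζ 0))⁻¹ * (brk (ζ 1))⁻¹ +
  ((brk (ζ 0))⁻¹ + (brk (ζ 1))⁻¹) * (brk (ζ 0 - ζ 1))⁻¹

lemma wt_pos (ζ : Plane) : 0 < wt ζ := by
  have h0 := inv_brk_pos (ζ 0)
  have h1 := inv_brk_pos (ζ 1)
  have h2 := inv_brk_pos (ζ 0 - ζ 1)
  unfold wt; positivity

lemma continuous_inv_brk : Continuous fun x => (brk x)⁻¹ :=
  continuous_brk.inv₀ brk_ne_zero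

@[fun_prop] lemma _root_.Continuous.inv_brk {X : Type*} [TopologicalSpace X] {f : X → ℝ}
    (hf : Continuous f) : Continuous fun x => (brk (f x))⁻¹ := continuous_inv_brk.comp hf

@[fun_prop] lemma continuous_wt : Continuous wt := by unfold wt; fun_prop

/-- The product D·D contributes one multiple of the product weight and each `Q` two multiples of its
own weight, hence the constant 5. -/
lemma norm_Ek_le (ζ : Plane) (α β : ℝ) :
    ‖Ek (ζ 0) (ζ 1) α β‖ ≤ 5 * ((|α| + 2) ^ 2 * (|β| + 2) ^ 2) * wt ζ := by
  have h0 := inv_brk_pos (ζ 0)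
  have h1 := inv_brk_pos (ζ 1)
  have h2 := inv_brk_pos (ζ 0 - ζ 1)
  have hα := abs_nonneg α
  have hβ := abs_nonneg β
  set a := |α| + 2 with ha
  set b := |β| + 2 with hb
  have ha1 : 1 ≤ a := by linarith
  have hb1 : 1 ≤ b := by linarith
  have ha2 : 1 ≤ a ^ 2 := one_le_pow₀ ha1
  have hb2 : 1 ≤ b ^ 2 := one_le_pow₀ hb1
  have b1 : ‖D (ζ 0) α * D (ζ 1) β‖ ≤ (a ^ 2 * b ^ 2) * ((brk (ζ 0))⁻¹ * (brk (ζ 1))⁻¹) := by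
    rw [norm_mul]
    calc _ ≤ (a * (brk (ζ 0))⁻¹) * (b * (brk (ζ 1))⁻¹) := by
          gcongr <;> exact norm_D_le_brk _ _
      _ = (a * b) * ((brk (ζ 0))⁻¹ * (brk (ζ 1))⁻¹) := by ring
      _ ≤ _ := by gcongr <;> nlinarith
  have b2 : ‖Q (ζ 0) (ζ 1) α‖ ≤ 2 * (a ^ 2 * b ^ 2) *
      ((brk (ζ 1))⁻¹ * ((brk (ζ 0))⁻¹ + (brk (ζ 0 - ζ 1))⁻¹)) := by
    refine (norm_Q_le_brk _ _ _).trans ?_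
    gcongr
    exact le_mul_of_one_le_right (by positivity) hb2
  have b3 : ‖Q (ζ 1) (ζ 0) β‖ ≤ 2 * (a ^ 2 * b ^ 2) *
      ((brk (ζ 0))⁻¹ * ((brk (ζ 1))⁻¹ + (brk (ζ 0 - ζ 1))⁻¹)) := by
    refine (norm_Q_le_brk _ _ _).trans ?_
    rw [brk_sub_comm]
    gcongr
    exact le_mul_of_one_le_left (by positivity) ha2
  have := (norm_add_le _ _).trans (add_le_add ((norm_add_le _ _).trans (add_le_add b1 b2)) b3)
  refine this.trans ?_
  have hab : 0 ≤ a ^ 2 * b ^ 2 := by positivity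
  unfold wt
  nlinarith [mul_nonneg hab (mul_pos h0 h2).le, mul_nonneg hab (mul_pos h1 h2).le]

/-! ### Fourier densities -/

/-- The normalisation `(2π)⁻²` of the inverse Fourier transform. -/
def cF : ℂ := (((2 * Real.pi) ^ 2 : ℝ) : ℂ)⁻¹

lemma two_pi_pos : 0 < 2 * Real.pi := by positivity

/-- The substitution ζ ↦ 2πζ removes the normalisation of the Fourier transform from the density; in
dimension two its Jacobian is the constant `cF`. -/
lemma IsFourierDensity.scaled {u : 𝓢'(Plane, Vec n)} {g : Plane → Vec n} (h : IsFourierDensity u g)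
    (θ : 𝓢(Plane, ℂ)) : Integrable (fun ζ => θ ((2 * Real.pi)⁻¹ • ζ) • g ζ) ∧
      (𝓕 u) θ = cF • ∫ ζ, θ ((2 * Real.pi)⁻¹ • ζ) • g ζ := by
  have hp := two_pi_pos.ne'
  obtain ⟨h1, h2⟩ := h θ
  set F : Plane → Vec n := fun ζ => θ ((2 * Real.pi)⁻¹ • ζ) • g ζ with hF
  have e : ∀ ζ : Plane, θ ζ • g ((2 * Real.pi) • ζ) = F ((2 * Real.pi) • ζ) := fun ζ => by
    simp only [hF, inv_smul_smul₀ hp]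
  simp only [e] at h1 h2
  refine ⟨(integrable_comp_smul_iff volume _ hp).1 h1, ?_⟩
  rw [h2, Measure.integral_comp_smul]
  have : |((2 * Real.pi) ^ Module.finrank ℝ Plane)⁻¹| = ((2 * Real.pi) ^ 2)⁻¹ := by
    rw [finrank_euclideanSpace, Fintype.card_fin, abs_of_pos (by positivity)]
  rw [this, cF, ← Complex.ofReal_inv, Complex.coe_smul]

lemma inner_plane (x z : Plane) : inner ℝ x z = x 0 * z 0 + x 1 * z 1 := by
  simp [PiLp.inner_apply, Fin.sum_univ_two, mul_comm]

/-- `∫ e^{i(ατ + βξ)} θ(α, β) dα dβ`. -/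
def osc (θ : Plane → ℂ) (ζ : Plane) : ℂ := ∫ p : Plane, ex (p 0 * ζ 0 + p 1 * ζ 1) * θ p

lemma fourierInv_eq_osc (θ : 𝓢(Plane, ℂ)) (ζ : Plane) :
    (𝓕⁻ θ : 𝓢(Plane, ℂ)) ((2 * Real.pi)⁻¹ • ζ) = osc θ ζ := by
  have hp := two_pi_pos.ne'
  rw [SchwartzMap.fourierInv_coe, Real.fourierInv_eq', osc]
  refine integral_congr_ae (ae_of_all _ fun p => ?_)
  simp only [smul_eq_mul, ex, inner_smul_right, inner_plane]
  rw [mul_inv_cancel_left₀ hp, mul_comm Complex.I]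

/-- Fourier inversion on the test function turns the definition into a pairing of u itself; this is
the form in which f enters the equation. -/
lemma IsFourierDensity.apply {u : 𝓢'(Plane, Vec n)} {g : Plane → Vec n} (h : IsFourierDensity u g)
    (θ : 𝓢(Plane, ℂ)) : Integrable (fun ζ => osc θ ζ • g ζ) ∧
      u θ = cF • ∫ ζ, osc θ ζ • g ζ := by
  have := h.scaled (𝓕⁻ θ)
  rw [TemperedDistribution.fourier_apply, FourierInvPair.fourier_fourierInv_eq] at this
  simpa only [fourierInv_eq_osc] using this

/-- A smooth bump on the plane as a Schwartz function. -/
def bumpS (R : ℝ) (hR : 0 < R) : 𝓢(Plane, ℂ) :=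
  let b : ContDiffBump (0 : Plane) := ⟨R, R + 1, hR, by linarith⟩
  HasCompactSupport.toSchwartzMap (f := fun x => ((b x : ℝ) : ℂ))
    (b.hasCompactSupport.comp_left Complex.ofReal_zero)
    (Complex.ofRealCLM.contDiff.comp b.contDiff)

lemma bumpS_eq_one {R : ℝ} (hR : 0 < R) {x : Plane} (hx : ‖x‖ ≤ R) : bumpS R hR x = 1 := by
  let b : ContDiffBump (0 : Plane) := ⟨R, R + 1, hR, by linarith⟩
  change ((b x : ℝ) : ℂ) = 1
  rw [b.one_of_mem_closedBall (by simpa using hx), Complex.ofReal_one]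

/-- Testing against a bump equal to 1 on a ball shows that the density is integrable there. -/
lemma IsFourierDensity.locallyIntegrable {u : 𝓢'(Plane, Vec n)} {g : Plane → Vec n}
    (h : IsFourierDensity u g) : LocallyIntegrable g := by
  intro x
  have hR : 0 < (2 * Real.pi)⁻¹ * (‖x‖ + 1) := by positivity
  obtain ⟨h1, -⟩ := h.scaled (bumpS _ hR)
  refine ⟨Metric.ball 0 (‖x‖ + 1), Metric.isOpen_ball.mem_nhds (by simp), ?_⟩
  refine (h1.integrableOn (s := Metric.ball 0 (‖x‖ + 1))).congr_fun (fun ζ hζ => ?_)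
    measurableSet_ball
  have : ‖ζ‖ ≤ ‖x‖ + 1 := by simpa using (mem_ball_zero_iff.1 hζ).le
  simp only
  rw [bumpS_eq_one, one_smul]
  rw [norm_smul, Real.norm_of_nonneg (by positivity)]
  gcongr

lemma IsFourierDensity.aestronglyMeasurable {u : 𝓢'(Plane, Vec n)} {g : Plane → Vec n}
    (h : IsFourierDensity u g) : AEStronglyMeasurable g :=
  h.locallyIntegrable.aestronglyMeasurable

/-- Smooth compactly supported functions are admissible tests, so the difference of the densities
vanishes by the fundamental lemma of the calculus of variations. -/
lemma IsFourierDensity.ae_eq {u : 𝓢'(Plane, Vec n)} {g₁ g₂ : Plane → Vec n}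
    (h₁ : IsFourierDensity u g₁) (h₂ : IsFourierDensity u g₂) : g₁ =ᵐ[volume] g₂ := by
  have hc : cF ≠ 0 := by
    rw [cF]; exact inv_ne_zero (Complex.ofReal_ne_zero.2 (by positivity))
  have key := ae_eq_zero_of_integral_contDiff_smul_eq_zero
    (h₁.locallyIntegrable.sub h₂.locallyIntegrable) (fun b hb hbc => ?_)
  · filter_upwards [key] with x hx
    exact sub_eq_zero.1 hx
  · have hp := two_pi_pos
    have hcs : HasCompactSupport (fun x : Plane => ((b ((2 * Real.pi) • x) : ℝ) : ℂ)) := by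
      have : HasCompactSupport (fun x : Plane => b ((2 * Real.pi) • x)) :=
        hbc.comp_smul hp.ne'
      exact this.comp_left Complex.ofReal_zero
    have hsm : ContDiff ℝ (⊤ : ℕ∞) (fun x : Plane => ((b ((2 * Real.pi) • x) : ℝ) : ℂ)) :=
      Complex.ofRealCLM.contDiff.comp (hb.comp (contDiff_const_smul _))
    let θ : 𝓢(Plane, ℂ) := hcs.toSchwartzMap hsm
    have e : ∀ ζ : Plane, θ ((2 * Real.pi)⁻¹ • ζ) = (b ζ : ℂ) := fun ζ => by
      change ((b ((2 * Real.pi) • (2 * Real.pi)⁻¹ • ζ) : ℝ) : ℂ) = _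
      rw [smul_inv_smul₀ hp.ne']
    obtain ⟨i₁, e₁⟩ := h₁.scaled θ
    obtain ⟨i₂, e₂⟩ := h₂.scaled θ
    have h3 := smul_right_injective _ hc (e₁.symm.trans e₂)
    simp only [e, Complex.coe_smul] at i₁ i₂ h3
    simp only [Pi.sub_apply, smul_sub]
    rw [integral_sub i₁ i₂, h3, sub_self]

lemma prodSobolevSq_eq (a b : ℝ) {u : 𝓢'(Plane, Vec n)} {g : Plane → Vec n}
    (h : IsFourierDensity u g) : prodSobolevSq a b u = ∫⁻ ζ : Plane,
      ENNReal.ofReal ((1 + (ζ 0) ^ 2) ^ a * (1 + (ζ 1) ^ 2) ^ b * ‖g ζ‖ ^ 2) := by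
  refine le_antisymm (iInf₂_le g h) (le_iInf₂ fun g' h' => le_of_eq ?_)
  refine lintegral_congr_ae ?_
  filter_upwards [h.ae_eq h'] with ζ hζ
  rw [hζ]

lemma isFourierDensity_fourierDensity {a b : ℝ} {u : 𝓢'(Plane, Vec n)}
    (h : prodSobolevSq a b u < ∞) : IsFourierDensity u (fourierDensity u) := by
  have hex : ∃ g, IsFourierDensity u g := by
    by_contra hne
    push Not at hne
    simp [prodSobolevSq, hne] at h
  rw [fourierDensity, dif_pos hex]
  exact hex.choose_spec

lemma one_add_sq_le_brk_sq (x : ℝ) : 1 + x ^ 2 ≤ brk x ^ 2 := by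
  unfold brk; nlinarith [abs_nonneg x, sq_abs x]

lemma brk_rpow_two_mul (a x : ℝ) : brk x ^ (2 * a) = (brk x ^ 2) ^ a := by
  rw [Real.rpow_mul (brk_pos x).le, Real.rpow_two]

lemma one_add_sq_rpow_le {a : ℝ} (ha : 0 ≤ a) (x : ℝ) : (1 + x ^ 2) ^ a ≤ brk x ^ (2 * a) := by
  rw [brk_rpow_two_mul]
  exact Real.rpow_le_rpow (by positivity) (one_add_sq_le_brk_sq x) ha

lemma le_one_add_sq_rpow {a : ℝ} (ha : a ≤ 0) (x : ℝ) : brk x ^ (2 * a) ≤ (1 + x ^ 2) ^ a := by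
  rw [brk_rpow_two_mul]
  exact Real.rpow_le_rpow_of_nonpos (by positivity) (one_add_sq_le_brk_sq x) ha

lemma pw_mul_enorm_sq (a b : ℝ) (g : Plane → Vec n) (ζ : Plane) : pw a b ζ * ‖g ζ‖ₑ ^ 2 =
    ENNReal.ofReal (brk (ζ 0) ^ (2 * a) * brk (ζ 1) ^ (2 * b) * ‖g ζ‖ ^ 2) := by
  have h0 := (brk_rpow_pos (2 * a) (ζ 0)).le
  have h1 := (brk_rpow_pos (2 * b) (ζ 1)).le
  rw [pw, bw, bw, ENNReal.ofReal_mul (mul_nonneg h0 h1), ENNReal.ofReal_mul h0,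
    ENNReal.ofReal_pow (norm_nonneg _), ofReal_norm]

/-- Only one direction of the comparison 1 + x² ≤ (1+|x|)² is needed on each side: the exponents are
nonpositive for the source and nonnegative for the solution, so passing to `brk` costs no constant.
-/
lemma lintegral_pw_le_prodSobolevSq {a b : ℝ} (ha : a ≤ 0) (hb : b ≤ 0) {u : 𝓢'(Plane, Vec n)}
    {g : Plane → Vec n} (h : IsFourierDensity u g) :
    ∫⁻ ζ, pw a b ζ * ‖g ζ‖ₑ ^ 2 ≤ prodSobolevSq a b u := by
  rw [prodSobolevSq_eq a b h]
  refine lintegral_mono fun ζ => ?_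
  rw [pw_mul_enorm_sq]
  apply ENNReal.ofReal_le_ofReal
  have := (brk_rpow_pos (2 * b) (ζ 1)).le
  gcongr
  · exact le_one_add_sq_rpow ha _
  · exact le_one_add_sq_rpow hb _

lemma prodSobolevSq_le_lintegral_pw {a b : ℝ} (ha : 0 ≤ a) (hb : 0 ≤ b) {u : 𝓢'(Plane, Vec n)}
    {g : Plane → Vec n} (h : IsFourierDensity u g) :
    prodSobolevSq a b u ≤ ∫⁻ ζ, pw a b ζ * ‖g ζ‖ₑ ^ 2 := by
  rw [prodSobolevSq_eq a b h]
  refine lintegral_mono fun ζ => ?_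
  rw [pw_mul_enorm_sq]
  apply ENNReal.ofReal_le_ofReal
  have := (brk_rpow_pos (2 * a) (ζ 0)).le
  gcongr
  · exact one_add_sq_rpow_le ha _
  · exact one_add_sq_rpow_le hb _

/-! ### Integrability of the density against the weight -/

/-- A crude form of Young's inequality, by comparing K with p h. It replaces Cauchy-Schwarz where
only finiteness matters. -/
lemma mul_le_sq_div_add {K h p : ℝ≥0∞} (hp0 : p ≠ 0) (hpt : p ≠ ∞) :
    K * h ≤ K ^ 2 * p⁻¹ + p * h ^ 2 := by
  rcases le_total K (p * h) with hk | hk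
  · calc K * h ≤ p * h * h := by gcongr
      _ = p * h ^ 2 := by ring
      _ ≤ _ := le_add_self
  · have : h ≤ K * p⁻¹ := by
      rw [← div_eq_mul_inv, ENNReal.le_div_iff_mul_le (Or.inl hp0) (Or.inl hpt), mul_comm]
      exact hk
    calc K * h ≤ K * (K * p⁻¹) := by gcongr
      _ = K ^ 2 * p⁻¹ := by ring
      _ ≤ _ := le_self_add

lemma lintegral_mul_lt_top {K h p : Plane → ℝ≥0∞} (hK : Measurable K) (hp : Measurable p)
    (hp0 : ∀ y, p y ≠ 0) (hpt : ∀ y, p y ≠ ∞) (h1 : ∫⁻ y, K y ^ 2 * (p y)⁻¹ < ∞)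
    (h2 : ∫⁻ y, p y * h y ^ 2 < ∞) : ∫⁻ y, K y * h y < ∞ := by
  refine lt_of_le_of_lt (lintegral_mono fun y => mul_le_sq_div_add (hp0 y) (hpt y)) ?_
  rw [lintegral_add_left (by fun_prop)]
  exact ENNReal.add_lt_top.2 ⟨h1, h2⟩

lemma lintegral_prod_bw_lt_top {p q : ℝ} (hp : p < -1) (hq : q < -1) :
    ∫⁻ ζ : Plane, bw p (ζ 0) * bw q (ζ 1) < ∞ := by
  rw [show (∫⁻ ζ : Plane, bw p (ζ 0) * bw q (ζ 1)) = ∫⁻ u, ∫⁻ v, bw p u * bw q v from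
    lintegral_plane (h := fun u v => bw p u * bw q v) (by unfold Function.uncurry; fun_prop)]
  calc _ = ∫⁻ u, bw p u * ∫⁻ v, bw q v :=
        lintegral_congr fun u => lintegral_const_mul _ (by fun_prop)
    _ = (∫⁻ u, bw p u) * ∫⁻ v, bw q v := lintegral_mul_const _ (by fun_prop)
    _ < ∞ := ENNReal.mul_lt_top (lintegral_bw_lt_top hp) (lintegral_bw_lt_top hq)

/-- The same shear ω = u - v as for the kernels: the integral in v requires r₁ + r₂ > 3/2, and the
remaining power -2r₁ of ω requires r₁ > 1/2. -/
lemma lintegral_shear_bw_lt_top {r₁ r₂ : ℝ} (h1 : 1 / 2 < r₁) (h1' : r₁ ≤ 1)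
    (h : 3 / 2 < r₁ + r₂) :
    ∫⁻ v, ∫⁻ u, bw (-2) (u - v) * bw (2 - 2 * r₁) u * bw (-(2 * r₂)) v < ∞ := by
  calc ∫⁻ v, ∫⁻ u, bw (-2) (u - v) * bw (2 - 2 * r₁) u * bw (-(2 * r₂)) v
      = ∫⁻ v, ∫⁻ ω, bw (-2) ω * bw (2 - 2 * r₁) (ω + v) * bw (-(2 * r₂)) v := by
        refine lintegral_congr fun v => ?_
        rw [← lintegral_sub_right_eq_self (fun ω => bw (-2) ω * bw (2 - 2 * r₁) (ω + v) *
          bw (-(2 * r₂)) v) v]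
        simp only [sub_add_cancel]
    _ = ∫⁻ ω, ∫⁻ v, bw (-2) ω * bw (2 - 2 * r₁) (ω + v) * bw (-(2 * r₂)) v := by
        rw [lintegral_lintegral_swap]
        apply Measurable.aemeasurable
        unfold Function.uncurry; fun_prop
    _ ≤ ∫⁻ ω, bw (-(2 * r₁)) ω * ∫⁻ ξ, bw (2 - 2 * r₁ - 2 * r₂) ξ := by
        refine lintegral_mono fun ω => ?_
        simp only [mul_assoc]
        rw [lintegral_const_mul _ (by fun_prop)]
        calc _ ≤ bw (-2) ω * (bw (2 - 2 * r₁) ω * ∫⁻ ξ, bw (2 - 2 * r₁ - 2 * r₂) ξ) := by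
              gcongr; exact lintegral_bw_add_mul_le h1' ω
          _ = _ := by
              rw [← mul_assoc, bw_mul]; congr 2; ring
    _ < ∞ := by
        rw [lintegral_mul_const _ (by fun_prop)]
        exact ENNReal.mul_lt_top (lintegral_bw_lt_top (by linarith))
          (lintegral_bw_lt_top (by linarith))

lemma ofReal_inv_brk (x : ℝ) : ENNReal.ofReal (brk x)⁻¹ = bw (-1) x := by
  rw [bw, Real.rpow_neg_one]

lemma pw_ne_zero (a b : ℝ) (ζ : Plane) : pw a b ζ ≠ 0 :=
  mul_ne_zero (bw_ne_zero _ _) (bw_ne_zero _ _)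

lemma pw_ne_top (a b : ℝ) (ζ : Plane) : pw a b ζ ≠ ∞ :=
  ENNReal.mul_ne_top (bw_ne_top _ _) (bw_ne_top _ _)

lemma inv_pw (a b : ℝ) (ζ : Plane) : (pw a b ζ)⁻¹ = bw (-(2 * a)) (ζ 0) * bw (-(2 * b)) (ζ 1) := by
  rw [pw, ENNReal.mul_inv (Or.inl (bw_ne_zero _ _)) (Or.inl (bw_ne_top _ _)), bw_inv, bw_inv]

lemma ofReal_wt (ζ : Plane) : ENNReal.ofReal (wt ζ) = bw (-1) (ζ 0) * bw (-1) (ζ 1) +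
    (bw (-1) (ζ 1) * bw (-1) (ζ 0 - ζ 1) + bw (-1) (ζ 0) * bw (-1) (ζ 0 - ζ 1)) := by
  have h0 := (inv_brk_pos (ζ 0)).le
  have h1 := (inv_brk_pos (ζ 1)).le
  have h2 := (inv_brk_pos (ζ 0 - ζ 1)).le
  simp only [← ofReal_inv_brk]
  rw [← ENNReal.ofReal_mul h0, ← ENNReal.ofReal_mul h0, ← ENNReal.ofReal_mul h1,
    ← ENNReal.ofReal_add (by positivity) (by positivity),
    ← ENNReal.ofReal_add (by positivity) (by positivity), wt]
  congr 1; ring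

/-- Each of the three summands of `wt` is paired with the density in weighted L². The product term
needs both exponents above 1/2; the two terms in τ-ξ are the shear integral and its mirror image. -/
lemma lintegral_wt_mul_lt_top {r₁ r₂ : ℝ} (h1 : 1 / 2 < r₁) (h1' : r₁ ≤ 1) (h2 : 1 / 2 < r₂)
    (h2' : r₂ ≤ 1) (h : 3 / 2 < r₁ + r₂) {g : Plane → ℝ≥0∞} (hg : AEMeasurable g)
    (hfin : ∫⁻ ζ, pw (r₁ - 1) (r₂ - 1) ζ * g ζ ^ 2 < ∞) :
    ∫⁻ ζ, ENNReal.ofReal (wt ζ) * g ζ < ∞ := by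
  have hsq : ∀ x, bw (-1) x ^ 2 = bw (-2) x := fun x => by rw [sq, bw_mul]; norm_num
  have e1 : ∀ x, bw (-(2 * r₁)) x = bw (-2) x * bw (-(2 * (r₁ - 1))) x := fun x => by
    rw [bw_mul]; congr 1; ring
  have e2 : ∀ x, bw (-(2 * r₂)) x = bw (-2) x * bw (-(2 * (r₂ - 1))) x := fun x => by
    rw [bw_mul]; congr 1; ring
  have k1 : ∫⁻ ζ : Plane, (bw (-1) (ζ 0) * bw (-1) (ζ 1)) * g ζ < ∞ := by
    refine lintegral_mul_lt_top (by fun_prop) (measurable_pw _ _) (pw_ne_zero _ _) (pw_ne_top _ _)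
      ?_ hfin
    refine lt_of_le_of_lt (le_of_eq (lintegral_congr fun ζ => ?_))
      (lintegral_prod_bw_lt_top (p := -(2 * r₁)) (q := -(2 * r₂)) (by linarith) (by linarith))
    rw [inv_pw, mul_pow, hsq, hsq, e1, e2]; ring
  have k2 : ∫⁻ ζ : Plane, (bw (-1) (ζ 1) * bw (-1) (ζ 0 - ζ 1)) * g ζ < ∞ := by
    refine lintegral_mul_lt_top (by fun_prop) (measurable_pw _ _) (pw_ne_zero _ _) (pw_ne_top _ _)
      ?_ hfin
    refine lt_of_le_of_lt (le_of_eq ?_) (lintegral_shear_bw_lt_top h1 h1' h)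
    rw [← lintegral_plane' (h := fun u v => bw (-2) (u - v) * bw (2 - 2 * r₁) u *
      bw (-(2 * r₂)) v) (by unfold Function.uncurry; fun_prop)]
    refine lintegral_congr fun ζ => ?_
    rw [inv_pw, mul_pow, hsq, hsq, e2, show -(2 * (r₁ - 1)) = 2 - 2 * r₁ by ring]; ring
  have k3 : ∫⁻ ζ : Plane, (bw (-1) (ζ 0) * bw (-1) (ζ 0 - ζ 1)) * g ζ < ∞ := by
    refine lintegral_mul_lt_top (by fun_prop) (measurable_pw _ _) (pw_ne_zero _ _) (pw_ne_top _ _)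
      ?_ hfin
    refine lt_of_le_of_lt (le_of_eq ?_)
      (lintegral_shear_bw_lt_top (r₁ := r₂) (r₂ := r₁) h2 h2' (by linarith))
    rw [← lintegral_plane (h := fun v u => bw (-2) (u - v) * bw (2 - 2 * r₂) u *
      bw (-(2 * r₁)) v) (by unfold Function.uncurry; fun_prop)]
    refine lintegral_congr fun ζ => ?_
    have : bw (-2) (ζ 0 - ζ 1) = bw (-2) (ζ 1 - ζ 0) := by rw [bw, bw, brk_sub_comm]
    rw [inv_pw, mul_pow, hsq, hsq, e1, show -(2 * (r₂ - 1)) = 2 - 2 * r₂ by ring, this]; ring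
  simp only [ofReal_wt, add_mul]
  rw [lintegral_add_left' (by fun_prop), lintegral_add_left' (by fun_prop)]
  exact ENNReal.add_lt_top.2 ⟨k1, ENNReal.add_lt_top.2 ⟨k2, k3⟩⟩

/-- A function that is integrable against the weight `wt`. -/
structure WtIntegrable (g : Plane → Vec n) : Prop where
  meas : AEStronglyMeasurable g
  integrable : Integrable (fun ζ => wt ζ * ‖g ζ‖)

lemma IsFourierDensity.wtIntegrable {r₁ r₂ : ℝ} (h1 : 1 / 2 < r₁) (h1' : r₁ ≤ 1)
    (h2 : 1 / 2 < r₂) (h2' : r₂ ≤ 1) (h : 3 / 2 < r₁ + r₂) {u : 𝓢'(Plane, Vec n)}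
    {g : Plane → Vec n} (hg : IsFourierDensity u g)
    (hfin : prodSobolevSq (r₁ - 1) (r₂ - 1) u < ∞) : WtIntegrable g := by
  have hm := hg.aestronglyMeasurable
  refine ⟨hm, continuous_wt.aestronglyMeasurable.mul hm.norm, ?_⟩
  have := lintegral_wt_mul_lt_top h1 h1' h2 h2' h hm.enorm
    (lt_of_le_of_lt (lintegral_pw_le_prodSobolevSq (by linarith) (by linarith) hg) hfin)
  refine lt_of_le_of_lt (le_of_eq (lintegral_congr fun ζ => ?_)) this
  rw [enorm_mul, enorm_norm, Real.enorm_of_nonneg (wt_pos ζ).le]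

lemma memHyp_iff {a b : ℝ} {u : 𝓢'(Plane, Vec n)} :
    MemHyp a b u ↔ prodSobolevSq a b u < ∞ ∧ prodSobolevSq b a u < ∞ := by
  rw [MemHyp, hypNorm, ENNReal.rpow_lt_top_iff_of_pos (by norm_num), ENNReal.add_lt_top]

/-! ### Densities of real distributions -/

def conjV : Vec n →L[ℝ] Vec n :=
  LinearMap.toContinuousLinearMap
    { toFun := fun v => WithLp.toLp 2 fun i => (starRingEnd ℂ) (v i)
      map_add' := fun v w => by ext i; simp
      map_smul' := fun r v => by ext i; simp }

@[simp] lemma conjV_apply (v : Vec n) (i : Fin n) : conjV v i = (starRingEnd ℂ) (v i) := rfl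

lemma conjV_smul (c : ℂ) (v : Vec n) : conjV (c • v) = (starRingEnd ℂ) c • conjV v := by
  ext i; simp

@[simp] lemma conjV_conjV (v : Vec n) : conjV (conjV v) = v := by ext i; simp

def conjS (θ : 𝓢(Plane, ℂ)) : 𝓢(Plane, ℂ) :=
  SchwartzMap.postcompCLM (𝕜 := ℝ) (Complex.conjCLE : ℂ →L[ℝ] ℂ) θ

lemma conjS_apply (θ : 𝓢(Plane, ℂ)) (x : Plane) : conjS θ x = (starRingEnd ℂ) (θ x) := rfl

/-- The functions θ + θ̄ and i(θ - θ̄) are real, and their images determine those of θ and θ̄ up to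
the claimed conjugation. -/
lemma IsRealDistribution.conjS {u : 𝓢'(Plane, Vec n)} (hu : IsRealDistribution u)
    (θ : 𝓢(Plane, ℂ)) : u (conjS θ) = conjV (u θ) := by
  have h1 := hu (θ + NullWave.conjS θ) (fun p => by
    rw [add_apply, conjS_apply]; simp)
  have h2 := hu (Complex.I • (θ - NullWave.conjS θ)) (fun p => by
    rw [smul_apply, sub_apply, conjS_apply]; simp)
  ext i
  have h1 := h1 i
  have h2 := h2 i
  simp only [map_add, map_smul, map_sub, PiLp.add_apply, PiLp.smul_apply, PiLp.sub_apply,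
    smul_eq_mul, Complex.add_im, Complex.mul_im, Complex.I_re, Complex.I_im, Complex.sub_re,
    Complex.sub_im] at h1 h2
  rw [conjV_apply]
  apply Complex.ext
  · simp; linarith
  · simp; linarith

lemma fourier_conj_neg (θ : 𝓢(Plane, ℂ)) :
    𝓕 (conjS (SchwartzMap.compCLMOfContinuousLinearEquiv ℂ (ContinuousLinearEquiv.neg ℝ) θ)) =
      conjS (𝓕 θ) := by
  ext ζ
  rw [conjS_apply, SchwartzMap.fourier_coe, SchwartzMap.fourier_coe, Real.fourier_eq',
    Real.fourier_eq', ← integral_conj, ← integral_neg_eq_self]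
  refine integral_congr_ae (ae_of_all _ fun p => ?_)
  simp only [conjS_apply, SchwartzMap.compCLMOfContinuousLinearEquiv_apply, smul_eq_mul,
    map_mul, ← Complex.exp_conj, Function.comp_apply, inner_neg_left]
  simp [Complex.conj_ofNat]

/-- The reflected conjugate is again a density of u, because reflection and conjugation commute with
the Fourier transform in the form of `fourier_conj_neg`; uniqueness of the density finishes. -/
lemma IsFourierDensity.conj_neg {u : 𝓢'(Plane, Vec n)} {g : Plane → Vec n}
    (h : IsFourierDensity u g) (hu : IsRealDistribution u) :
    ∀ᵐ ζ, g ζ = conjV (g (-ζ)) := by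
  refine h.ae_eq (g₂ := fun ζ => conjV (g (-ζ))) fun θ => ?_
  obtain ⟨h1, h2⟩ := h (NullWave.conjS
    (SchwartzMap.compCLMOfContinuousLinearEquiv ℂ (ContinuousLinearEquiv.neg ℝ) θ))
  have e : ∀ ζ : Plane, conjV ((NullWave.conjS (SchwartzMap.compCLMOfContinuousLinearEquiv ℂ
      (ContinuousLinearEquiv.neg ℝ) θ)) (-ζ) • g ((2 * Real.pi) • -ζ)) =
        θ ζ • conjV (g (-((2 * Real.pi) • ζ))) := fun ζ => by
    rw [conjV_smul, conjS_apply, smul_neg]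
    simp
  constructor
  · have := conjV.integrable_comp h1.comp_neg
    simpa only [e] using this
  · have h3 := congrArg conjV h2
    rw [← conjV.integral_comp_comm h1, ← integral_neg_eq_self, TemperedDistribution.fourier_apply,
      fourier_conj_neg, hu.conjS, conjV_conjV] at h3
    simp only [e] at h3
    exact h3

/-! ### Integrals of symbols against an integrable density -/

lemma WtIntegrable.integrable_smul {g : Plane → Vec n} (hg : WtIntegrable g) {m : Plane → ℂ} {K : ℝ}
    (hm : AEStronglyMeasurable m) (hb : ∀ ζ, ‖m ζ‖ ≤ K * wt ζ) :
    Integrable (fun ζ => m ζ • g ζ) := by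
  refine (hg.integrable.const_mul K).mono' (hm.smul hg.meas) (ae_of_all _ fun ζ => ?_)
  rw [norm_smul, ← mul_assoc]
  gcongr
  exact hb ζ

/-- Finite partial sums of absolute values bounded by one multiple of `wt` give summable L¹ norms,
so the series and the integral may be exchanged. -/
lemma WtIntegrable.hasSum_integral {ι : Type*} [Countable ι] {g : Plane → Vec n}
    (hg : WtIntegrable g) {m : ι → Plane → ℂ} {M : Plane → ℂ} {K : ℝ}
    (hm : ∀ i, AEStronglyMeasurable (m i))
    (hb : ∀ ζ (s : Finset ι), ∑ i ∈ s, ‖m i ζ‖ ≤ K * wt ζ)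
    (hM : ∀ ζ, HasSum (fun i => m i ζ) (M ζ)) :
    HasSum (fun i => ∫ ζ, m i ζ • g ζ) (∫ ζ, M ζ • g ζ) := by
  have hint : ∀ i, Integrable (fun ζ => m i ζ • g ζ) := fun i =>
    hg.integrable_smul (hm i) fun ζ => by simpa using hb ζ {i}
  have hsum : Summable fun i => ∫ ζ, ‖m i ζ • g ζ‖ := by
    refine summable_of_sum_le (c := ∫ ζ, K * (wt ζ * ‖g ζ‖))
      (fun i => integral_nonneg fun ζ => norm_nonneg (m i ζ • g ζ)) fun s => ?_
    rw [← integral_finsetSum _ fun i _ => (hint i).norm]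
    refine integral_mono (integrable_finsetSum _ fun i _ => (hint i).norm)
      (hg.integrable.const_mul K) fun ζ => ?_
    simp only [norm_smul, ← Finset.sum_mul]
    rw [← mul_assoc]
    gcongr
    exact hb ζ s
  have h := hasSum_integral_of_summable_integral_norm hint hsum
  rwa [integral_congr_ae (ae_of_all volume fun ζ => ((hM ζ).smul_const (g ζ)).tsum_eq)] at h

lemma WtIntegrable.continuous_integral {X : Type*} [TopologicalSpace X] [FirstCountableTopology X]
    {g : Plane → Vec n} (hg : WtIntegrable g) {k : X → Plane → ℂ} {M : X → ℝ} (hM : Continuous M)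
    (hkm : ∀ x, AEStronglyMeasurable (k x)) (hk : ∀ ζ, Continuous fun x => k x ζ)
    (hb : ∀ x ζ, ‖k x ζ‖ ≤ M x * wt ζ) : Continuous fun x => ∫ ζ, k x ζ • g ζ := by
  refine continuous_iff_continuousAt.2 fun x₀ => ?_
  refine continuousAt_of_dominated (bound := fun ζ => (M x₀ + 1) * (wt ζ * ‖g ζ‖))
    (Eventually.of_forall fun x => (hkm x).smul hg.meas) ?_ (hg.integrable.const_mul _)
    (ae_of_all _ fun ζ => ((hk ζ).smul continuous_const).continuousAt)
  have : ∀ᶠ x in 𝓝 x₀, M x < M x₀ + 1 := hM.continuousAt.eventually_lt_const (by linarith)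
  filter_upwards [this] with x hx
  refine ae_of_all _ fun ζ => ?_
  rw [norm_smul, ← mul_assoc]
  gcongr
  exact (hb x ζ).trans (mul_le_mul_of_nonneg_right hx.le (wt_pos ζ).le)

lemma integral_integral_smul_swap {X Y V : Type*} [TopologicalSpace X] [MeasurableSpace X]
    [BorelSpace X] [SecondCountableTopology X] [TopologicalSpace Y] [MeasurableSpace Y]
    [BorelSpace Y] [SecondCountableTopology Y] {μ : Measure X} {ν : Measure Y} [SFinite μ]
    [SFinite ν] [NormedAddCommGroup V] [NormedSpace ℂ V] [CompleteSpace V] {k : X → Y → ℂ}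
    {G : Y → V} {w : X → ℝ} {v : Y → ℝ} (hk : Continuous (Function.uncurry k))
    (hG : AEStronglyMeasurable G ν) (hb : ∀ x y, ‖k x y‖ ≤ w x * v y) (hw : Integrable w μ)
    (hv : Integrable (fun y => v y * ‖G y‖) ν) :
    Integrable (fun x => ∫ y, k x y • G y ∂ν) μ ∧
      ∫ x, ∫ y, k x y • G y ∂ν ∂μ = ∫ y, (∫ x, k x y ∂μ) • G y ∂ν := by
  have hint : Integrable (Function.uncurry fun x y => k x y • G y) (μ.prod ν) := by
    refine (hw.mul_prod hv).mono' ?_ (ae_of_all _ fun p => ?_)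
    · exact hk.aestronglyMeasurable.smul
        (hG.comp_quasiMeasurePreserving Measure.quasiMeasurePreserving_snd)
    · simp only [Function.uncurry, norm_smul]
      rw [← mul_assoc]
      gcongr
      exact hb _ _
  refine ⟨hint.integral_prod_left, ?_⟩
  rw [integral_integral_swap hint]
  simp only [integral_smul_const]

/-! ### Fourier transforms of Schwartz functions of one variable -/

/-- `∫ e^{iωx} θ(x) dx`. -/
def osc1 (θ : ℝ → ℂ) (ω : ℝ) : ℂ := ∫ x, ex (ω * x) * θ x

lemma fourierInv_eq_osc1 (θ : 𝓢(ℝ, ℂ)) (ω : ℝ) :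
    (𝓕⁻ θ : 𝓢(ℝ, ℂ)) ((2 * Real.pi)⁻¹ * ω) = osc1 θ ω := by
  have hp := two_pi_pos.ne'
  rw [SchwartzMap.fourierInv_coe, Real.fourierInv_eq', osc1]
  refine integral_congr_ae (ae_of_all _ fun x => ?_)
  simp only [smul_eq_mul, ex]
  rw [show 2 * Real.pi * inner ℝ x ((2 * Real.pi)⁻¹ * ω) = ω * x by
    simp only [RCLike.inner_apply, conj_trivial]; field_simp, mul_comm Complex.I]

lemma brk_le_seven_mul (ω : ℝ) : brk ω ≤ 7 * (1 + ‖(2 * Real.pi)⁻¹ * ω‖) := by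
  have hp := two_pi_pos
  have h7 : 2 * Real.pi ≤ 7 := by linarith [Real.pi_lt_d2]
  have : |ω| = 2 * Real.pi * ‖(2 * Real.pi)⁻¹ * ω‖ := by
    rw [norm_mul, Real.norm_of_nonneg (by positivity), Real.norm_eq_abs,
      mul_inv_cancel_left₀ hp.ne']
  rw [brk, this]
  nlinarith [norm_nonneg ((2 * Real.pi)⁻¹ * ω)]

lemma norm_scaled_schwartz_le (k : ℕ) (Ψ : 𝓢(ℝ, ℂ)) (ω : ℝ) :
    ‖Ψ ((2 * Real.pi)⁻¹ * ω)‖ ≤ 14 ^ k * ((Finset.Iic (k, 0)).sup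
      (schwartzSeminormFamily ℂ ℝ ℂ)) Ψ * (brk ω ^ k)⁻¹ := by
  have h := SchwartzMap.one_add_le_sup_seminorm_apply (𝕜 := ℂ) (m := (k, 0)) (k := k) (n := 0) le_rfl
    le_rfl Ψ ((2 * Real.pi)⁻¹ * ω)
  rw [norm_iteratedFDeriv_zero] at h
  rw [le_mul_inv_iff₀ (pow_pos (brk_pos ω) k)]
  calc _ ≤ ‖Ψ ((2 * Real.pi)⁻¹ * ω)‖ * (7 * (1 + ‖(2 * Real.pi)⁻¹ * ω‖)) ^ k := by
        gcongr
        · exact (brk_pos ω).le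
        · exact brk_le_seven_mul ω
    _ = 7 ^ k * ((1 + ‖(2 * Real.pi)⁻¹ * ω‖) ^ k * ‖Ψ ((2 * Real.pi)⁻¹ * ω)‖) := by
        rw [mul_pow]; ring
    _ ≤ 7 ^ k * (2 ^ k * ((Finset.Iic (k, 0)).sup (schwartzSeminormFamily ℂ ℝ ℂ)) Ψ) := by
        exact mul_le_mul_of_nonneg_left h (by positivity)
    _ = _ := by rw [show (14 : ℝ) = 7 * 2 by norm_num, mul_pow]; ring

lemma exists_norm_osc1_le (k : ℕ) (θ : 𝓢(ℝ, ℂ)) :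
    ∃ C : ℝ, 0 ≤ C ∧ ∀ ω, ‖osc1 θ ω‖ ≤ C * (brk ω ^ k)⁻¹ := by
  refine ⟨14 ^ k * ((Finset.Iic (k, 0)).sup (schwartzSeminormFamily ℂ ℝ ℂ)) (𝓕⁻ θ),
    mul_nonneg (by positivity) (apply_nonneg _ _), fun ω => ?_⟩
  rw [← fourierInv_eq_osc1]
  exact norm_scaled_schwartz_le k _ ω

@[fun_prop] lemma continuous_osc1 (θ : 𝓢(ℝ, ℂ)) : Continuous (osc1 θ) := by
  have : osc1 θ = fun ω => (𝓕⁻ θ : 𝓢(ℝ, ℂ)) ((2 * Real.pi)⁻¹ * ω) := by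
    funext ω; exact (fourierInv_eq_osc1 θ ω).symm
  rw [this]
  exact (𝓕⁻ θ : 𝓢(ℝ, ℂ)).continuous.comp (by fun_prop)

/-- The tempered distribution `θ ↦ ∫ θ̌(τ - ξ) G(τ, ξ) dτ dξ`. -/
lemma exists_symbol_distribution {G : Plane → Vec n} (hG : AEStronglyMeasurable G)
    (hi : Integrable (fun ζ => (brk (ζ 0 - ζ 1))⁻¹ * ‖G ζ‖)) :
    ∃ T : 𝓢'(ℝ, Vec n), ∀ θ, T θ = ∫ ζ : Plane, osc1 θ (ζ 0 - ζ 1) • G ζ := by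
  have hI : ∀ Ψ : 𝓢(ℝ, ℂ), Integrable
      (fun ζ : Plane => Ψ ((2 * Real.pi)⁻¹ * (ζ 0 - ζ 1)) • G ζ) := fun Ψ => by
    refine (hi.const_mul (14 ^ 1 * ((Finset.Iic (1, 0)).sup
      (schwartzSeminormFamily ℂ ℝ ℂ)) Ψ)).mono'
      ((Ψ.continuous.comp (f := fun ζ : Plane => (2 * Real.pi)⁻¹ * (ζ 0 - ζ 1))
        (by fun_prop)).aestronglyMeasurable.smul hG) (ae_of_all _ fun ζ => ?_)
    rw [norm_smul, ← mul_assoc]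
    gcongr
    simpa using norm_scaled_schwartz_le 1 Ψ (ζ 0 - ζ 1)
  let L : 𝓢(ℝ, ℂ) →L[ℂ] Vec n := SchwartzMap.mkCLMtoNormedSpace (σ := RingHom.id ℂ)
    (fun Ψ => ∫ ζ : Plane, Ψ ((2 * Real.pi)⁻¹ * (ζ 0 - ζ 1)) • G ζ)
    (fun Ψ₁ Ψ₂ => by
      rw [← integral_add (hI Ψ₁) (hI Ψ₂)]
      simp only [add_apply, add_smul])
    (fun a Ψ => by
      simp only [smul_apply, smul_assoc, integral_smul, RingHom.id_apply])
    ⟨Finset.Iic (1, 0), 14 ^ 1 * ∫ ζ : Plane, (brk (ζ 0 - ζ 1))⁻¹ * ‖G ζ‖,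
      mul_nonneg (by positivity) (integral_nonneg fun ζ =>
        mul_nonneg (inv_brk_pos _).le (norm_nonneg _)), fun Ψ => by
      refine (norm_integral_le_integral_norm _).trans ?_
      calc _ ≤ ∫ ζ : Plane, (14 ^ 1 * ((Finset.Iic (1, 0)).sup
              (schwartzSeminormFamily ℂ ℝ ℂ)) Ψ) * ((brk (ζ 0 - ζ 1))⁻¹ * ‖G ζ‖) := by
            refine integral_mono (hI Ψ).norm (hi.const_mul _) fun ζ => ?_
            simp only [norm_smul]
            rw [← mul_assoc]
            gcongr
            simpa using norm_scaled_schwartz_le 1 Ψ (ζ 0 - ζ 1)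
        _ = _ := by rw [integral_const_mul]; ring⟩
  refine ⟨ContinuousLinearMap.toPointwiseConvergenceCLM _ _ _ _
    (L.comp (FourierTransform.fourierInvCLM ℂ 𝓢(ℝ, ℂ))), fun θ => ?_⟩
  change (∫ ζ : Plane, (𝓕⁻ θ : 𝓢(ℝ, ℂ)) ((2 * Real.pi)⁻¹ * (ζ 0 - ζ 1)) • G ζ) = _
  simp only [fourierInv_eq_osc1]

/-! ### Uniqueness of primitives -/

/-- The primitive from -∞ vanishes to the left of the support, and to its right because the total
integral is zero. -/
lemma exists_compact_primitive {u : ℝ → ℝ} (hu : ContDiff ℝ (⊤ : ℕ∞) u) (hc : HasCompactSupport u)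
    (h0 : ∫ x, u x = 0) : ∃ θ : 𝓢(ℝ, ℂ), HasCompactSupport θ ∧ ∀ x, deriv θ x = (u x : ℂ) := by
  obtain ⟨R, hR⟩ := hc.isCompact.isBounded.subset_closedBall 0
  have hz : ∀ x, R < |x| → u x = 0 := fun x hx => by
    refine image_eq_zero_of_notMem_tsupport fun hm => ?_
    have := hR hm
    rw [mem_closedBall_zero_iff, Real.norm_eq_abs] at this
    linarith
  let v : ℝ → ℝ := fun x => ∫ y in Iic x, u y
  have hui : Integrable u := hu.continuous.integrable_of_hasCompactSupport hc
  have hvd : ∀ x, HasDerivAt v (u x) x := fun x => by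
    have h1 : ∀ y, v y = (∫ t in Iic x, u t) + ∫ t in x..y, u t := fun y => by
      rw [← intervalIntegral.integral_Iic_sub_Iic hui.integrableOn hui.integrableOn]
      simp only [v]; ring
    have h2 := (hu.continuous.integral_hasStrictDerivAt x x).hasDerivAt
    have h3 : v = fun y => (∫ t in Iic x, u t) + ∫ t in x..y, u t := funext h1
    rw [h3]
    exact h2.const_add _
  have hvc : HasCompactSupport v := by
    refine HasCompactSupport.intro (isCompact_Icc (a := -|R|) (b := |R|)) fun x hx => ?_
    rw [mem_Icc, not_and_or, not_le, not_le] at hx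
    rcases hx with hx | hx
    · refine setIntegral_eq_zero_of_forall_eq_zero fun y hy => hz y ?_
      have : y ≤ x := hy
      have := neg_abs_le y
      linarith [le_abs_self R]
    · simp only [v]
      rw [← h0]
      refine setIntegral_eq_integral_of_forall_compl_eq_zero fun y hy => hz y ?_
      have : x < y := by simpa using hy
      linarith [le_abs_self y, le_abs_self R]
  have hvs : ContDiff ℝ (⊤ : ℕ∞) v := by
    rw [contDiff_infty_iff_deriv]
    refine ⟨fun x => (hvd x).differentiableAt, ?_⟩
    rwa [show deriv v = u from funext fun x => (hvd x).deriv]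
  have hcs : HasCompactSupport (fun x => ((v x : ℝ) : ℂ)) := hvc.comp_left Complex.ofReal_zero
  refine ⟨hcs.toSchwartzMap (Complex.ofRealCLM.contDiff.comp hvs), hcs, fun x => ?_⟩
  exact (hvd x).ofReal_comp.deriv

/-- The lemma of du Bois-Reymond: any test function minus its integral times a normalised bump ρ is
a derivative, so h is orthogonal to it, and the constant value is the mean of h against ρ. -/
lemma eq_const_of_integral_deriv_smul {h : ℝ → Vec n} (hc : Continuous h)
    (h0 : ∀ θ : 𝓢(ℝ, ℂ), HasCompactSupport θ → ∫ x, deriv θ x • h x = 0) (a b : ℝ) :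
    h a = h b := by
  let B : ContDiffBump (0 : ℝ) := ⟨1, 2, one_pos, one_lt_two⟩
  let ρ : ℝ → ℝ := B.normed volume
  have hρs : ContDiff ℝ (⊤ : ℕ∞) ρ := B.contDiff_normed
  have hρc : HasCompactSupport ρ := B.hasCompactSupport_normed
  have hρ1 : ∫ x, ρ x = 1 := B.integral_normed
  have hint : ∀ {u : ℝ → ℝ}, Continuous u → HasCompactSupport u →
      Integrable (fun x => u x • h x) := fun hu huc =>
    (hu.smul hc).integrable_of_hasCompactSupport huc.smul_right
  set c : Vec n := ∫ x, ρ x • h x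
  have key := ae_eq_zero_of_integral_contDiff_smul_eq_zero (μ := volume)
    (hc.sub continuous_const).locallyIntegrable (f := fun x => h x - c) (fun v hv hvc => ?_)
  · have h1 : h =ᵐ[volume] fun _ => c := by
      filter_upwards [key] with x hx
      exact sub_eq_zero.1 hx
    have := (Continuous.ae_eq_iff_eq volume hc continuous_const).1 h1
    rw [this]
  · have hvi : Integrable v := hv.continuous.integrable_of_hasCompactSupport hvc
    have hρi : Integrable ρ := hρs.continuous.integrable_of_hasCompactSupport hρc
    obtain ⟨θ, hθc, hθ⟩ := exists_compact_primitive (u := fun x => v x - (∫ y, v y) * ρ x)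
      (hv.sub (contDiff_const.mul hρs)) (hvc.sub hρc.mul_left) (by
        rw [integral_sub hvi (hρi.const_mul _), integral_const_mul, hρ1, mul_one, sub_self])
    have := h0 θ hθc
    simp only [hθ, Complex.coe_smul, sub_smul, mul_smul] at this
    have i2 : Integrable (fun x => (∫ y, v y) • ρ x • h x) :=
      (hint hρs.continuous hρc).fun_smul _
    rw [integral_sub (hint hv.continuous hvc) i2, integral_smul] at this
    simp only [smul_sub]
    rw [integral_sub (hint hv.continuous hvc) (hvi.smul_const c), integral_smul_const]
    exact this

/-- The integral is defined through a chosen primitive; any two differ by a constant, so any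
explicit one may be used. -/
lemma distribIntegral_eq {T : 𝓢'(ℝ, Vec n)} {P : ℝ → Vec n} (hP : IsPrimitive T P) (a b : ℝ) :
    distribIntegral T a b = P b - P a := by
  have hex : ∃ P, IsPrimitive T P := ⟨P, hP⟩
  rw [distribIntegral, dif_pos hex]
  obtain ⟨hc, hd⟩ := hex.choose_spec
  set P' := hex.choose
  have hint : ∀ {h : ℝ → Vec n} (_ : Continuous h) (θ : 𝓢(ℝ, ℂ)), HasCompactSupport θ →
      Integrable (fun x => deriv θ x • h x) := fun hh θ hθ =>
    (((SchwartzMap.derivCLM ℂ ℂ θ).continuous).smul hh).integrable_of_hasCompactSupport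
      (HasCompactSupport.smul_right (f := deriv θ) hθ.deriv)
  have := eq_const_of_integral_deriv_smul (h := fun x => P' x - P x) (hc.sub hP.1)
    (fun θ hθ => by
      simp only [smul_sub]
      rw [integral_sub (hint hc θ hθ) (hint hP.1 θ hθ)]
      have := (hd θ hθ).symm.trans (hP.2 θ hθ)
      rw [neg_inj.1 this, sub_self]) b a
  exact sub_eq_sub_iff_sub_eq_sub.1 this

lemma distribSum_eq {ι : Type*} {p : ι → ℝ → Vec n} {T : 𝓢'(ℝ, Vec n)} (h : HasDistribSum p T) :
    distribSum p = T := by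
  have hex : ∃ T, HasDistribSum p T := ⟨T, h⟩
  rw [distribSum, dif_pos hex]
  ext1 θ
  exact ((hex.choose_spec θ).2).unique (h θ).2

/-! ### Distributions of one variable whose density depends on `τ - ξ` -/

lemma integrable_brk_mul (θ : 𝓢(ℝ, ℂ)) : Integrable (fun x => (|x| + 2) * ‖θ x‖) := by
  have h1 := θ.integrable_pow_mul volume 1
  have h2 := (θ.integrable (μ := volume)).norm.const_mul 2
  refine (h1.add h2).congr (ae_of_all _ fun x => ?_)
  simp [add_mul]

lemma integral_deriv_mul_D (θ : 𝓢(ℝ, ℂ)) (ω : ℝ) :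
    ∫ x, deriv θ x * D ω x = -osc1 θ ω := by
  have hb : ∀ κ : 𝓢(ℝ, ℂ), Integrable (fun x => D ω x * κ x) := fun κ => by
    refine (integrable_brk_mul κ).mono' ?_ (ae_of_all _ fun x => ?_)
    · exact (Continuous.mul (by fun_prop) κ.continuous).aestronglyMeasurable
    · rw [norm_mul]
      gcongr
      linarith [norm_D_le ω x]
  have hi : Integrable (fun x => ex (ω * x) * θ x) := by
    refine (θ.integrable (μ := volume)).norm.mono'
      (Continuous.mul (by fun_prop) θ.continuous).aestronglyMeasurable (ae_of_all _ fun x => ?_)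
    simp
  have := integral_mul_deriv_eq_deriv_mul_of_integrable (u := D ω) (v := θ)
    (u' := fun x => ex (ω * x)) (v' := deriv θ) (fun x _ => hasDerivAt_D ω x)
    (fun x _ => θ.differentiableAt.hasDerivAt) (hb (SchwartzMap.derivCLM ℂ ℂ θ)) hi (hb θ)
  rw [osc1, ← this]
  simp only [mul_comm]

/-- Along the antidiagonal the symbol at (τ, ξ) oscillates with frequency τ-ξ, whose primitive is `D
(τ-ξ)`. The decay ⟨τ-ξ⟩⁻¹ of `D` makes the integral converge for multipliers that are controlled
only after that gain. -/
lemma isPrimitive_of_symbol {g : Plane → Vec n} (hg : WtIntegrable g) {m : Plane → ℂ} {K : ℝ}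
    (hm : AEStronglyMeasurable m) (hb : ∀ ζ, ‖m ζ‖ * (brk (ζ 0 - ζ 1))⁻¹ ≤ K * wt ζ)
    {T : 𝓢'(ℝ, Vec n)} (hT : ∀ θ, T θ = cF • ∫ ζ : Plane, osc1 θ (ζ 0 - ζ 1) • (m ζ • g ζ)) :
    IsPrimitive T (fun x => cF • ∫ ζ : Plane, D (ζ 0 - ζ 1) x • (m ζ • g ζ)) := by
  constructor
  · simp only [smul_smul (D _ _)]
    refine (hg.continuous_integral (k := fun x ζ => D (ζ 0 - ζ 1) x * m ζ)
      (M := fun x => (|x| + 2) * K) (by fun_prop) (fun x => ?_) (fun ζ => by fun_prop)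
      (fun x ζ => ?_)).const_smul cF
    · exact (Continuous.aestronglyMeasurable (by fun_prop)).mul hm
    · rw [norm_mul]
      calc _ ≤ (|x| + 2) * (brk (ζ 0 - ζ 1))⁻¹ * ‖m ζ‖ := by
              exact mul_le_mul_of_nonneg_right (norm_D_le_brk _ _) (norm_nonneg _)
        _ = (|x| + 2) * (‖m ζ‖ * (brk (ζ 0 - ζ 1))⁻¹) := by ring
        _ ≤ (|x| + 2) * (K * wt ζ) := by
              exact mul_le_mul_of_nonneg_left (hb ζ) (by positivity)
        _ = _ := by ring
  · intro θ _
    have hθ := integrable_brk_mul (SchwartzMap.derivCLM ℂ ℂ θ)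
    have hv : Integrable (fun ζ : Plane => (brk (ζ 0 - ζ 1))⁻¹ * ‖m ζ • g ζ‖) := by
      refine (hg.integrable.const_mul K).mono' ?_ (ae_of_all _ fun ζ => ?_)
      · exact (Continuous.aestronglyMeasurable (by fun_prop)).mul (hm.smul hg.meas).norm
      · rw [norm_mul, norm_norm, norm_smul, Real.norm_of_nonneg (inv_brk_pos _).le, ← mul_assoc,
          ← mul_assoc]
        refine mul_le_mul_of_nonneg_right ?_ (norm_nonneg _)
        exact (mul_comm _ _).trans_le (hb ζ)
    have := (integral_integral_smul_swap (μ := volume) (ν := volume)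
      (k := fun x (ζ : Plane) => deriv θ x * D (ζ 0 - ζ 1) x)
      (G := fun ζ => m ζ • g ζ) (w := fun x => (|x| + 2) * ‖deriv θ x‖)
      (v := fun ζ => (brk (ζ 0 - ζ 1))⁻¹) ?_ (hm.smul hg.meas) (fun x ζ => ?_) hθ hv).2
    · simp only [smul_comm _ cF, ← integral_smul, mul_smul] at this ⊢
      simp only [integral_smul] at this ⊢
      rw [this, hT]
      simp only [integral_deriv_mul_D, neg_smul, integral_neg, smul_neg, neg_neg]
    · have : Continuous (deriv θ) := (SchwartzMap.derivCLM ℂ ℂ θ).continuous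
      unfold Function.uncurry; fun_prop
    · rw [norm_mul]
      calc _ ≤ ‖deriv θ x‖ * ((|x| + 2) * (brk (ζ 0 - ζ 1))⁻¹) := by
            gcongr; exact norm_D_le_brk _ _
        _ = _ := by ring

/-! ### Dyadic partitions of unity -/

section Dyadic

variable {φ : ℕ → 𝓢(ℝ, ℂ)}

/-- The high-frequency part `∑_{k ≥ 1} φ_k` of a partition of unity. -/
def high (φ : ℕ → 𝓢(ℝ, ℂ)) (x : ℝ) : ℂ := 1 - φ 0 x

@[fun_prop] lemma _root_.Continuous.high {X : Type*} [TopologicalSpace X] {f : X → ℝ}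
    (hf : Continuous f) (φ : ℕ → 𝓢(ℝ, ℂ)) : Continuous fun x => high φ (f x) :=
  (continuous_const.sub (φ 0).continuous).comp hf

@[fun_prop] lemma _root_.Continuous.schwartz {X : Type*} [TopologicalSpace X] {f : X → ℝ}
    (hf : Continuous f) (θ : 𝓢(ℝ, ℂ)) : Continuous fun x => θ (f x) :=
  θ.continuous.comp hf

lemma exists_norm_schwartz_le (θ : 𝓢(ℝ, ℂ)) :
    ∃ C : ℝ, 0 ≤ C ∧ ∀ x, ‖θ x‖ ≤ C * (brk x)⁻¹ := by
  refine ⟨2 ^ 1 * ((Finset.Iic (1, 0)).sup (schwartzSeminormFamily ℂ ℝ ℂ)) θ,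
    mul_nonneg (by positivity) (apply_nonneg _ _), fun x => ?_⟩
  have h := SchwartzMap.one_add_le_sup_seminorm_apply (𝕜 := ℂ) (m := (1, 0)) (k := 1) (n := 0)
    le_rfl le_rfl θ x
  rw [norm_iteratedFDeriv_zero, pow_one] at h
  rw [le_mul_inv_iff₀ (brk_pos x), mul_comm]
  exact h

namespace IsDyadicPartition

lemma exists_bound (hφ : IsDyadicPartition φ) : ∃ c : ℝ, 0 < c ∧ ∀ j x, ‖φ j x‖ ≤ c := by
  obtain ⟨c, hc, h⟩ := hφ.deriv_bound 0
  exact ⟨c, hc, fun j x => by simpa using h j x⟩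

lemma of_ne_zero (hφ : IsDyadicPartition φ) {k : ℕ} {x : ℝ} (h : φ (k + 1) x ≠ 0) :
    (2 : ℝ) ^ k ≤ |x| ∧ |x| ≤ 2 ^ (k + 2) := by
  have := hφ.tsupport_succ (k + 1) (by omega) (subset_tsupport _ h)
  simpa using this

lemma succ_eq_zero (hφ : IsDyadicPartition φ) {x : ℝ} (h : |x| < 1) (k : ℕ) :
    φ (k + 1) x = 0 := by
  by_contra h0
  have h1 := (hφ.of_ne_zero h0).1
  have h2 : (1 : ℝ) ≤ 2 ^ k := one_le_pow₀ (by norm_num)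
  linarith

/-- At each point at most three of the functions are nonzero, since 2^k ≤ |x| ≤ 2^{k+2} on the
support of φ_{k+1}. -/
lemma sum_norm_le (hφ : IsDyadicPartition φ) {c : ℝ} (hc : ∀ j x, ‖φ j x‖ ≤ c) (x : ℝ)
    (s : Finset ℕ) : ∑ k ∈ s, ‖φ (k + 1) x‖ ≤ 3 * c := by
  have hc0 : 0 ≤ c := (norm_nonneg _).trans (hc 0 0)
  rcases lt_or_ge |x| 1 with hx | hx
  · simp only [hφ.succ_eq_zero hx, norm_zero, Finset.sum_const_zero]
    positivity
  obtain ⟨m, hm1, hm2⟩ := exists_nat_pow_near hx one_lt_two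
  calc ∑ k ∈ s, ‖φ (k + 1) x‖ = ∑ k ∈ s with φ (k + 1) x ≠ 0, ‖φ (k + 1) x‖ := by
        rw [Finset.sum_filter_of_ne]
        intro k _ hk
        simpa using hk
    -- Here m is the integer part of log₂|x|; truncation of m - 2 at zero can only shorten the
    -- range.
    _ ≤ ∑ k ∈ Finset.Icc (m - 2) m, c := by
        refine (Finset.sum_le_sum fun k _ => hc _ _).trans
          (Finset.sum_le_sum_of_subset_of_nonneg (fun k hk => ?_) fun _ _ _ => hc0)
        obtain ⟨h1, h2⟩ := hφ.of_ne_zero (Finset.mem_filter.1 hk).2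
        have k1 : k < m + 1 := (pow_lt_pow_iff_right₀ (one_lt_two (α := ℝ))).1 (h1.trans_lt hm2)
        have k2 : m ≤ k + 2 := (pow_le_pow_iff_right₀ (one_lt_two (α := ℝ))).1 (hm1.trans h2)
        exact Finset.mem_Icc.2 ⟨by omega, by omega⟩
    _ ≤ _ := by
        rw [Finset.sum_const, nsmul_eq_mul, Nat.card_Icc]
        have : ((m + 1 - (m - 2) : ℕ) : ℝ) ≤ 3 := by exact_mod_cast (by omega)
        gcongr

lemma hasSum_high (hφ : IsDyadicPartition φ) (x : ℝ) :
    HasSum (fun k => φ (k + 1) x) (high φ x) := by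
  have := (hasSum_nat_add_iff' (f := fun j => φ j x) 1).2 (hφ.hasSum_one x)
  simpa [high] using this

lemma high_eq_zero (hφ : IsDyadicPartition φ) {x : ℝ} (h : |x| < 1) : high φ x = 0 := by
  have := hφ.hasSum_high x
  simp only [hφ.succ_eq_zero h] at this
  exact this.unique hasSum_zero

lemma norm_high_le (hφ : IsDyadicPartition φ) {c : ℝ} (hc : ∀ j x, ‖φ j x‖ ≤ c) (x : ℝ) :
    ‖high φ x‖ ≤ 3 * c :=
  le_of_tendsto (hφ.hasSum_high x).norm (Eventually.of_forall fun s =>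
    (norm_sum_le _ _).trans (hφ.sum_norm_le hc x s))

lemma sum_prod_norm_le (hφ : IsDyadicPartition φ) {c : ℝ} (hc : ∀ j x, ‖φ j x‖ ≤ c) (x y : ℝ)
    (s : Finset (ℕ × ℕ)) :
    ∑ q ∈ s, ‖φ (q.1 + 1) x‖ * ‖φ (q.2 + 1) y‖ ≤ 9 * c ^ 2 := by
  classical
  have hc0 : 0 ≤ c := (norm_nonneg _).trans (hc 0 0)
  have hs : s ⊆ s.image Prod.fst ×ˢ s.image Prod.snd := Finset.subset_product
  refine (Finset.sum_le_sum_of_subset_of_nonneg hs fun q _ _ =>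
    mul_nonneg (norm_nonneg (φ (q.1 + 1) x)) (norm_nonneg (φ (q.2 + 1) y))).trans ?_
  rw [Finset.sum_product]
  simp only
  rw [← Finset.sum_mul_sum]
  refine (mul_le_mul (hφ.sum_norm_le hc _ _) (hφ.sum_norm_le hc _ _)
    (Finset.sum_nonneg fun _ _ => norm_nonneg _) (by positivity)).trans (le_of_eq ?_)
  ring

lemma hasSum_prod (hφ : IsDyadicPartition φ) (x y : ℝ) :
    HasSum (fun q : ℕ × ℕ => φ (q.1 + 1) x * φ (q.2 + 1) y) (high φ x * high φ y) := by
  obtain ⟨c, -, hc⟩ := hφ.exists_bound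
  have hs : Summable fun q : ℕ × ℕ => φ (q.1 + 1) x * φ (q.2 + 1) y := by
    refine Summable.of_norm (summable_of_sum_le (c := 9 * c ^ 2) (fun _ => norm_nonneg _)
      fun s => ?_)
    simp only [norm_mul]
    exact hφ.sum_prod_norm_le hc x y s
  exact HasSum.mul (f := fun j => φ (j + 1) x) (g := fun k => φ (k + 1) y)
    (hφ.hasSum_high x) (hφ.hasSum_high y) hs

end IsDyadicPartition

end Dyadic

/-! ### Multipliers -/

lemma inv_brk_mul_inv_brk_le (ζ : Plane) : (brk (ζ 0))⁻¹ * (brk (ζ 1))⁻¹ ≤ wt ζ := by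
  have h0 := inv_brk_pos (ζ 0)
  have h1 := inv_brk_pos (ζ 1)
  have h2 := inv_brk_pos (ζ 0 - ζ 1)
  unfold wt
  nlinarith [mul_pos h0 h2, mul_pos h1 h2]

lemma inv_brk_right_mul_le (ζ : Plane) : (brk (ζ 1))⁻¹ * (brk (ζ 0 - ζ 1))⁻¹ ≤ wt ζ := by
  have h0 := inv_brk_pos (ζ 0)
  have h1 := inv_brk_pos (ζ 1)
  have h2 := inv_brk_pos (ζ 0 - ζ 1)
  unfold wt
  nlinarith [mul_pos h0 h2, mul_pos h0 h1]

lemma inv_brk_left_mul_le (ζ : Plane) : (brk (ζ 0))⁻¹ * (brk (ζ 0 - ζ 1))⁻¹ ≤ wt ζ := by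
  have h0 := inv_brk_pos (ζ 0)
  have h1 := inv_brk_pos (ζ 1)
  have h2 := inv_brk_pos (ζ 0 - ζ 1)
  unfold wt
  nlinarith [mul_pos h1 h2, mul_pos h0 h1]

/-- `1 / (ix)`. -/
def invI (x : ℝ) : ℂ := 1 / (Complex.I * x)

@[fun_prop] lemma measurable_invI : Measurable invI := by unfold invI; fun_prop

lemma norm_invI (x : ℝ) : ‖invI x‖ = |x|⁻¹ := by simp [invI]

/-- At x = 0 the quotient is 0 by convention, and the identity survives because the high-frequency
part vanishes for |x| < 1. -/
lemma I_mul_invI_mul {φ : ℕ → 𝓢(ℝ, ℂ)} (hφ : IsDyadicPartition φ) (x : ℝ) :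
    Complex.I * x * (invI x * high φ x) = high φ x := by
  rcases eq_or_ne x 0 with rfl | h
  · rw [hφ.high_eq_zero (by simp)]; simp
  · have : (x : ℂ) ≠ 0 := Complex.ofReal_ne_zero.2 h
    rw [← mul_assoc, invI, mul_one_div_cancel (mul_ne_zero Complex.I_ne_zero this), one_mul]

lemma norm_invI_mul_le {x : ℝ} {z : ℂ} (h : |x| < 1 → z = 0) :
    ‖invI x‖ * ‖z‖ ≤ 2 * (brk x)⁻¹ * ‖z‖ := by
  rcases lt_or_ge |x| 1 with hx | hx
  · simp [h hx]
  · rw [norm_invI]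
    gcongr
    exact inv_abs_le hx

lemma IsDyadicPartition.sum_norm_invI_le {φ : ℕ → 𝓢(ℝ, ℂ)} (hφ : IsDyadicPartition φ) {c : ℝ}
    (hc : ∀ j x, ‖φ j x‖ ≤ c) (x : ℝ) (s : Finset ℕ) :
    ∑ k ∈ s, ‖invI x‖ * ‖φ (k + 1) x‖ ≤ 6 * c * (brk x)⁻¹ := by
  have h0 := inv_brk_pos x
  refine (Finset.sum_le_sum fun k _ => norm_invI_mul_le fun h => hφ.succ_eq_zero h k).trans ?_
  rw [← Finset.mul_sum]
  nlinarith [hφ.sum_norm_le hc x s]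

/-! ### The pointwise series -/

section Series

variable {φ : ℕ → 𝓢(ℝ, ℂ)} {f : 𝓢'(Plane, Vec n)}

/-- The operator with kernel `k` and multiplier `m` applied to the density `g`. -/
def opInt (k m : Plane → ℂ) (g : Plane → Vec n) : Vec n := cF • ∫ ζ : Plane, (k ζ * m ζ) • g ζ

/-- The character `e^{i(ατ + βξ)}`. -/
def chi (α β : ℝ) (ζ : Plane) : ℂ := ex (α * ζ 0 + β * ζ 1)

@[fun_prop] lemma _root_.Continuous.chi {X : Type*} [TopologicalSpace X] {a b : X → ℝ}
    {z : X → Plane} (ha : Continuous a) (hb : Continuous b) (hz : Continuous z) :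
    Continuous fun x => chi (a x) (b x) (z x) := by unfold NullWave.chi; fun_prop

@[simp] lemma norm_chi (α β : ℝ) (ζ : Plane) : ‖chi α β ζ‖ = 1 := norm_ex _

lemma WtIntegrable.hasSum_opInt {ι : Type*} [Countable ι] {g : Plane → Vec n}
    (hg : WtIntegrable g) {m : ι → Plane → ℂ} {M : Plane → ℂ} {K : ℝ}
    (hm : ∀ i, AEStronglyMeasurable (m i))
    (hb : ∀ ζ (s : Finset ι), ∑ i ∈ s, ‖m i ζ‖ ≤ K * wt ζ)
    (hM : ∀ ζ, HasSum (fun i => m i ζ) (M ζ)) (α β : ℝ) :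
    HasSum (fun i => opInt (chi α β) (m i) g) (opInt (chi α β) M g) := by
  refine HasSum.const_smul cF (hg.hasSum_integral (K := K)
    (fun i => (Continuous.aestronglyMeasurable (by fun_prop)).mul (hm i)) (fun ζ s => ?_)
    fun ζ => (hM ζ).mul_left _)
  simpa using hb ζ s

lemma WtIntegrable.continuous_opInt {g : Plane → Vec n} (hg : WtIntegrable g) {m : Plane → ℂ}
    {K : ℝ} (hm : AEStronglyMeasurable m) (hb : ∀ ζ, ‖m ζ‖ ≤ K * wt ζ) :
    Continuous fun p : ℝ × ℝ => opInt (chi p.1 p.2) m g := by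
  refine (hg.continuous_integral (k := fun (p : ℝ × ℝ) ζ => chi p.1 p.2 ζ * m ζ)
    (M := fun _ => K) continuous_const
    (fun p => (Continuous.aestronglyMeasurable (by fun_prop)).mul hm) (fun ζ => by fun_prop)
    fun p ζ => ?_).const_smul cF
  simpa using hb ζ

variable (φ) in
/-- The multipliers of the four parts of the formula. -/
def mulH (ζ : Plane) : ℂ := φ 0 (ζ 0) * φ 0 (ζ 1)
variable (φ) in
def mulI (ζ : Plane) : ℂ := invI (ζ 1) * φ 0 (ζ 0) * high φ (ζ 1)
variable (φ) in
def mulJ (ζ : Plane) : ℂ := invI (ζ 0) * high φ (ζ 0) * φ 0 (ζ 1)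
variable (φ) in
def mulG (ζ : Plane) : ℂ := 1 / ((Complex.I * ζ 0) * (Complex.I * ζ 1)) * high φ (ζ 0) * high φ (ζ 1)

lemma exists_low_bound (φ : ℕ → 𝓢(ℝ, ℂ)) :
    ∃ C : ℝ, 0 ≤ C ∧ ∀ x, ‖φ 0 x‖ ≤ C * (brk x)⁻¹ := exists_norm_schwartz_le _

lemma measurable_invProd : Measurable fun ζ : Plane =>
    1 / ((Complex.I * ζ 0) * (Complex.I * ζ 1)) := by fun_prop

lemma block_eq (α β : ℝ) :
    block φ 0 0 f α β = opInt (chi α β) (mulH φ) (fourierDensity f) := rfl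

lemma exists_norm_mulH_le (φ : ℕ → 𝓢(ℝ, ℂ)) : ∃ K : ℝ, ∀ ζ, ‖mulH φ ζ‖ ≤ K * wt ζ := by
  obtain ⟨C, hC, h⟩ := exists_low_bound φ
  refine ⟨C * C, fun ζ => ?_⟩
  have h0 := inv_brk_pos (ζ 0)
  calc ‖mulH φ ζ‖ ≤ (C * (brk (ζ 0))⁻¹) * (C * (brk (ζ 1))⁻¹) := by
        rw [mulH, norm_mul]; gcongr <;> exact h _
    _ = C * C * ((brk (ζ 0))⁻¹ * (brk (ζ 1))⁻¹) := by ring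
    _ ≤ _ := by gcongr; exact inv_brk_mul_inv_brk_le ζ

lemma continuous_mulH : Continuous (mulH φ) := by unfold mulH; fun_prop

lemma measurable_mulI : AEStronglyMeasurable (mulI φ) :=
  Measurable.aestronglyMeasurable (((measurable_invI.comp (by fun_prop)).mul
    (Continuous.measurable (by fun_prop))).mul (Continuous.measurable (by fun_prop)))

lemma measurable_mulJ : AEStronglyMeasurable (mulJ φ) :=
  Measurable.aestronglyMeasurable (((measurable_invI.comp (by fun_prop)).mul
    (Continuous.measurable (by fun_prop))).mul (Continuous.measurable (by fun_prop)))

lemma measurable_mulG : AEStronglyMeasurable (mulG φ) :=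
  Measurable.aestronglyMeasurable ((measurable_invProd.mul
    (Continuous.measurable (by fun_prop))).mul (Continuous.measurable (by fun_prop)))

/-- The factor φ₀(τ) decays like ⟨τ⟩⁻¹ and the quotient by ξ, on high frequencies, like ⟨ξ⟩⁻¹;
together they fit the product part of `wt` uniformly in the partial sums. -/
lemma IsDyadicPartition.exists_sumI (hφ : IsDyadicPartition φ)
    (hg : WtIntegrable (fourierDensity f)) : (∃ K, ∀ ζ, ‖mulI φ ζ‖ ≤ K * wt ζ) ∧
      ∀ α β, HasSum (fun k => blockIntβ φ 0 (k + 1) f α β)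
        (opInt (chi α β) (mulI φ) (fourierDensity f)) := by
  obtain ⟨c, hc0, hc⟩ := hφ.exists_bound
  obtain ⟨C, hC, hl⟩ := exists_low_bound φ
  let m : ℕ → Plane → ℂ := fun k ζ => 1 / (Complex.I * ζ 1) * φ 0 (ζ 0) * φ (k + 1) (ζ 1)
  have hM : ∀ ζ, HasSum (fun k => m k ζ) (mulI φ ζ) := fun ζ =>
    (hφ.hasSum_high (ζ 1)).mul_left _
  have hb : ∀ ζ (s : Finset ℕ), ∑ k ∈ s, ‖m k ζ‖ ≤ (6 * c * C) * wt ζ := fun ζ s => by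
    have h1 := inv_brk_pos (ζ 1)
    calc ∑ k ∈ s, ‖m k ζ‖ = ‖φ 0 (ζ 0)‖ * ∑ k ∈ s, ‖invI (ζ 1)‖ * ‖φ (k + 1) (ζ 1)‖ := by
          rw [Finset.mul_sum]
          refine Finset.sum_congr rfl fun k _ => ?_
          simp only [m, norm_mul, invI]; ring
      _ ≤ (C * (brk (ζ 0))⁻¹) * (6 * c * (brk (ζ 1))⁻¹) := by
          gcongr
          · exact mul_nonneg hC (inv_brk_pos _).le
          · exact hl _
          · exact hφ.sum_norm_invI_le hc _ s
      _ = 6 * c * C * ((brk (ζ 0))⁻¹ * (brk (ζ 1))⁻¹) := by ring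
      _ ≤ _ := by gcongr; exact inv_brk_mul_inv_brk_le ζ
  refine ⟨⟨_, fun ζ => le_of_tendsto (hM ζ).norm (Eventually.of_forall fun s =>
    (norm_sum_le _ _).trans (hb ζ s))⟩, fun α β => ?_⟩
  exact hg.hasSum_opInt (m := m) (fun k => Measurable.aestronglyMeasurable
    (((measurable_invI.comp (by fun_prop)).mul (Continuous.measurable (by fun_prop))).mul
      (Continuous.measurable (by fun_prop)))) hb hM α β

lemma IsDyadicPartition.exists_sumJ (hφ : IsDyadicPartition φ)
    (hg : WtIntegrable (fourierDensity f)) : (∃ K, ∀ ζ, ‖mulJ φ ζ‖ ≤ K * wt ζ) ∧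
      ∀ α β, HasSum (fun j => blockIntα φ (j + 1) 0 f α β)
        (opInt (chi α β) (mulJ φ) (fourierDensity f)) := by
  obtain ⟨c, hc0, hc⟩ := hφ.exists_bound
  obtain ⟨C, hC, hl⟩ := exists_low_bound φ
  let m : ℕ → Plane → ℂ := fun k ζ => 1 / (Complex.I * ζ 0) * φ (k + 1) (ζ 0) * φ 0 (ζ 1)
  have hM : ∀ ζ, HasSum (fun k => m k ζ) (mulJ φ ζ) := fun ζ =>
    ((hφ.hasSum_high (ζ 0)).mul_left _).mul_right _
  have hb : ∀ ζ (s : Finset ℕ), ∑ k ∈ s, ‖m k ζ‖ ≤ (6 * c * C) * wt ζ := fun ζ s => by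
    have h1 := inv_brk_pos (ζ 0)
    calc ∑ k ∈ s, ‖m k ζ‖ = ‖φ 0 (ζ 1)‖ * ∑ k ∈ s, ‖invI (ζ 0)‖ * ‖φ (k + 1) (ζ 0)‖ := by
          rw [Finset.mul_sum]
          refine Finset.sum_congr rfl fun k _ => ?_
          simp only [m, norm_mul, invI]; ring
      _ ≤ (C * (brk (ζ 1))⁻¹) * (6 * c * (brk (ζ 0))⁻¹) := by
          gcongr
          · exact mul_nonneg hC (inv_brk_pos _).le
          · exact hl _
          · exact hφ.sum_norm_invI_le hc _ s
      _ = 6 * c * C * ((brk (ζ 0))⁻¹ * (brk (ζ 1))⁻¹) := by ring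
      _ ≤ _ := by gcongr; exact inv_brk_mul_inv_brk_le ζ
  refine ⟨⟨_, fun ζ => le_of_tendsto (hM ζ).norm (Eventually.of_forall fun s =>
    (norm_sum_le _ _).trans (hb ζ s))⟩, fun α β => ?_⟩
  exact hg.hasSum_opInt (m := m) (fun k => Measurable.aestronglyMeasurable
    (((measurable_invI.comp (by fun_prop)).mul (Continuous.measurable (by fun_prop))).mul
      (Continuous.measurable (by fun_prop)))) hb hM α β

lemma IsDyadicPartition.exists_sumG (hφ : IsDyadicPartition φ)
    (hg : WtIntegrable (fourierDensity f)) : (∃ K, ∀ ζ, ‖mulG φ ζ‖ ≤ K * wt ζ) ∧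
      ∀ α β, HasSum (fun q : ℕ × ℕ => blockIntαβ φ (q.1 + 1) (q.2 + 1) f α β)
        (opInt (chi α β) (mulG φ) (fourierDensity f)) := by
  obtain ⟨c, hc0, hc⟩ := hφ.exists_bound
  let m : ℕ × ℕ → Plane → ℂ := fun q ζ =>
    1 / ((Complex.I * ζ 0) * (Complex.I * ζ 1)) * φ (q.1 + 1) (ζ 0) * φ (q.2 + 1) (ζ 1)
  have hM : ∀ ζ, HasSum (fun q => m q ζ) (mulG φ ζ) := fun ζ => by
    have := (hφ.hasSum_prod (ζ 0) (ζ 1)).mul_left (1 / ((Complex.I * ζ 0) * (Complex.I * ζ 1)))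
    simpa only [mulG, m, mul_assoc] using this
  have hb : ∀ ζ (s : Finset (ℕ × ℕ)), ∑ q ∈ s, ‖m q ζ‖ ≤ (36 * c ^ 2) * wt ζ := fun ζ s => by
    have h0 := inv_brk_pos (ζ 0)
    have h1 := inv_brk_pos (ζ 1)
    calc ∑ q ∈ s, ‖m q ζ‖ ≤ ∑ q ∈ s, (4 * ((brk (ζ 0))⁻¹ * (brk (ζ 1))⁻¹)) *
            (‖φ (q.1 + 1) (ζ 0)‖ * ‖φ (q.2 + 1) (ζ 1)‖) := by
          refine Finset.sum_le_sum fun q _ => ?_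
          calc ‖m q ζ‖ = (‖invI (ζ 0)‖ * ‖φ (q.1 + 1) (ζ 0)‖) *
                (‖invI (ζ 1)‖ * ‖φ (q.2 + 1) (ζ 1)‖) := by
                simp only [m, norm_mul, norm_div, invI, norm_one]; ring
            _ ≤ (2 * (brk (ζ 0))⁻¹ * ‖φ (q.1 + 1) (ζ 0)‖) *
                (2 * (brk (ζ 1))⁻¹ * ‖φ (q.2 + 1) (ζ 1)‖) := by
                gcongr ?_ * ?_
                · exact norm_invI_mul_le fun h => hφ.succ_eq_zero h _
                · exact norm_invI_mul_le fun h => hφ.succ_eq_zero h _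
            _ = _ := by ring
      _ ≤ (4 * ((brk (ζ 0))⁻¹ * (brk (ζ 1))⁻¹)) * (9 * c ^ 2) := by
          rw [← Finset.mul_sum]
          gcongr
          exact hφ.sum_prod_norm_le hc _ _ s
      _ = 36 * c ^ 2 * ((brk (ζ 0))⁻¹ * (brk (ζ 1))⁻¹) := by ring
      _ ≤ _ := by gcongr; exact inv_brk_mul_inv_brk_le ζ
  refine ⟨⟨_, fun ζ => le_of_tendsto (hM ζ).norm (Eventually.of_forall fun s =>
    (norm_sum_le _ _).trans (hb ζ s))⟩, fun α β => ?_⟩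
  exact hg.hasSum_opInt (m := m) (fun k => Measurable.aestronglyMeasurable
    ((measurable_invProd.mul (Continuous.measurable (by fun_prop))).mul
      (Continuous.measurable (by fun_prop)))) hb hM α β

end Series

/-! ### The restrictions to the antidiagonal that enter A and B. -/

section Antidiagonal

variable {φ : ℕ → 𝓢(ℝ, ℂ)}

lemma chi_antidiag (γ : ℝ) (ζ : Plane) : chi γ (-γ) ζ = ex ((ζ 0 - ζ 1) * γ) := by
  rw [chi]; ring_nf

lemma integrable_inv_brk_mul {g : Plane → Vec n} (hg : WtIntegrable g) {m : Plane → ℂ} {K : ℝ}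
    (hm : AEStronglyMeasurable m) (hb : ∀ ζ, ‖m ζ‖ * (brk (ζ 0 - ζ 1))⁻¹ ≤ K * wt ζ) :
    Integrable (fun ζ : Plane => (brk (ζ 0 - ζ 1))⁻¹ * ‖m ζ • g ζ‖) := by
  refine (hg.integrable.const_mul K).mono' ?_ (ae_of_all _ fun ζ => ?_)
  · exact (Continuous.aestronglyMeasurable (by fun_prop)).mul (hm.smul hg.meas).norm
  · rw [norm_mul, norm_norm, norm_smul, Real.norm_of_nonneg (inv_brk_pos _).le, ← mul_assoc,
      ← mul_assoc]
    exact mul_le_mul_of_nonneg_right ((mul_comm _ _).trans_le (hb ζ)) (norm_nonneg _)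

lemma schwartz_smul_opInt {g : Plane → Vec n} (hg : WtIntegrable g) {m : Plane → ℂ} {K : ℝ}
    (hm : AEStronglyMeasurable m) (hb : ∀ ζ, ‖m ζ‖ ≤ K * wt ζ) (θ : 𝓢(ℝ, ℂ)) :
    Integrable (fun x => θ x • opInt (chi x (-x)) m g) ∧
      ∫ x, θ x • opInt (chi x (-x)) m g = cF • ∫ ζ : Plane, (osc1 θ (ζ 0 - ζ 1) * m ζ) • g ζ := by
  have h := integral_integral_smul_swap (μ := volume) (ν := volume)
    (k := fun x (ζ : Plane) => ex ((ζ 0 - ζ 1) * x) * θ x) (G := fun ζ => m ζ • g ζ)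
    (w := fun x => ‖θ x‖) (v := fun _ => 1) (by unfold Function.uncurry; fun_prop)
    (hm.smul hg.meas) (fun x ζ => by simp) (θ.integrable (μ := volume)).norm
    (by simpa using (hg.integrable_smul hm hb).norm)
  have e : ∀ x, θ x • opInt (chi x (-x)) m g =
      cF • ∫ ζ : Plane, (ex ((ζ 0 - ζ 1) * x) * θ x) • (m ζ • g ζ) := fun x => by
    rw [opInt, smul_comm, ← integral_smul]
    simp only [chi_antidiag, smul_smul]
    congr 2
    funext ζ; congr 1; ring
  simp only [e]
  refine ⟨h.1.fun_smul cF, ?_⟩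
  rw [integral_smul, h.2]
  simp only [smul_smul, osc1]

/-- The total multiplier has decay in one frequency only, so it need not be bounded by `wt`. Pairing
with a Schwartz function θ inserts its transform at τ-ξ, and the extra ⟨τ-ξ⟩⁻¹ brings the multiplier
under `wt`. This gives convergence as a distribution and an explicit continuous primitive. -/
lemma IsDyadicPartition.exists_antidiag (hφ : IsDyadicPartition φ) {g : Plane → Vec n}
    (hg : WtIntegrable g) {a : Plane → ℂ} (ha : Measurable a)
    (h1 : ∀ ζ : Plane, 1 ≤ |ζ 0| → 1 ≤ |ζ 1| → ‖a ζ‖ ≤ 1)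
    (h2 : ∀ ζ : Plane, 1 ≤ |ζ 0| → 1 ≤ |ζ 1| → ‖a ζ‖ * (brk (ζ 0 - ζ 1))⁻¹ ≤ 2 * wt ζ) :
    ∃ T : 𝓢'(ℝ, Vec n), HasDistribSum (fun (q : ℕ × ℕ) γ => opInt (chi γ (-γ))
        (fun ζ => a ζ * φ (q.1 + 1) (ζ 0) * φ (q.2 + 1) (ζ 1)) g) T ∧
      (∃ K, ∀ ζ : Plane, ‖a ζ * high φ (ζ 0) * high φ (ζ 1)‖ * (brk (ζ 0 - ζ 1))⁻¹ ≤ K * wt ζ) ∧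
      IsPrimitive T fun x => cF • ∫ ζ : Plane,
        D (ζ 0 - ζ 1) x • ((a ζ * high φ (ζ 0) * high φ (ζ 1)) • g ζ) := by
  obtain ⟨c, hc0, hc⟩ := hφ.exists_bound
  let m : ℕ × ℕ → Plane → ℂ := fun q ζ => a ζ * φ (q.1 + 1) (ζ 0) * φ (q.2 + 1) (ζ 1)
  let M : Plane → ℂ := fun ζ => a ζ * high φ (ζ 0) * high φ (ζ 1)
  have hmm : ∀ q, AEStronglyMeasurable (m q) := fun q => Measurable.aestronglyMeasurable
    ((ha.mul (Continuous.measurable (by fun_prop))).mul (Continuous.measurable (by fun_prop)))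
  have hMm : AEStronglyMeasurable M := Measurable.aestronglyMeasurable
    ((ha.mul (Continuous.measurable (by fun_prop))).mul (Continuous.measurable (by fun_prop)))
  have hM : ∀ ζ, HasSum (fun q => m q ζ) (M ζ) := fun ζ => by
    simpa only [m, M, mul_assoc] using (hφ.hasSum_prod (ζ 0) (ζ 1)).mul_left (a ζ)
  have hzero : ∀ (q : ℕ × ℕ) (ζ : Plane), (1 ≤ |ζ 0| ∧ 1 ≤ |ζ 1|) ∨
      ‖φ (q.1 + 1) (ζ 0)‖ * ‖φ (q.2 + 1) (ζ 1)‖ = 0 := fun q ζ => by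
    rcases lt_or_ge |ζ 0| 1 with h | h
    · right; rw [hφ.succ_eq_zero h]; simp
    rcases lt_or_ge |ζ 1| 1 with h' | h'
    · right; rw [hφ.succ_eq_zero h']; simp
    · exact Or.inl ⟨h, h'⟩
  -- A single block is bounded by `wt` because its cut-offs are Schwartz; K depends on q and serves
  -- only to exchange the integrals term by term.
  have hmb : ∀ q, ∃ K, ∀ ζ, ‖m q ζ‖ ≤ K * wt ζ := fun q => by
    obtain ⟨C₁, hC₁, hl₁⟩ := exists_norm_schwartz_le (φ (q.1 + 1))
    obtain ⟨C₂, hC₂, hl₂⟩ := exists_norm_schwartz_le (φ (q.2 + 1))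
    refine ⟨C₁ * C₂, fun ζ => ?_⟩
    have hi := inv_brk_pos (ζ 0)
    calc ‖m q ζ‖ = ‖a ζ‖ * (‖φ (q.1 + 1) (ζ 0)‖ * ‖φ (q.2 + 1) (ζ 1)‖) := by
          simp only [m, norm_mul]; ring
      _ ≤ 1 * (‖φ (q.1 + 1) (ζ 0)‖ * ‖φ (q.2 + 1) (ζ 1)‖) := by
          rcases hzero q ζ with h | h
          · gcongr; exact h1 ζ h.1 h.2
          · simp [h]
      _ ≤ 1 * ((C₁ * (brk (ζ 0))⁻¹) * (C₂ * (brk (ζ 1))⁻¹)) := by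
          gcongr
          · exact hl₁ _
          · exact hl₂ _
      _ = C₁ * C₂ * ((brk (ζ 0))⁻¹ * (brk (ζ 1))⁻¹) := by ring
      _ ≤ _ := by gcongr; exact inv_brk_mul_inv_brk_le ζ
  -- The bound uniform over finite sets of blocks holds only after the gain ⟨τ-ξ⟩⁻¹.
  have hsb : ∀ ζ (s : Finset (ℕ × ℕ)),
      ∑ q ∈ s, ‖m q ζ‖ * (brk (ζ 0 - ζ 1))⁻¹ ≤ (18 * c ^ 2) * wt ζ := fun ζ s => by
    have hw := wt_pos ζ
    calc _ ≤ ∑ q ∈ s, (2 * wt ζ) * (‖φ (q.1 + 1) (ζ 0)‖ * ‖φ (q.2 + 1) (ζ 1)‖) := by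
          refine Finset.sum_le_sum fun q _ => ?_
          rw [show ‖m q ζ‖ * (brk (ζ 0 - ζ 1))⁻¹ = ‖a ζ‖ * (brk (ζ 0 - ζ 1))⁻¹ *
            (‖φ (q.1 + 1) (ζ 0)‖ * ‖φ (q.2 + 1) (ζ 1)‖) by simp only [m, norm_mul]; ring]
          rcases hzero q ζ with h | h
          · exact mul_le_mul_of_nonneg_right (h2 ζ h.1 h.2)
              (mul_nonneg (norm_nonneg _) (norm_nonneg _))
          · simp [h]
      _ ≤ (2 * wt ζ) * (9 * c ^ 2) := by
          rw [← Finset.mul_sum]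
          gcongr
          exact hφ.sum_prod_norm_le hc _ _ s
      _ = _ := by ring
  have hMb : ∀ ζ, ‖M ζ‖ * (brk (ζ 0 - ζ 1))⁻¹ ≤ (18 * c ^ 2) * wt ζ := fun ζ =>
    le_of_tendsto ((hM ζ).norm.mul_const _) (Eventually.of_forall fun s => by
      refine le_trans ?_ (hsb ζ s)
      rw [← Finset.sum_mul]
      exact mul_le_mul_of_nonneg_right (norm_sum_le _ _) (inv_brk_pos _).le)
  obtain ⟨T₀, hT₀⟩ := exists_symbol_distribution (hMm.smul hg.meas)
    (integrable_inv_brk_mul hg hMm hMb)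
  have hT : ∀ θ, (cF • T₀) θ = cF • ∫ ζ : Plane, osc1 θ (ζ 0 - ζ 1) • (M ζ • g ζ) := fun θ =>
    congrArg (cF • ·) (hT₀ θ)
  refine ⟨cF • T₀, fun θ => ?_, ⟨_, hMb⟩, isPrimitive_of_symbol hg hMm hMb hT⟩
  refine ⟨fun q => ?_, ?_⟩
  · obtain ⟨K, hK⟩ := hmb q
    exact (schwartz_smul_opInt hg (hmm q) hK θ).1
  · obtain ⟨C, hC, hCθ⟩ := exists_norm_osc1_le 1 θ
    simp only [pow_one] at hCθ
    have := (hg.hasSum_integral (m := fun q ζ => osc1 θ (ζ 0 - ζ 1) * m q ζ)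
      (M := fun ζ => osc1 θ (ζ 0 - ζ 1) * M ζ) (K := C * (18 * c ^ 2))
      (fun q => (Continuous.aestronglyMeasurable (by fun_prop)).mul (hmm q)) (fun ζ s => ?_)
      fun ζ => (hM ζ).mul_left _).const_smul cF
    · rw [hT]
      simp only [← mul_smul] at this ⊢
      convert this using 1
      funext q
      obtain ⟨K, hK⟩ := hmb q
      exact (schwartz_smul_opInt hg (hmm q) hK θ).2
    · calc _ ≤ ∑ q ∈ s, C * (‖m q ζ‖ * (brk (ζ 0 - ζ 1))⁻¹) := by
            refine Finset.sum_le_sum fun q _ => ?_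
            rw [norm_mul]
            calc _ ≤ C * (brk (ζ 0 - ζ 1))⁻¹ * ‖m q ζ‖ :=
                  mul_le_mul_of_nonneg_right (hCθ _) (norm_nonneg _)
              _ = _ := by ring
        _ ≤ C * ((18 * c ^ 2) * wt ζ) := by
            rw [← Finset.mul_sum]
            gcongr
            exact hsb ζ s
        _ = _ := by ring

end Antidiagonal

/-! ### The four terms of the formula -/

section Terms

variable {φ : ℕ → 𝓢(ℝ, ℂ)} {f : 𝓢'(Plane, Vec n)}

lemma intervalIntegral_opInt {g : Plane → Vec n} (hg : WtIntegrable g) {m : Plane → ℂ} {K : ℝ}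
    (hm : AEStronglyMeasurable m) (hb : ∀ ζ, ‖m ζ‖ ≤ K * wt ζ) {k : ℝ → Plane → ℂ} {R a b : ℝ}
    (hk : Continuous (Function.uncurry k)) (hkb : ∀ t ∈ uIcc a b, ∀ ζ, ‖k t ζ‖ ≤ R) :
    ∫ t in a..b, opInt (k t) m g = opInt (fun ζ => ∫ t in a..b, k t ζ) m g := by
  simp only [opInt, mul_smul]
  rw [intervalIntegral.integral_smul, intervalIntegral_integral_smul_swap
    (G := fun ζ => m ζ • g ζ) hk (hm.smul hg.meas) hkb
    ((hg.integrable_smul hm hb).norm.const_mul R)]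

lemma opInt_sub {g : Plane → Vec n} {k₁ k₂ m : Plane → ℂ}
    (h₁ : Integrable fun ζ => (k₁ ζ * m ζ) • g ζ) (h₂ : Integrable fun ζ => (k₂ ζ * m ζ) • g ζ) :
    opInt k₁ m g - opInt k₂ m g = opInt (fun ζ => k₁ ζ - k₂ ζ) m g := by
  simp only [opInt, sub_mul, sub_smul]
  rw [integral_sub h₁ h₂, smul_sub]

lemma WtIntegrable.integrable_opInt {g : Plane → Vec n} (hg : WtIntegrable g) {k m : Plane → ℂ}
    {K R : ℝ} (hm : AEStronglyMeasurable m) (hb : ∀ ζ, ‖m ζ‖ ≤ K * wt ζ) (hk : Continuous k)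
    (hkb : ∀ ζ, ‖k ζ‖ ≤ R) : Integrable fun ζ => (k ζ * m ζ) • g ζ := by
  have hR : 0 ≤ R := (norm_nonneg _).trans (hkb 0)
  refine hg.integrable_smul (K := R * K) (hk.aestronglyMeasurable.mul hm) fun ζ => ?_
  rw [norm_mul, mul_assoc]
  exact mul_le_mul (hkb ζ) (hb ζ) (norm_nonneg _) hR

lemma integral_chi_left (a b β : ℝ) (ζ : Plane) :
    ∫ γ in a..b, chi γ β ζ = ex (ζ 1 * β) * (D (ζ 0) b - D (ζ 0) a) := by
  have : ∀ γ, chi γ β ζ = ex (ζ 1 * β) * ex (ζ 0 * γ) := fun γ => by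
    rw [chi, ← ex_add]; ring_nf
  simp only [this, intervalIntegral.integral_const_mul]
  rw [D, D, intervalIntegral.integral_interval_sub_left] <;>
  exact Continuous.intervalIntegrable (by fun_prop) _ _

lemma integral_chi_right (a b α : ℝ) (ζ : Plane) :
    ∫ γ in a..b, chi α γ ζ = ex (ζ 0 * α) * (D (ζ 1) b - D (ζ 1) a) := by
  have : ∀ γ, chi α γ ζ = ex (ζ 0 * α) * ex (ζ 1 * γ) := fun γ => by
    rw [chi, ← ex_add]; ring_nf
  simp only [this, intervalIntegral.integral_const_mul]
  rw [D, D, intervalIntegral.integral_interval_sub_left] <;>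
  exact Continuous.intervalIntegrable (by fun_prop) _ _

lemma integral_chi_antidiag (a b : ℝ) (ζ : Plane) :
    ∫ γ in a..b, chi γ (-γ) ζ = D (ζ 0 - ζ 1) b - D (ζ 0 - ζ 1) a := by
  simp only [chi_antidiag]
  rw [D, D, intervalIntegral.integral_interval_sub_left] <;>
  exact Continuous.intervalIntegrable (by fun_prop) _ _

lemma integral_chi_antidiag' (a b : ℝ) (ζ : Plane) :
    ∫ γ in a..b, chi (-γ) γ ζ = D (ζ 1 - ζ 0) b - D (ζ 1 - ζ 0) a := by
  have : ∀ γ, chi (-γ) γ ζ = ex ((ζ 1 - ζ 0) * γ) := fun γ => by rw [chi]; ring_nf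
  simp only [this]
  rw [D, D, intervalIntegral.integral_interval_sub_left] <;>
  exact Continuous.intervalIntegrable (by fun_prop) _ _

/-- The kernel `Ek` as a function on the frequency plane. -/
def kerE (α β : ℝ) (ζ : Plane) : ℂ := Ek (ζ 0) (ζ 1) α β

/-- At low frequencies no division is needed: Fubini moves both integrals onto the character, where
they give `Ek`. -/
lemma termH_eq (hg : WtIntegrable (fourierDensity f)) (α β : ℝ) :
    termH φ f α β = opInt (kerE α β) (mulH φ) (fourierDensity f) := by
  obtain ⟨K, hK⟩ := exists_norm_mulH_le φ
  have hm := (continuous_mulH (φ := φ)).aestronglyMeasurable (μ := volume)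
  simp only [termH, block_eq]
  have e1 : ∀ γ, ∫ τ in (-γ)..β, opInt (chi γ τ) (mulH φ) (fourierDensity f) =
      opInt (fun ζ => ex (ζ 0 * γ) * (D (ζ 1) β - D (ζ 1) (-γ))) (mulH φ) (fourierDensity f) :=
    fun γ => by
      rw [intervalIntegral_opInt hg hm hK (R := 1) (by unfold Function.uncurry; fun_prop)
        (fun t _ ζ => (norm_chi _ _ _).le)]
      simp only [integral_chi_right]
  simp only [e1]
  rw [intervalIntegral_opInt hg hm hK (R := |β| + (|α| + |β|))
    (by unfold Function.uncurry; fun_prop)]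
  · congr 1; funext ζ; exact integral_eq_Ek _ _ _ _
  · intro t ht ζ
    rw [norm_mul, norm_ex, one_mul]
    have h1 := norm_D_le (ζ 1) β
    have h2 := norm_D_le (ζ 1) (-t)
    have h3 : |t| ≤ |α| + |β| := by
      rw [mem_uIcc] at ht
      have h := neg_abs_le α
      have h' := neg_abs_le β
      have h4 := le_abs_self α
      have h5 := le_abs_self β
      rw [abs_le]
      rcases ht with ht | ht <;> constructor <;> linarith [abs_nonneg α, abs_nonneg β]
    rw [abs_neg] at h2
    linarith [norm_sub_le (D (ζ 1) β) (D (ζ 1) (-t))]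

lemma opInt_congr {g : Plane → Vec n} {k m k' m' : Plane → ℂ} (h : ∀ ζ, k ζ * m ζ = k' ζ * m' ζ) :
    opInt k m g = opInt k' m' g := by simp only [opInt, h]

lemma sumI_eq (hφ : IsDyadicPartition φ) (hg : WtIntegrable (fourierDensity f)) (α β : ℝ) :
    sumI φ f α β = opInt (chi α β) (mulI φ) (fourierDensity f) :=
  ((hφ.exists_sumI hg).2 α β).tsum_eq

lemma sumJ_eq (hφ : IsDyadicPartition φ) (hg : WtIntegrable (fourierDensity f)) (α β : ℝ) :
    sumJ φ f α β = opInt (chi α β) (mulJ φ) (fourierDensity f) :=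
  ((hφ.exists_sumJ hg).2 α β).tsum_eq

lemma sumG_eq (hφ : IsDyadicPartition φ) (hg : WtIntegrable (fourierDensity f)) (α β : ℝ) :
    sumG φ f α β = opInt (chi α β) (mulG φ) (fourierDensity f) :=
  ((hφ.exists_sumG hg).2 α β).tsum_eq

/-- The two line integrals of characters combine to iξ Ek, and the multiplier contains (iξ)⁻¹. -/
lemma termI_eq (hφ : IsDyadicPartition φ) (hg : WtIntegrable (fourierDensity f)) (α β : ℝ) :
    termI φ f α β = opInt (kerE α β) (fun ζ => φ 0 (ζ 0) * high φ (ζ 1)) (fourierDensity f) := by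
  obtain ⟨K, hK⟩ := (hφ.exists_sumI hg).1
  have hm := measurable_mulI (φ := φ)
  simp only [termI, sumI_eq hφ hg]
  rw [intervalIntegral_opInt hg hm hK (R := 1) (by unfold Function.uncurry; fun_prop)
      (fun t _ ζ => (norm_chi _ _ _).le),
    intervalIntegral_opInt hg hm hK (R := 1) (by unfold Function.uncurry; fun_prop)
      (fun t _ ζ => (norm_chi _ _ _).le)]
  simp only [integral_chi_left, integral_chi_antidiag]
  rw [opInt_sub]
  · refine opInt_congr fun ζ => ?_
    rw [← I_mul_Ek_right, ← I_mul_invI_mul hφ (ζ 1), mulI, kerE]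
    ring
  · refine hg.integrable_opInt (R := |α| + |-β|) hm hK (by fun_prop) fun ζ => ?_
    rw [norm_mul, norm_ex, one_mul]
    exact (norm_sub_le _ _).trans (add_le_add (norm_D_le _ _) (norm_D_le _ _))
  · exact hg.integrable_opInt (R := |α| + |-β|) hm hK (by fun_prop) fun ζ =>
      (norm_sub_le _ _).trans (add_le_add (norm_D_le _ _) (norm_D_le _ _))

lemma termJ_eq (hφ : IsDyadicPartition φ) (hg : WtIntegrable (fourierDensity f)) (α β : ℝ) :
    termJ φ f α β = opInt (kerE α β) (fun ζ => high φ (ζ 0) * φ 0 (ζ 1)) (fourierDensity f) := by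
  obtain ⟨K, hK⟩ := (hφ.exists_sumJ hg).1
  have hm := measurable_mulJ (φ := φ)
  simp only [termJ, sumJ_eq hφ hg]
  rw [intervalIntegral_opInt hg hm hK (R := 1) (by unfold Function.uncurry; fun_prop)
      (fun t _ ζ => (norm_chi _ _ _).le),
    intervalIntegral_opInt hg hm hK (R := 1) (by unfold Function.uncurry; fun_prop)
      (fun t _ ζ => (norm_chi _ _ _).le)]
  simp only [integral_chi_right, integral_chi_antidiag']
  rw [opInt_sub]
  · refine opInt_congr fun ζ => ?_
    rw [← I_mul_Ek_left, ← I_mul_invI_mul hφ (ζ 0), mulJ, kerE]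
    ring
  · refine hg.integrable_opInt (R := |β| + |-α|) hm hK (by fun_prop) fun ζ => ?_
    rw [norm_mul, norm_ex, one_mul]
    exact (norm_sub_le _ _).trans (add_le_add (norm_D_le _ _) (norm_D_le _ _))
  · exact hg.integrable_opInt (R := |β| + |-α|) hm hK (by fun_prop) fun ζ =>
      (norm_sub_le _ _).trans (add_le_add (norm_D_le _ _) (norm_D_le _ _))

lemma exists_antidiagβ (hφ : IsDyadicPartition φ) (hg : WtIntegrable (fourierDensity f)) :
    ∃ T : 𝓢'(ℝ, Vec n), HasDistribSum (antidiagβ φ f) T ∧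
      (∃ K, ∀ ζ : Plane, ‖invI (ζ 1) * high φ (ζ 0) * high φ (ζ 1)‖ * (brk (ζ 0 - ζ 1))⁻¹
        ≤ K * wt ζ) ∧
      IsPrimitive T fun x => cF • ∫ ζ : Plane,
        D (ζ 0 - ζ 1) x • ((invI (ζ 1) * high φ (ζ 0) * high φ (ζ 1)) • fourierDensity f ζ) := by
  refine hφ.exists_antidiag hg (a := fun ζ => invI (ζ 1)) (measurable_invI.comp (by fun_prop))
    (fun ζ _ h => ?_) (fun ζ _ h => ?_) <;> rw [norm_invI]
  · exact inv_le_one_of_one_le₀ h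
  · have := inv_brk_right_mul_le ζ
    have h0 := inv_brk_pos (ζ 0 - ζ 1)
    nlinarith [mul_le_mul_of_nonneg_right (inv_abs_le h) h0.le]

lemma exists_antidiagα (hφ : IsDyadicPartition φ) (hg : WtIntegrable (fourierDensity f)) :
    ∃ T : 𝓢'(ℝ, Vec n), HasDistribSum (antidiagα φ f) T ∧
      (∃ K, ∀ ζ : Plane, ‖invI (ζ 0) * high φ (ζ 0) * high φ (ζ 1)‖ * (brk (ζ 0 - ζ 1))⁻¹
        ≤ K * wt ζ) ∧
      IsPrimitive T fun x => cF • ∫ ζ : Plane,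
        D (ζ 0 - ζ 1) x • ((invI (ζ 0) * high φ (ζ 0) * high φ (ζ 1)) • fourierDensity f ζ) := by
  refine hφ.exists_antidiag hg (a := fun ζ => invI (ζ 0)) (measurable_invI.comp (by fun_prop))
    (fun ζ h _ => ?_) (fun ζ h _ => ?_) <;> rw [norm_invI]
  · exact inv_le_one_of_one_le₀ h
  · have := inv_brk_left_mul_le ζ
    have h0 := inv_brk_pos (ζ 0 - ζ 1)
    nlinarith [mul_le_mul_of_nonneg_right (inv_abs_le h) h0.le]

lemma integrable_D_mul {g : Plane → Vec n} (hg : WtIntegrable g) {m : Plane → ℂ} {K : ℝ}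
    (hm : AEStronglyMeasurable m) (hb : ∀ ζ, ‖m ζ‖ * (brk (ζ 0 - ζ 1))⁻¹ ≤ K * wt ζ) (x : ℝ) :
    Integrable fun ζ : Plane => (D (ζ 0 - ζ 1) x * m ζ) • g ζ := by
  have hx : 0 ≤ |x| + 2 := by positivity
  refine hg.integrable_smul (K := (|x| + 2) * K)
    ((Continuous.aestronglyMeasurable (by fun_prop)).mul hm) fun ζ => ?_
  rw [norm_mul]
  calc _ ≤ (|x| + 2) * (brk (ζ 0 - ζ 1))⁻¹ * ‖m ζ‖ :=
        mul_le_mul_of_nonneg_right (norm_D_le_brk _ _) (norm_nonneg _)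
    _ = (|x| + 2) * (‖m ζ‖ * (brk (ζ 0 - ζ 1))⁻¹) := by ring
    _ ≤ (|x| + 2) * (K * wt ζ) := mul_le_mul_of_nonneg_left (hb ζ) hx
    _ = _ := by ring

/-- `I_mul_I_mul_Ek` multiplied by u v, with u and v the high-frequency parts divided by iτ and iξ:
a factor iτ or iξ cancels one of the two divisions, which yields the multipliers of B and A
respectively. -/
lemma mulG_relation (hφ : IsDyadicPartition φ) (α β : ℝ) (ζ : Plane) :
    kerE α β ζ * (high φ (ζ 0) * high φ (ζ 1)) =
      chi α β ζ * mulG φ ζ - 1 / 2 * (chi α (-α) ζ * mulG φ ζ)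
      - 1 / 2 * (chi (-β) β ζ * mulG φ ζ)
      - 1 / 2 * ((D (ζ 0 - ζ 1) α - D (ζ 0 - ζ 1) (-β)) *
        (invI (ζ 1) * high φ (ζ 0) * high φ (ζ 1)))
      - 1 / 2 * ((D (ζ 0 - ζ 1) α - D (ζ 0 - ζ 1) (-β)) *
        (invI (ζ 0) * high φ (ζ 0) * high φ (ζ 1))) := by
  have h0 := I_mul_invI_mul hφ (ζ 0)
  have h1 := I_mul_invI_mul hφ (ζ 1)
  have hE := I_mul_I_mul_Ek (ζ 0) (ζ 1) α β
  have hG : mulG φ ζ = (invI (ζ 0) * high φ (ζ 0)) * (invI (ζ 1) * high φ (ζ 1)) := by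
    rw [mulG, invI, invI, ← one_div_mul_one_div]; ring
  have c1 : ∀ a b, chi a b ζ = ex (ζ 0 * a + ζ 1 * b) := fun a b => by rw [chi]; ring_nf
  rw [hG, c1, c1, c1, kerE]
  set u := invI (ζ 0) * high φ (ζ 0)
  set v := invI (ζ 1) * high φ (ζ 1)
  have e1 : invI (ζ 1) * high φ (ζ 0) * high φ (ζ 1) = Complex.I * ζ 0 * u * v := by
    rw [h0]; simp only [v]; ring
  have e2 : invI (ζ 0) * high φ (ζ 0) * high φ (ζ 1) = Complex.I * ζ 1 * u * v := by
    rw [show Complex.I * ζ 1 * u * v = u * (Complex.I * ζ 1 * v) by ring, h1]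
  rw [e1, e2, ← h0, ← h1]
  linear_combination u * v * hE

lemma termG_eq (hφ : IsDyadicPartition φ) (hg : WtIntegrable (fourierDensity f)) (α β : ℝ) :
    termG φ f α β = opInt (kerE α β) (fun ζ => high φ (ζ 0) * high φ (ζ 1))
      (fourierDensity f) := by
  obtain ⟨K, hK⟩ := (hφ.exists_sumG hg).1
  obtain ⟨Tβ, hTβ, ⟨Kβ, hKβ⟩, hPβ⟩ := exists_antidiagβ hφ hg
  obtain ⟨Tα, hTα, ⟨Kα, hKα⟩, hPα⟩ := exists_antidiagα hφ hg
  have hm := measurable_mulG (φ := φ)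
  have hmβ : AEStronglyMeasurable
      (fun ζ : Plane => invI (ζ 1) * high φ (ζ 0) * high φ (ζ 1)) volume :=
    Measurable.aestronglyMeasurable (((measurable_invI.comp (by fun_prop)).mul
      (Continuous.measurable (by fun_prop))).mul (Continuous.measurable (by fun_prop)))
  have hmα : AEStronglyMeasurable
      (fun ζ : Plane => invI (ζ 0) * high φ (ζ 0) * high φ (ζ 1)) volume :=
    Measurable.aestronglyMeasurable (((measurable_invI.comp (by fun_prop)).mul
      (Continuous.measurable (by fun_prop))).mul (Continuous.measurable (by fun_prop)))
  have ic : ∀ a b, Integrable fun ζ => (chi a b ζ * mulG φ ζ) • fourierDensity f ζ := fun a b =>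
    hg.integrable_opInt (R := 1) hm hK (by fun_prop) fun ζ => (norm_chi _ _ _).le
  have iβ := fun x => integrable_D_mul hg hmβ hKβ x
  have iα := fun x => integrable_D_mul hg hmα hKα x
  rw [termG, distribSum_eq hTβ, distribSum_eq hTα, distribIntegral_eq hPβ,
    distribIntegral_eq hPα, sumG_eq hφ hg, sumG_eq hφ hg, sumG_eq hφ hg]
  simp only [smul_smul (D _ _)]
  simp only [opInt, mulG_relation hφ, sub_smul, mul_smul (1 / 2 : ℂ), sub_mul]
  have jβ := (iβ α).sub (iβ (-β))
  have jα := (iα α).sub (iα (-β))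
  rw [integral_sub, integral_sub, integral_sub, integral_sub]
  · simp only [integral_smul]
    rw [integral_sub (iβ α) (iβ (-β)), integral_sub (iα α) (iα (-β))]
    simp only [smul_sub, smul_comm cF (1 / 2 : ℂ)]
  · exact ic _ _
  · exact (ic _ _).fun_smul _
  · exact (ic _ _).sub ((ic _ _).fun_smul _)
  · exact (ic _ _).fun_smul _
  · exact ((ic _ _).sub ((ic _ _).fun_smul _)).sub ((ic _ _).fun_smul _)
  · exact jβ.fun_smul (1 / 2 : ℂ)
  · exact (((ic _ _).sub ((ic _ _).fun_smul _)).sub ((ic _ _).fun_smul _)).sub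
      (jβ.fun_smul (1 / 2 : ℂ))
  · exact jα.fun_smul (1 / 2 : ℂ)

/-- The solution of the wave equation with a right-hand side of Fourier density `g`. -/
def rep (g : Plane → Vec n) (α β : ℝ) : Vec n := cF • ∫ ζ : Plane, Ek (ζ 0) (ζ 1) α β • g ζ

/-- Since φ₀ + high = 1 in each variable, the four frequency regions recombine to the full kernel.
-/
lemma pathwiseIntegral_eq (hφ : IsDyadicPartition φ) (hg : WtIntegrable (fourierDensity f))
    (α β : ℝ) : pathwiseIntegral φ f α β = rep (fourierDensity f) α β := by
  have hE : ∀ ζ, ‖kerE α β ζ‖ ≤ 5 * ((|α| + 2) ^ 2 * (|β| + 2) ^ 2) * wt ζ := fun ζ =>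
    norm_Ek_le ζ α β
  obtain ⟨c, hc0, hc⟩ := hφ.exists_bound
  have key : ∀ u v : ℝ → ℂ, Continuous u → Continuous v → (∀ x, ‖u x‖ ≤ 3 * c) →
      (∀ x, ‖v x‖ ≤ 3 * c) →
      Integrable fun ζ : Plane => (kerE α β ζ * (u (ζ 0) * v (ζ 1))) • fourierDensity f ζ :=
    fun u v hu hv hub hvb => by
      refine hg.integrable_smul
        (K := 5 * ((|α| + 2) ^ 2 * (|β| + 2) ^ 2) * (3 * c * (3 * c))) ?_ fun ζ => ?_
      · refine Continuous.aestronglyMeasurable ?_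
        unfold kerE; fun_prop
      · rw [norm_mul, norm_mul, mul_right_comm]
        exact mul_le_mul (hE ζ) (mul_le_mul (hub _) (hvb _) (norm_nonneg _) (by positivity))
          (by positivity) (by have := wt_pos ζ; positivity)
  have hl : ∀ x, ‖φ 0 x‖ ≤ 3 * c := fun x => (hc 0 x).trans (by linarith)
  have hh := hφ.norm_high_le hc
  have cl : Continuous fun x => φ 0 x := (φ 0).continuous
  have ch : Continuous fun x => high φ x := by fun_prop
  rw [pathwiseIntegral, termH_eq hg, termI_eq hφ hg, termJ_eq hφ hg, termG_eq hφ hg]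
  simp only [opInt, rep, mulH]
  have i1 := key _ _ cl cl hl hl
  have i2 := key _ _ cl ch hl hh
  have i3 := key _ _ ch cl hh hl
  have i4 := key _ _ ch ch hh hh
  have e : ∀ ζ : Plane, Ek (ζ 0) (ζ 1) α β • fourierDensity f ζ =
      (kerE α β ζ * (φ 0 (ζ 0) * φ 0 (ζ 1))) • fourierDensity f ζ +
      (kerE α β ζ * (φ 0 (ζ 0) * high φ (ζ 1))) • fourierDensity f ζ +
      (kerE α β ζ * (high φ (ζ 0) * φ 0 (ζ 1))) • fourierDensity f ζ +
      (kerE α β ζ * (high φ (ζ 0) * high φ (ζ 1))) • fourierDensity f ζ := fun ζ => by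
    simp only [← add_smul, kerE, high]
    congr 1; ring
  simp only [e]
  rw [integral_add, integral_add, integral_add i1 i2]
  rotate_left
  · exact i1.add i2
  · exact i3
  · exact (i1.add i2).add i3
  · exact i4
  simp only [smul_add]

lemma formulaWellDefined (hφ : IsDyadicPartition φ) (hg : WtIntegrable (fourierDensity f)) :
    FormulaWellDefined φ f where
  continuous_low := by
    obtain ⟨K, hK⟩ := exists_norm_mulH_le φ
    simp only [block_eq]
    exact hg.continuous_opInt continuous_mulH.aestronglyMeasurable hK
  summable_I α β := ((hφ.exists_sumI hg).2 α β).summable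
  continuous_I := by
    obtain ⟨K, hK⟩ := (hφ.exists_sumI hg).1
    simp only [sumI_eq hφ hg]
    exact hg.continuous_opInt measurable_mulI hK
  summable_J α β := ((hφ.exists_sumJ hg).2 α β).summable
  continuous_J := by
    obtain ⟨K, hK⟩ := (hφ.exists_sumJ hg).1
    simp only [sumJ_eq hφ hg]
    exact hg.continuous_opInt measurable_mulJ hK
  summable_G α β := ((hφ.exists_sumG hg).2 α β).summable
  continuous_G := by
    obtain ⟨K, hK⟩ := (hφ.exists_sumG hg).1
    simp only [sumG_eq hφ hg]
    exact hg.continuous_opInt measurable_mulG hK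
  trace_β := by
    obtain ⟨T, h, -, hP⟩ := exists_antidiagβ hφ hg
    exact ⟨T, h, _, hP⟩
  trace_α := by
    obtain ⟨T, h, -, hP⟩ := exists_antidiagα hφ hg
    exact ⟨T, h, _, hP⟩

end Terms

/-! ### Pointwise properties of the solution -/

lemma WtIntegrable.continuous_rep {g : Plane → Vec n} (hg : WtIntegrable g) :
    Continuous fun p : ℝ × ℝ => rep g p.1 p.2 := by
  refine (hg.continuous_integral (k := fun (p : ℝ × ℝ) ζ => Ek (ζ 0) (ζ 1) p.1 p.2)
    (M := fun p => 5 * ((|p.1| + 2) ^ 2 * (|p.2| + 2) ^ 2)) (by fun_prop)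
    (fun p => Continuous.aestronglyMeasurable (by fun_prop)) (fun ζ => by fun_prop)
    fun p ζ => norm_Ek_le ζ p.1 p.2).const_smul cF

lemma rep_antidiag (g : Plane → Vec n) (α : ℝ) : rep g α (-α) = 0 := by
  simp [rep, Ek_antidiag]

lemma norm_rep_le {g : Plane → Vec n} (hg : WtIntegrable g) (α β : ℝ) :
    ‖rep g α β‖ ≤ ‖cF‖ * (5 * ((|α| + 2) ^ 2 * (|β| + 2) ^ 2) * ∫ ζ, wt ζ * ‖g ζ‖) := by
  rw [rep, norm_smul]
  gcongr
  refine (norm_integral_le_integral_norm _).trans ?_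
  rw [← integral_const_mul]
  refine integral_mono_of_nonneg (ae_of_all _ fun ζ => norm_nonneg _) (hg.integrable.const_mul _)
    (ae_of_all _ fun ζ => ?_)
  simp only [norm_smul]
  rw [← mul_assoc]
  exact mul_le_mul_of_nonneg_right (norm_Ek_le ζ α β) (norm_nonneg _)

/-- The substitution ζ ↦ -ζ conjugates both the kernel and the density, so the integral equals its
own conjugate. -/
lemma rep_im_eq_zero {g : Plane → Vec n} (hg : WtIntegrable g)
    (hc : ∀ᵐ ζ, g ζ = conjV (g (-ζ))) (α β : ℝ)
    (i : Fin n) : (rep g α β i).im = 0 := by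
  have hi : Integrable fun ζ : Plane => Ek (ζ 0) (ζ 1) α β • g ζ :=
    hg.integrable_smul (Continuous.aestronglyMeasurable (by fun_prop))
      fun ζ => norm_Ek_le ζ α β
  have h1 : conjV (∫ ζ : Plane, Ek (ζ 0) (ζ 1) α β • g ζ) =
      ∫ ζ : Plane, Ek (ζ 0) (ζ 1) α β • g ζ := by
    rw [← conjV.integral_comp_comm hi,
      ← integral_neg_eq_self (fun ζ : Plane => conjV (Ek (ζ 0) (ζ 1) α β • g ζ)) volume]
    refine integral_congr_ae ?_
    filter_upwards [hc] with ζ hζ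
    rw [conjV_smul, conj_Ek, hζ]
    simp
  have h2 : conjV (rep g α β) = rep g α β := by
    rw [rep, conjV_smul, h1]
    congr 1
    rw [cF, map_inv₀, Complex.conj_ofReal]
  have := congrArg (fun v : Vec n => v i) h2
  rw [conjV_apply] at this
  exact Complex.conj_eq_iff_im.1 this

/-! ### Distributions given by functions of polynomial growth -/

lemma abs_apply_le_norm (p : Plane) (i : Fin 2) : |p i| ≤ ‖p‖ := by
  simpa using PiLp.norm_apply_le p i

lemma growth_le (p : Plane) :
    5 * ((|p 0| + 2) ^ 2 * (|p 1| + 2) ^ 2) ≤ 80 * (1 + ‖p‖) ^ 4 := by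
  have h0 := abs_apply_le_norm p 0
  have h1 := abs_apply_le_norm p 1
  have hp := norm_nonneg p
  calc 5 * ((|p 0| + 2) ^ 2 * (|p 1| + 2) ^ 2)
      ≤ 5 * ((2 * (1 + ‖p‖)) ^ 2 * (2 * (1 + ‖p‖)) ^ 2) := by gcongr <;> linarith
    _ = _ := by ring

lemma integrable_decay : Integrable fun p : Plane => (1 + ‖p‖) ^ (-3 : ℝ) :=
  integrable_one_add_norm (by rw [finrank_euclideanSpace, Fintype.card_fin]; norm_num)

/-- Seven powers of decay: four absorb the growth of the solution, and three make the remainder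
integrable on the plane. -/
lemma growth_mul_schwartz_le (θ : 𝓢(Plane, ℂ)) (p : Plane) : (1 + ‖p‖) ^ 4 * ‖θ p‖ ≤
    2 ^ 7 * ((Finset.Iic (7, 0)).sup (schwartzSeminormFamily ℂ Plane ℂ)) θ *
      (1 + ‖p‖) ^ (-3 : ℝ) := by
  have h := SchwartzMap.one_add_le_sup_seminorm_apply (𝕜 := ℂ) (m := (7, 0)) (k := 7) (n := 0)
    le_rfl le_rfl θ p
  rw [norm_iteratedFDeriv_zero] at h
  have hp : 0 < 1 + ‖p‖ := by positivity
  rw [Real.rpow_neg hp.le, le_mul_inv_iff₀ (by positivity),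
    show (3 : ℝ) = (3 : ℕ) by norm_num, Real.rpow_natCast]
  calc _ = (1 + ‖p‖) ^ 7 * ‖θ p‖ := by ring
    _ ≤ _ := h

lemma integrable_growth_mul (θ : 𝓢(Plane, ℂ)) :
    Integrable fun p : Plane => 5 * ((|p 0| + 2) ^ 2 * (|p 1| + 2) ^ 2) * ‖θ p‖ := by
  refine ((integrable_decay.const_mul (2 ^ 7 * ((Finset.Iic (7, 0)).sup
    (schwartzSeminormFamily ℂ Plane ℂ)) θ)).const_mul 80).mono'
    (Continuous.aestronglyMeasurable (by have := θ.continuous; fun_prop)) (ae_of_all _ fun p => ?_)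
  rw [Real.norm_of_nonneg (by positivity)]
  calc _ ≤ 80 * (1 + ‖p‖) ^ 4 * ‖θ p‖ :=
        mul_le_mul_of_nonneg_right (growth_le p) (norm_nonneg _)
    _ = 80 * ((1 + ‖p‖) ^ 4 * ‖θ p‖) := by ring
    _ ≤ _ := mul_le_mul_of_nonneg_left (growth_mul_schwartz_le θ p) (by norm_num)

lemma exists_distribution {F : Plane → Vec n} (hF : Continuous F) {C : ℝ}
    (hC : ∀ p, ‖F p‖ ≤ C * (1 + ‖p‖) ^ 4) : ∃ U : 𝓢'(Plane, Vec n), ∀ θ : 𝓢(Plane, ℂ),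
      Integrable (fun p => θ p • F p) ∧ U θ = ∫ p, θ p • F p := by
  have hC0 : 0 ≤ C := by simpa using (norm_nonneg _).trans (hC 0)
  have hb : ∀ (θ : 𝓢(Plane, ℂ)) p, ‖θ p • F p‖ ≤ C * (2 ^ 7 * ((Finset.Iic (7, 0)).sup
      (schwartzSeminormFamily ℂ Plane ℂ)) θ * (1 + ‖p‖) ^ (-3 : ℝ)) := fun θ p => by
    rw [norm_smul]
    calc _ ≤ ‖θ p‖ * (C * (1 + ‖p‖) ^ 4) := mul_le_mul_of_nonneg_left (hC p) (norm_nonneg _)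
      _ = C * ((1 + ‖p‖) ^ 4 * ‖θ p‖) := by ring
      _ ≤ _ := mul_le_mul_of_nonneg_left (growth_mul_schwartz_le θ p) hC0
  have hI : ∀ θ : 𝓢(Plane, ℂ), Integrable (fun p => θ p • F p) := fun θ =>
    ((integrable_decay.const_mul _).const_mul C).mono'
      (θ.continuous.smul hF).aestronglyMeasurable (ae_of_all _ (hb θ))
  let L : 𝓢(Plane, ℂ) →L[ℂ] Vec n := SchwartzMap.mkCLMtoNormedSpace (σ := RingHom.id ℂ)
    (fun θ => ∫ p : Plane, θ p • F p)
    (fun θ₁ θ₂ => by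
      rw [← integral_add (hI θ₁) (hI θ₂)]
      simp only [add_apply, add_smul])
    (fun a θ => by
      simp only [smul_apply, smul_assoc, integral_smul, RingHom.id_apply])
    ⟨Finset.Iic (7, 0), C * (2 ^ 7 * ∫ p : Plane, (1 + ‖p‖) ^ (-3 : ℝ)),
      mul_nonneg hC0 (mul_nonneg (by positivity) (integral_nonneg fun p => by positivity)),
      fun θ => by
      refine (norm_integral_le_integral_norm _).trans ?_
      refine (integral_mono (hI θ).norm ((integrable_decay.const_mul _).const_mul C) (hb θ)).trans
        (le_of_eq ?_)
      rw [integral_const_mul, integral_const_mul]; ring⟩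
  exact ⟨ContinuousLinearMap.toPointwiseConvergenceCLM _ _ _ _ L, fun θ => ⟨hI θ, rfl⟩⟩

/-! ### The distribution solution -/

/-- The pairing of a test function with the solution for a character. -/
def pairE (θ : Plane → ℂ) (ζ : Plane) : ℂ := ∫ p : Plane, θ p * Ek (ζ 0) (ζ 1) (p 0) (p 1)

lemma WtIntegrable.exists_solution {g : Plane → Vec n} (hg : WtIntegrable g) :
    ∃ U : 𝓢'(Plane, Vec n), IsGivenBy U (rep g) ∧
      ∀ θ : 𝓢(Plane, ℂ), U θ = cF • ∫ ζ, pairE θ ζ • g ζ := by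
  obtain ⟨U, hU⟩ := exists_distribution (F := fun p : Plane => rep g (p 0) (p 1))
    (hg.continuous_rep.comp (f := fun p : Plane => (p 0, p 1)) (by fun_prop))
    (C := ‖cF‖ * (80 * ∫ ζ, wt ζ * ‖g ζ‖)) (fun p => by
      have hI : 0 ≤ ∫ ζ, wt ζ * ‖g ζ‖ :=
        integral_nonneg fun ζ => mul_nonneg (wt_pos ζ).le (norm_nonneg _)
      calc _ ≤ _ := norm_rep_le hg _ _
        _ ≤ ‖cF‖ * (80 * (1 + ‖p‖) ^ 4 * ∫ ζ, wt ζ * ‖g ζ‖) := by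
            exact mul_le_mul_of_nonneg_left (mul_le_mul_of_nonneg_right (growth_le p) hI)
              (norm_nonneg _)
        _ = _ := by ring)
  refine ⟨U, hU, fun θ => ?_⟩
  rw [(hU θ).2]
  have h := (integral_integral_smul_swap (μ := volume) (ν := volume)
    (k := fun (p ζ : Plane) => θ p * Ek (ζ 0) (ζ 1) (p 0) (p 1)) (G := g)
    (w := fun p : Plane => 5 * ((|p 0| + 2) ^ 2 * (|p 1| + 2) ^ 2) * ‖θ p‖) (v := wt)
    (by have := θ.continuous; unfold Function.uncurry; fun_prop) hg.meas (fun p ζ => ?_)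
    (integrable_growth_mul θ) hg.integrable).2
  · simp only [pairE, ← h, rep, mul_smul, integral_smul]
    rw [← integral_smul]
    simp only [smul_comm cF]
  · rw [norm_mul]
    calc _ ≤ ‖θ p‖ * (5 * ((|p 0| + 2) ^ 2 * (|p 1| + 2) ^ 2) * wt ζ) :=
          mul_le_mul_of_nonneg_left (norm_Ek_le ζ _ _) (norm_nonneg _)
      _ = _ := by ring

lemma integrable_schwartz_mul {h : Plane → ℂ} (hh : Continuous h) {C : ℝ}
    (hC : ∀ p, ‖h p‖ ≤ C * (5 * ((|p 0| + 2) ^ 2 * (|p 1| + 2) ^ 2))) (θ : 𝓢(Plane, ℂ)) :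
    Integrable fun p => θ p * h p := by
  refine ((integrable_growth_mul θ).const_mul C).mono'
    (Continuous.aestronglyMeasurable (by fun_prop)) (ae_of_all _ fun p => ?_)
  rw [norm_mul]
  calc _ ≤ ‖θ p‖ * (C * (5 * ((|p 0| + 2) ^ 2 * (|p 1| + 2) ^ 2))) :=
        mul_le_mul_of_nonneg_left (hC p) (norm_nonneg _)
    _ = _ := by ring

lemma integral_lineDeriv_mul {h h' : Plane → ℂ} (hh : Continuous h) (hh' : Continuous h')
    {C C' : ℝ} (hC : ∀ p, ‖h p‖ ≤ C * (5 * ((|p 0| + 2) ^ 2 * (|p 1| + 2) ^ 2)))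
    (hC' : ∀ p, ‖h' p‖ ≤ C' * (5 * ((|p 0| + 2) ^ 2 * (|p 1| + 2) ^ 2))) {v : Plane}
    (hd : ∀ p, HasLineDerivAt ℝ h (h' p) p v) (θ : 𝓢(Plane, ℂ)) :
    ∫ p, (∂_{v} θ : 𝓢(Plane, ℂ)) p * h p = -∫ p, θ p * h' p := by
  have := integral_bilinear_hasLineDerivAt_right_eq_neg_left_of_integrable
    (μ := (volume : Measure Plane)) (f := θ) (f' := (∂_{v} θ : 𝓢(Plane, ℂ))) (g := h) (g' := h') (v := v)
    (B := ContinuousLinearMap.mul ℝ ℂ) (integrable_schwartz_mul hh hC (∂_{v} θ))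
    (integrable_schwartz_mul hh' hC' θ) (integrable_schwartz_mul hh hC θ)
    (fun p _ => by
      rw [SchwartzMap.lineDerivOp_apply]
      exact θ.differentiableAt.lineDifferentiableAt.hasLineDerivAt) (fun p _ => hd p)
  simp only [ContinuousLinearMap.mul_apply'] at this
  rw [this, neg_neg]

lemma one_le_growth (p : Plane) : 1 ≤ 5 * ((|p 0| + 2) ^ 2 * (|p 1| + 2) ^ 2) := by
  have h0 := abs_nonneg (p 0)
  have h1 := abs_nonneg (p 1)
  have : 1 ≤ (|p 0| + 2) ^ 2 := one_le_pow₀ (by linarith)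
  have : 1 ≤ (|p 1| + 2) ^ 2 := one_le_pow₀ (by linarith)
  nlinarith

lemma abs_add_abs_le_growth (p : Plane) :
    |p 0| + |p 1| ≤ 5 * ((|p 0| + 2) ^ 2 * (|p 1| + 2) ^ 2) := by
  have h0 := abs_nonneg (p 0)
  have h1 := abs_nonneg (p 1)
  have : 1 + |p 0| ≤ (|p 0| + 2) ^ 2 := by nlinarith
  have : 1 + |p 1| ≤ (|p 1| + 2) ^ 2 := by nlinarith
  nlinarith [mul_nonneg h0 h1]

/-- The weak form of ∂_α∂_β Ek = e^{i(τα+ξβ)}, by one integration by parts in β and one in α. -/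
lemma pairE_lineDeriv (θ : 𝓢(Plane, ℂ)) (ζ : Plane) : 
    pairE (∂_{eβ} (∂_{eα} θ) : 𝓢(Plane, ℂ)) ζ = osc θ ζ := by
  have eα0 : ∀ t : ℝ, t * eα 0 = t ∧ t * eα 1 = 0 := fun t => by simp [eα]
  have eβ0 : ∀ t : ℝ, t * eβ 0 = 0 ∧ t * eβ 1 = t := fun t => by simp [eβ]
  rw [pairE, integral_lineDeriv_mul (h := fun p : Plane => Ek (ζ 0) (ζ 1) (p 0) (p 1))
    (h' := fun p : Plane => ex (ζ 1 * p 1) * (D (ζ 0) (p 0) - D (ζ 0) (-p 1)))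
    (C := wt ζ) (C' := 1) (by fun_prop) (by fun_prop) (fun p => ?_) (fun p => ?_) (fun p => ?_),
    integral_lineDeriv_mul (h' := fun p : Plane => ex (p 0 * ζ 0 + p 1 * ζ 1))
      (C := 1) (C' := 1) (by fun_prop) (by fun_prop) (fun p => ?_) (fun p => ?_) (fun p => ?_),
    neg_neg, osc]
  · simp only [mul_comm]
  · rw [norm_mul, norm_ex, one_mul, one_mul]
    refine (norm_sub_le _ _).trans (le_trans (add_le_add (norm_D_le _ _) (norm_D_le _ _)) ?_)
    rw [abs_neg]; exact abs_add_abs_le_growth p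
  · rw [norm_ex, one_mul]; exact one_le_growth p
  · unfold HasLineDerivAt
    simp only [PiLp.add_apply, PiLp.smul_apply, smul_eq_mul, eα0, add_zero]
    have := ((hasDerivAt_D (ζ 0) (p 0 + 0)).comp_const_add (p 0) 0).sub_const (D (ζ 0) (-p 1))
    refine (this.const_mul (ex (ζ 1 * p 1))).congr_deriv ?_
    rw [← ex_add]; ring_nf
  · rw [mul_comm]; exact norm_Ek_le ζ _ _
  · rw [norm_mul, norm_ex, one_mul, one_mul]
    refine (norm_sub_le _ _).trans (le_trans (add_le_add (norm_D_le _ _) (norm_D_le _ _)) ?_)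
    rw [abs_neg]; exact abs_add_abs_le_growth p
  · unfold HasLineDerivAt
    simp only [PiLp.add_apply, PiLp.smul_apply, smul_eq_mul, eβ0, add_zero]
    have := (hasDerivAt_Ek_right (ζ 0) (ζ 1) (p 0) (p 1 + 0)).comp_const_add (p 1) 0
    simpa using this

/-! ### The coordinates `t`, `x` -/

/-- The map `(t, x) ↦ (t + x, t - x)`. -/
def rotL : Plane →ₗ[ℝ] Plane where
  toFun p := !₂[p 0 + p 1, p 0 - p 1]
  map_add' p q := by ext i; fin_cases i <;> simp <;> ring
  map_smul' r p := by ext i; fin_cases i <;> simp <;> ring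

lemma rotL_rotL (p : Plane) : rotL (rotL p) = (2 : ℝ) • p := by
  ext i; fin_cases i <;> simp [rotL] <;> ring

/-- The square of the map is twice the identity in dimension two, so the determinant squares to 4.
-/
lemma abs_det_rotL : |LinearMap.det rotL| = 2 := by
  have h : LinearMap.det (rotL * rotL) = 4 := by
    rw [show rotL * rotL = (2 : ℝ) • LinearMap.id from LinearMap.ext rotL_rotL, LinearMap.det_smul,
      LinearMap.det_id, finrank_euclideanSpace, Fintype.card_fin]
    norm_num
  rw [map_mul] at h
  have h2 : |LinearMap.det rotL| * |LinearMap.det rotL| = 2 * 2 := by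
    rw [← abs_mul, h]; norm_num
  nlinarith [abs_nonneg (LinearMap.det rotL)]

lemma measurableEmbedding_rotL : MeasurableEmbedding rotL := by
  have hc : Continuous rotL := rotL.continuous_of_finiteDimensional
  refine hc.measurableEmbedding fun p q h => ?_
  have := congrArg rotL h
  rw [rotL_rotL, rotL_rotL] at this
  exact smul_right_injective Plane two_ne_zero this

lemma integral_rot {V : Type*} [NormedAddCommGroup V] [NormedSpace ℝ V] (h : Plane → V) :
    ∫ p : Plane, h p = (2 : ℝ) • ∫ q : ℝ × ℝ, h !₂[q.1 + q.2, q.1 - q.2] := by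
  have hd : LinearMap.det rotL ≠ 0 := fun h0 => by
    have := abs_det_rotL
    rw [h0] at this; norm_num at this
  have h1 := measurableEmbedding_rotL.integral_map (μ := volume) h
  rw [Measure.map_linearMap_addHaar_eq_smul_addHaar volume hd, abs_inv, abs_det_rotL,
    integral_smul_measure] at h1
  rw [integral_plane (fun p => h (rotL p))] at h1
  have h2 : ∀ q : ℝ × ℝ, rotL !₂[q.1, q.2] = !₂[q.1 + q.2, q.1 - q.2] := fun q => by
    simp [rotL]
  simp only [h2] at h1
  rw [← h1, smul_smul]
  norm_num

/-! ### Traces -/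

/-- The translation law separates t from x: on the slice at time t the kernel is `Ek` at (t, t)
times e^{i(τ-ξ)x}. -/
lemma pairE_rot {Θ : Plane → ℂ} {ψ φ : ℝ → ℂ} (hΘ : ∀ t x : ℝ, Θ !₂[t + x, t - x] = ψ t * φ x)
    (ζ : Plane) :
    pairE Θ ζ = 2 * ((∫ t, ψ t * Ek (ζ 0) (ζ 1) t t) * osc1 φ (ζ 0 - ζ 1)) := by
  rw [pairE, integral_rot]
  have e : ∀ q : ℝ × ℝ, Θ !₂[q.1 + q.2, q.1 - q.2] * Ek (ζ 0) (ζ 1) (q.1 + q.2) (q.1 - q.2) =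
      (ψ q.1 * Ek (ζ 0) (ζ 1) q.1 q.1) * (ex ((ζ 0 - ζ 1) * q.2) * φ q.2) := fun q => by
    rw [hΘ, Ek_translate]; ring
  simp only [Matrix.cons_val_zero, Matrix.cons_val_one, e]
  rw [Measure.volume_eq_prod,
    integral_prod_mul (fun t => ψ t * Ek (ζ 0) (ζ 1) t t) (fun x => ex ((ζ 0 - ζ 1) * x) * φ x)]
  simp [osc1]

/-- The slice at time t is the distribution with symbol M t in the frequency τ-ξ. A test function of
x contributes decay in τ-ξ, so M needs a bound by `wt` only after a factor ⟨τ-ξ⟩⁻¹. Dominated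
convergence gives weak continuity in t. Both traces are instances, with M the kernel at (t, t) and
with M its time derivative. -/
lemma hasAntidiagonalTrace_zero {g : Plane → Vec n} (hg : WtIntegrable g)
    {u : 𝓢'(Plane, Vec n)} {M : ℝ → Plane → ℂ} {R : ℝ → ℝ} (hR : Continuous R)
    (hM : Continuous (Function.uncurry M))
    (hb : ∀ t ζ, ‖M t ζ‖ * (brk (ζ 0 - ζ 1))⁻¹ ≤ R t * wt ζ) (h0 : ∀ ζ, M 0 ζ = 0)
    (hu : ∀ (Θ : 𝓢(Plane, ℂ)) (ψ φ : 𝓢(ℝ, ℂ)), HasCompactSupport ψ →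
      (∀ t x : ℝ, Θ !₂[t + x, t - x] = ψ t * φ x) → u Θ = cF • ∫ ζ : Plane,
        (2 * ((∫ t, ψ t * M t ζ) * osc1 φ (ζ 0 - ζ 1))) • g ζ) :
    HasAntidiagonalTrace u 0 := by
  have hMt : ∀ t, Continuous (M t) := fun t => hM.comp (by fun_prop : Continuous fun ζ => (t, ζ))
  have hex : ∀ t, ∃ T : 𝓢'(ℝ, Vec n), ∀ θ, T θ =
      ∫ ζ : Plane, osc1 θ (ζ 0 - ζ 1) • (M t ζ • g ζ) := fun t =>
    exists_symbol_distribution ((hMt t).aestronglyMeasurable.smul hg.meas)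
      (integrable_inv_brk_mul hg (hMt t).aestronglyMeasurable (hb t))
  choose T hT using hex
  have hbound : ∀ φ : 𝓢(ℝ, ℂ), ∃ C : ℝ, 0 ≤ C ∧ ∀ t ζ,
      ‖osc1 φ (ζ 0 - ζ 1) * M t ζ‖ ≤ C * R t * wt ζ := fun φ => by
    obtain ⟨C, hC, hCφ⟩ := exists_norm_osc1_le 1 φ
    simp only [pow_one] at hCφ
    refine ⟨C, hC, fun t ζ => ?_⟩
    rw [norm_mul]
    calc _ ≤ C * (brk (ζ 0 - ζ 1))⁻¹ * ‖M t ζ‖ :=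
          mul_le_mul_of_nonneg_right (hCφ _) (norm_nonneg _)
      _ = C * (‖M t ζ‖ * (brk (ζ 0 - ζ 1))⁻¹) := by ring
      _ ≤ C * (R t * wt ζ) := mul_le_mul_of_nonneg_left (hb t ζ) hC
      _ = _ := by ring
  have hTφ : ∀ t φ, (cF • T t) φ = cF • ∫ ζ : Plane, (osc1 φ (ζ 0 - ζ 1) * M t ζ) • g ζ :=
    fun t φ => by
      simp only [mul_smul]
      exact congrArg (cF • ·) (hT t φ)
  refine ⟨fun t => cF • T t, fun φ => ?_, fun Θ ψ φ hψ hΘ => ?_, ?_⟩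
  · obtain ⟨C, hC, h⟩ := hbound φ
    simp only [hTφ]
    exact (hg.continuous_integral (M := fun t => C * R t) (by fun_prop)
      (fun t => Continuous.aestronglyMeasurable (by have := hMt t; fun_prop))
      (fun ζ => continuous_const.mul (hM.comp (by fun_prop : Continuous fun t => (t, ζ))))
      h).const_smul cF
  · obtain ⟨C, hC, h⟩ := hbound φ
    have hw : Integrable fun t => ‖ψ t‖ * (C * R t) :=
      (ψ.continuous.norm.mul (by fun_prop)).integrable_of_hasCompactSupport
        (HasCompactSupport.mul_right (f := fun t => ‖ψ t‖) hψ.norm)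
    have := (integral_integral_smul_swap (μ := volume) (ν := volume)
      (k := fun t (ζ : Plane) => ψ t * (osc1 φ (ζ 0 - ζ 1) * M t ζ)) (G := g)
      (w := fun t => ‖ψ t‖ * (C * R t)) (v := wt) ?_ hg.meas (fun t ζ => ?_) hw hg.integrable).2
    · rw [hu Θ ψ φ hψ hΘ]
      simp only [hTφ]
      have e : ∀ ζ : Plane, ∫ t, ψ t * (osc1 φ (ζ 0 - ζ 1) * M t ζ) =
          (∫ t, ψ t * M t ζ) * osc1 φ (ζ 0 - ζ 1) := fun ζ => by
        rw [← integral_mul_const]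
        congr 1; funext t; ring
      simp only [e] at this
      simp only [mul_smul (2 : ℂ), integral_smul]
      rw [← this, smul_comm]
      congr 1
      rw [← integral_smul]
      congr 1; funext t
      rw [smul_comm (ψ t) cF, ← integral_smul (ψ t)]
      simp only [mul_smul]
    · have hM' : Continuous fun q : ℝ × Plane => M q.1 q.2 := hM
      unfold Function.uncurry; fun_prop
    · rw [norm_mul, mul_assoc]
      exact mul_le_mul_of_nonneg_left (h t ζ) (norm_nonneg _)
  · ext1 φ
    rw [hTφ]
    simp [h0]

/-- The time derivative of `Ek τ ξ t t`. -/
def dEk (t : ℝ) (ζ : Plane) : ℂ :=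
  ex (ζ 0 * t) * (D (ζ 1) t - D (ζ 1) (-t)) + ex (ζ 1 * t) * (D (ζ 0) t - D (ζ 0) (-t))

lemma hasDerivAt_Ek_diag (ζ : Plane) (t : ℝ) :
    HasDerivAt (fun t => Ek (ζ 0) (ζ 1) t t) (dEk t ζ) t := by
  refine ((((hasDerivAt_D (ζ 0) t).mul (hasDerivAt_D (ζ 1) t)).add (hasDerivAt_Q (ζ 0) (ζ 1) t)).add
    (hasDerivAt_Q (ζ 1) (ζ 0) t)).congr_deriv ?_
  rw [dEk]; ring

lemma continuous_dEk : Continuous (Function.uncurry dEk) := by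
  unfold Function.uncurry dEk; fun_prop

lemma norm_dEk_le (t : ℝ) (ζ : Plane) :
    ‖dEk t ζ‖ ≤ 2 * (|t| + 2) * ((brk (ζ 0))⁻¹ + (brk (ζ 1))⁻¹) := by
  have h : ∀ ω, ‖D ω t - D ω (-t)‖ ≤ 2 * (|t| + 2) * (brk ω)⁻¹ := fun ω => by
    have h1 := norm_D_le_brk ω t
    have h2 := norm_D_le_brk ω (-t)
    rw [abs_neg] at h2
    linarith [norm_sub_le (D ω t) (D ω (-t))]
  rw [dEk]
  refine (norm_add_le _ _).trans ?_
  rw [norm_mul, norm_mul, norm_ex, norm_ex]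
  linarith [h (ζ 0), h (ζ 1)]

lemma integral_deriv_mul_Ek_diag (ψ : 𝓢(ℝ, ℂ)) (hψ : HasCompactSupport ψ) (ζ : Plane) :
    ∫ t, deriv ψ t * Ek (ζ 0) (ζ 1) t t = -∫ t, ψ t * dEk t ζ := by
  have hdc : Continuous fun t => dEk t ζ :=
    continuous_dEk.comp (by fun_prop : Continuous fun t => (t, ζ))
  have hc' : Continuous (deriv ψ) := (SchwartzMap.derivCLM ℂ ℂ ψ).continuous
  have := integral_mul_deriv_eq_deriv_mul_of_integrable (u := fun t => Ek (ζ 0) (ζ 1) t t)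
    (v := ψ) (u' := fun t => dEk t ζ) (v' := deriv ψ) (fun x _ => hasDerivAt_Ek_diag ζ x)
    (fun x _ => ψ.differentiableAt.hasDerivAt)
    ((Continuous.mul (by fun_prop) hc').integrable_of_hasCompactSupport hψ.deriv.mul_left)
    ((hdc.mul ψ.continuous).integrable_of_hasCompactSupport hψ.mul_left)
    ((Continuous.mul (by fun_prop) ψ.continuous).integrable_of_hasCompactSupport hψ.mul_left)
  simpa only [mul_comm] using this

/-- In the coordinates t, x the operator ∂_α + ∂_β is ∂_t, so it acts on ψ alone. -/
lemma lineDeriv_rot {Θ : 𝓢(Plane, ℂ)} {ψ φ : 𝓢(ℝ, ℂ)}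
    (hΘ : ∀ t x : ℝ, Θ !₂[t + x, t - x] = ψ t * φ x) (t x : ℝ) :
    (∂_{eα} Θ + ∂_{eβ} Θ) !₂[t + x, t - x] = SchwartzMap.derivCLM ℂ ℂ ψ t * φ x := by
  rw [← LineDeriv.lineDerivOp_left_add, SchwartzMap.lineDerivOp_apply]
  have h1 : HasLineDerivAt ℝ Θ (deriv ψ t * φ x) !₂[t + x, t - x] (eα + eβ) := by
    unfold HasLineDerivAt
    have e : ∀ r : ℝ, Θ (!₂[t + x, t - x] + r • (eα + eβ)) = ψ (t + r) * φ x := fun r => by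
      rw [← hΘ]
      congr 1
      ext i; fin_cases i <;> simp [eα, eβ] <;> ring
    simp only [e]
    have := (ψ.differentiableAt (x := t + 0)).hasDerivAt.comp_const_add t 0
    simpa using this.mul_const (φ x)
  exact h1.lineDeriv

lemma lineDeriv_add_apply (u : 𝓢'(Plane, Vec n)) (Θ : 𝓢(Plane, ℂ)) :
    (∂_{eα} u + ∂_{eβ} u) Θ = -u (∂_{eα} Θ + ∂_{eβ} Θ) := by
  rw [map_add, neg_add]
  change (∂_{eα} u) Θ + (∂_{eβ} u) Θ = _
  rw [TemperedDistribution.lineDerivOp_apply_apply, TemperedDistribution.lineDerivOp_apply_apply,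
    map_neg, map_neg]

lemma WtIntegrable.isHomogeneousSolution {f U : 𝓢'(Plane, Vec n)} {g : Plane → Vec n}
    (hg : WtIntegrable g) (hf : IsFourierDensity f g)
    (hU : ∀ θ : 𝓢(Plane, ℂ), U θ = cF • ∫ ζ, pairE θ ζ • g ζ) : IsHomogeneousSolution f U where
  equation := by
    ext1 θ
    rw [TemperedDistribution.lineDerivOp_apply_apply, TemperedDistribution.lineDerivOp_apply_apply,
      LineDeriv.lineDerivOp_neg, neg_neg, hU, (hf.apply θ).2]
    simp only [pairE_lineDeriv]
  trace := by
    refine hasAntidiagonalTrace_zero hg (M := fun t ζ => Ek (ζ 0) (ζ 1) t t)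
      (R := fun t => 5 * ((|t| + 2) ^ 2 * (|t| + 2) ^ 2)) (by fun_prop)
      (by unfold Function.uncurry; fun_prop) (fun t ζ => ?_)
      (fun ζ => by simpa using Ek_antidiag (ζ 0) (ζ 1) 0) (fun Θ ψ φ _ hΘ => ?_)
    · refine (mul_le_of_le_one_right (norm_nonneg _) ?_).trans (norm_Ek_le ζ t t)
      exact inv_le_one_of_one_le₀ (one_le_brk _)
    · rw [hU]
      simp only [pairE_rot hΘ]
  trace_deriv := by
    refine hasAntidiagonalTrace_zero hg (M := dEk) (R := fun t => 2 * (|t| + 2)) (by fun_prop)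
      continuous_dEk (fun t ζ => ?_) (fun ζ => by simp [dEk]) (fun Θ ψ φ hψ hΘ => ?_)
    -- The time derivative decays only like ⟨τ⟩⁻¹ + ⟨ξ⟩⁻¹; multiplied by ⟨τ-ξ⟩⁻¹ this is the second
    -- part of `wt`.
    · have h := mul_le_mul_of_nonneg_right (norm_dEk_le t ζ) (inv_brk_pos (ζ 0 - ζ 1)).le
      refine h.trans ?_
      rw [mul_assoc]
      refine mul_le_mul_of_nonneg_left ?_ (by positivity)
      unfold wt
      have := mul_pos (inv_brk_pos (ζ 0)) (inv_brk_pos (ζ 1))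
      linarith
    · rw [lineDeriv_add_apply, hU]
      simp only [pairE_rot (lineDeriv_rot hΘ)]
      simp only [SchwartzMap.derivCLM_apply, integral_deriv_mul_Ek_diag ψ hψ]
      rw [← smul_neg, ← integral_neg]
      congr 2
      funext ζ
      rw [← neg_smul]
      congr 1; ring

/-! ### Primitives of Schwartz functions along a line -/

section LineIntegral

variable {V : Type} [NormedAddCommGroup V] [NormedSpace ℝ V]

/-- The integral of `Θ` over the part `S` of the line through `p` in the direction `eβ`. -/
def lineInt (S : Set ℝ) (Θ : Plane → V) (p : Plane) : V := ∫ γ in S, Θ (p + γ • eβ)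

lemma norm_smul_eβ (γ : ℝ) : ‖γ • eβ‖ = |γ| := by
  rw [norm_smul, Real.norm_eq_abs]
  simp [eβ, EuclideanSpace.norm_eq, Fin.sum_univ_two]

lemma exists_schwartz_decay (Θ : 𝓢(Plane, V)) (k : ℕ) :
    ∃ C : ℝ, 0 ≤ C ∧ ∀ p, (1 + ‖p‖) ^ k * ‖Θ p‖ ≤ C := by
  refine ⟨2 ^ k * ((Finset.Iic (k, 0)).sup (schwartzSeminormFamily ℝ Plane V)) Θ,
    mul_nonneg (by positivity) (apply_nonneg _ _), fun p => ?_⟩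
  have := SchwartzMap.one_add_le_sup_seminorm_apply (𝕜 := ℝ) (m := (k, 0)) (k := k) (n := 0)
    le_rfl le_rfl Θ p
  rwa [norm_iteratedFDeriv_zero] at this

lemma integrable_inv_one_add_sq : Integrable fun γ : ℝ => ((1 + ‖γ‖) ^ 2)⁻¹ := by
  have := integrable_one_add_norm (E := ℝ) (μ := volume) (r := 2) (by simp)
  refine this.congr (ae_of_all _ fun γ => ?_)
  simp only
  rw [Real.rpow_neg (by positivity)]
  norm_num

lemma exists_line_bound (Θ : 𝓢(Plane, V)) :
    ∃ C : ℝ, 0 ≤ C ∧ ∀ p (γ : ℝ), ‖Θ (p + γ • eβ)‖ ≤ C * (1 + ‖p‖) ^ 2 * ((1 + ‖γ‖) ^ 2)⁻¹ := by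
  obtain ⟨C, hC, h⟩ := exists_schwartz_decay Θ 2
  refine ⟨C, hC, fun p γ => ?_⟩
  rw [le_mul_inv_iff₀ (by positivity)]
  have h1 : 1 + ‖γ‖ ≤ (1 + ‖p + γ • eβ‖) * (1 + ‖p‖) := by
    have : ‖γ‖ ≤ ‖p + γ • eβ‖ + ‖p‖ := by
      rw [Real.norm_eq_abs, ← norm_smul_eβ]
      simpa using norm_sub_le (p + γ • eβ) p
    nlinarith [norm_nonneg p, norm_nonneg (p + γ • eβ)]
  calc _ ≤ ‖Θ (p + γ • eβ)‖ * ((1 + ‖p + γ • eβ‖) * (1 + ‖p‖)) ^ 2 := by gcongr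
    _ = (1 + ‖p + γ • eβ‖) ^ 2 * ‖Θ (p + γ • eβ)‖ * (1 + ‖p‖) ^ 2 := by ring
    _ ≤ _ := by gcongr; exact h _

/-- Moving away from the α-axis increases the norm, so |p + γe| dominates both |p| and |γ|, and
decay in p survives integration over γ. -/
lemma exists_half_line_bound (Θ : 𝓢(Plane, V)) (k : ℕ) :
    ∃ C : ℝ, 0 ≤ C ∧ ∀ p (γ : ℝ), 0 ≤ p 1 * γ →
      ‖p‖ ^ k * ‖Θ (p + γ • eβ)‖ ≤ C * ((1 + ‖γ‖) ^ 2)⁻¹ := by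
  obtain ⟨C, hC, h⟩ := exists_schwartz_decay Θ (k + 2)
  refine ⟨C, hC, fun p γ hp => ?_⟩
  rw [le_mul_inv_iff₀ (by positivity)]
  have hsq : ‖p + γ • eβ‖ ^ 2 = ‖p‖ ^ 2 + 2 * (p 1 * γ) + γ ^ 2 := by
    rw [EuclideanSpace.real_norm_sq_eq, EuclideanSpace.real_norm_sq_eq]
    simp [Fin.sum_univ_two, eβ]; ring
  have h1 : ‖p‖ ≤ ‖p + γ • eβ‖ := by
    refine (sq_le_sq₀ (norm_nonneg _) (norm_nonneg _)).1 ?_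
    nlinarith
  have h2 : ‖γ‖ ≤ ‖p + γ • eβ‖ := by
    refine (sq_le_sq₀ (norm_nonneg _) (norm_nonneg _)).1 ?_
    rw [Real.norm_eq_abs, sq_abs]
    nlinarith [norm_nonneg p]
  calc _ ≤ (1 + ‖p + γ • eβ‖) ^ k * ‖Θ (p + γ • eβ)‖ * (1 + ‖p + γ • eβ‖) ^ 2 := by
        gcongr
        linarith
    _ = (1 + ‖p + γ • eβ‖) ^ (k + 2) * ‖Θ (p + γ • eβ)‖ := by rw [pow_add]; ring
    _ ≤ C := h _

lemma integrable_line (Θ : 𝓢(Plane, V)) (p : Plane) : Integrable fun γ : ℝ => Θ (p + γ • eβ) := by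
  obtain ⟨C, hC, h⟩ := exists_line_bound Θ
  exact (integrable_inv_one_add_sq.const_mul _).mono'
    (Θ.continuous.comp (by fun_prop : Continuous fun γ : ℝ => p + γ • eβ)).aestronglyMeasurable
    (ae_of_all _ (h p))

lemma hasFDerivAt_lineInt (S : Set ℝ) (Θ : 𝓢(Plane, V)) (p : Plane) :
    HasFDerivAt (lineInt S Θ) (lineInt S (SchwartzMap.fderivCLM ℝ Plane V Θ) p) p := by
  obtain ⟨C, hC, h⟩ := exists_line_bound (SchwartzMap.fderivCLM ℝ Plane V Θ)
  refine hasFDerivAt_integral_of_dominated_of_fderiv_le (μ := volume.restrict S)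
    (F := fun p γ => Θ (p + γ • eβ))
    (F' := fun p γ => SchwartzMap.fderivCLM ℝ Plane V Θ (p + γ • eβ))
    (bound := fun γ => C * (2 + ‖p‖) ^ 2 * ((1 + ‖γ‖) ^ 2)⁻¹) (Metric.ball_mem_nhds p one_pos)
    (Eventually.of_forall fun q => (integrable_line Θ q).aestronglyMeasurable.restrict)
    (integrable_line Θ p).restrict
    (integrable_line (SchwartzMap.fderivCLM ℝ Plane V Θ) p).aestronglyMeasurable.restrict
    (ae_of_all _ fun γ q hq => ?_) (integrable_inv_one_add_sq.const_mul _).restrict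
    (ae_of_all _ fun γ q _ => ?_)
  · refine (h q γ).trans ?_
    have : ‖q‖ ≤ 1 + ‖p‖ := by
      have h1 := norm_sub_norm_le q p
      rw [Metric.mem_ball, dist_eq_norm] at hq
      linarith
    gcongr ?_ * ?_ ^ 2 * _
    linarith
  · have h1 : HasFDerivAt Θ (fderiv ℝ Θ (q + γ • eβ)) (q + γ • eβ) :=
      Θ.differentiableAt.hasFDerivAt
    exact (hasFDerivAt_comp_add_right (γ • eβ)).2 h1

lemma fderiv_lineInt (S : Set ℝ) (Θ : 𝓢(Plane, V)) :
    fderiv ℝ (lineInt S Θ) = lineInt S (SchwartzMap.fderivCLM ℝ Plane V Θ) :=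
  funext fun p => (hasFDerivAt_lineInt S Θ p).fderiv

end LineIntegral

/-- The target space varies inside the induction because the derivative is the line integral of a
Schwartz function with values in linear maps. -/
lemma contDiff_lineInt (S : Set ℝ) (m : ℕ) : ∀ {V : Type} [NormedAddCommGroup V]
    [NormedSpace ℝ V] (Θ : 𝓢(Plane, V)), ContDiff ℝ m (lineInt S Θ) := by
  induction m with
  | zero =>
    intro V _ _ Θ
    exact contDiff_zero.2 (continuous_iff_continuousAt.2 fun p =>
      (hasFDerivAt_lineInt S Θ p).continuousAt)
  | succ m ih =>
    intro V _ _ Θ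
    push_cast
    rw [contDiff_succ_iff_fderiv]
    refine ⟨fun p => (hasFDerivAt_lineInt S Θ p).differentiableAt, by simp, ?_⟩
    rw [fderiv_lineInt]
    exact ih _

lemma decay_lineInt {S : Set ℝ} (hS : MeasurableSet S) {H : Set Plane}
    (hH : ∀ p ∈ H, ∀ γ ∈ S, 0 ≤ p 1 * γ) (k m : ℕ) : ∀ {V : Type} [NormedAddCommGroup V]
    [NormedSpace ℝ V] (Θ : 𝓢(Plane, V)), ∃ C : ℝ, ∀ p ∈ H,
      ‖p‖ ^ k * ‖iteratedFDeriv ℝ m (lineInt S Θ) p‖ ≤ C := by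
  induction m with
  | zero =>
    intro V _ _ Θ
    obtain ⟨C, hC, h⟩ := exists_half_line_bound Θ k
    refine ⟨∫ γ in S, C * ((1 + ‖γ‖) ^ 2)⁻¹, fun p hp => ?_⟩
    rw [norm_iteratedFDeriv_zero, lineInt]
    calc _ ≤ ‖p‖ ^ k * ∫ γ in S, ‖Θ (p + γ • eβ)‖ := by
          gcongr; exact norm_integral_le_integral_norm _
      _ = ∫ γ in S, ‖p‖ ^ k * ‖Θ (p + γ • eβ)‖ := (integral_const_mul _ _).symm
      _ ≤ _ := setIntegral_mono_on ((integrable_line Θ p).norm.const_mul _).integrableOn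
          (integrable_inv_one_add_sq.const_mul _).integrableOn hS fun γ hγ =>
            h p γ (hH p hp γ hγ)
  | succ m ih =>
    intro V _ _ Θ
    obtain ⟨C, h⟩ := ih (SchwartzMap.fderivCLM ℝ Plane V Θ)
    refine ⟨C, fun p hp => ?_⟩
    rw [← norm_iteratedFDeriv_fderiv, fderiv_lineInt]
    exact h p hp

/-- The primitive has two expressions, an integral from -∞ and minus an integral to +∞, which agree
because the whole line integral is zero. The first decays where p 1 ≤ 0 and the second where p 1 ≥
0, so the primitive is Schwartz. -/
lemma exists_line_primitive (Θ : 𝓢(Plane, ℂ)) (h0 : ∀ p, lineInt univ Θ p = 0) :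
    ∃ Z : 𝓢(Plane, ℂ), ∂_{eβ} Z = Θ := by
  have hneg : lineInt (Iic 0) Θ = fun p => -lineInt (Ioi 0) Θ p := by
    funext p
    have := h0 p
    rw [lineInt, ← Iic_union_Ioi (a := (0 : ℝ)), setIntegral_union (Iic_disjoint_Ioi le_rfl)
      measurableSet_Ioi (integrable_line Θ p).integrableOn
      (integrable_line Θ p).integrableOn] at this
    exact eq_neg_of_add_eq_zero_left this
  let Z : 𝓢(Plane, ℂ) :=
    { toFun := lineInt (Iic 0) Θ
      smooth' := contDiff_infty.2 fun m => contDiff_lineInt _ m Θ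
      decay' := fun k m => by
        obtain ⟨C₁, h₁⟩ := decay_lineInt (H := {p | p 1 ≤ 0}) (measurableSet_Iic (a := (0 : ℝ)))
          (fun p hp γ hγ => mul_nonneg_of_nonpos_of_nonpos hp hγ) k m Θ
        obtain ⟨C₂, h₂⟩ := decay_lineInt (H := {p | 0 ≤ p 1}) (measurableSet_Ioi (a := (0 : ℝ)))
          (fun p hp γ hγ => mul_nonneg hp (le_of_lt hγ)) k m Θ
        refine ⟨max C₁ C₂, fun p => ?_⟩
        rcases le_total (p 1) 0 with hp | hp
        · exact (h₁ p hp).trans (le_max_left _ _)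
        · rw [hneg, show (fun p => -lineInt (Ioi 0) Θ p) = -lineInt (Ioi 0) Θ from rfl,
            iteratedFDeriv_neg, Pi.neg_apply, norm_neg]
          exact (h₂ p hp).trans (le_max_right _ _) }
  refine ⟨Z, ?_⟩
  ext p
  rw [SchwartzMap.lineDerivOp_apply_eq_fderiv]
  change fderiv ℝ (lineInt (Iic 0) Θ) p eβ = Θ p
  rw [fderiv_lineInt, lineInt, ContinuousLinearMap.integral_apply
    (integrable_line (SchwartzMap.fderivCLM ℝ Plane ℂ Θ) p).integrableOn]
  have hd : ∀ γ ∈ Iic (0 : ℝ), HasDerivAt (fun γ : ℝ => Θ (p + γ • eβ))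
      (SchwartzMap.fderivCLM ℝ Plane ℂ Θ (p + γ • eβ) eβ) γ := fun γ _ => by
    have h1 : HasFDerivAt Θ (fderiv ℝ Θ (p + γ • eβ)) (p + γ • eβ) :=
      Θ.differentiableAt.hasFDerivAt
    have h2 : HasDerivAt (fun γ : ℝ => p + γ • eβ) eβ γ := by
      simpa using ((hasDerivAt_id γ).smul_const eβ).const_add p
    exact h1.comp_hasDerivAt γ h2
  have hi := ((integrable_line (SchwartzMap.fderivCLM ℝ Plane ℂ Θ) p).apply_continuousLinearMap
    eβ).integrableOn (s := Iic (0 : ℝ))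
  have ht : Tendsto (fun γ : ℝ => Θ (p + γ • eβ)) atBot (𝓝 0) :=
    tendsto_zero_of_hasDerivAt_of_integrableOn_Iic hd hi (integrable_line Θ p).integrableOn
  rw [integral_Iic_of_hasDerivAt_of_tendsto' hd hi ht]
  simp

/-! ### Division by a coordinate -/

lemma integrable_osc_kernel (Θ : 𝓢(Plane, ℂ)) (ζ : Plane) :
    Integrable fun p : Plane => ex (p 0 * ζ 0 + p 1 * ζ 1) * Θ p :=
  (Θ.integrable (μ := volume)).norm.mono' (Continuous.aestronglyMeasurable (by fun_prop))
    (ae_of_all _ fun p => by simp)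

/-- The integral over vertical lines, as a function of the abscissa, has the restriction of the
transform to one axis as its Fourier transform; inversion gives zero. -/
lemma lineInt_eq_zero (Θ : 𝓢(Plane, ℂ)) (h : ∀ a : ℝ, osc Θ !₂[a, 0] = 0) (p : Plane) :
    lineInt univ Θ p = 0 := by
  set m : ℝ → ℂ := fun x => lineInt univ Θ !₂[x, 0] with hm
  have hmx : ∀ x, m x = ∫ y, Θ !₂[x, y] := fun x => by
    simp only [hm, lineInt, Measure.restrict_univ]
    congr 1; funext y; congr 1
    ext i; fin_cases i <;> simp [eβ]
  have hmc : Continuous m := by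
    have : Continuous (lineInt univ Θ) := (contDiff_lineInt univ 0 Θ).continuous
    exact this.comp (by fun_prop)
  have hint : Integrable fun q : ℝ × ℝ => Θ !₂[q.1, q.2] :=
    integrable_plane_iff.1 Θ.integrable
  have hmi : Integrable m := by
    refine hint.integral_prod_left.congr (ae_of_all _ fun x => (hmx x).symm)
  have hF : 𝓕 m = 0 := by
    funext w
    have h1 := h (-(2 * Real.pi * w))
    rw [osc, integral_plane] at h1
    have hi := integrable_plane_iff.1 (integrable_osc_kernel Θ !₂[-(2 * Real.pi * w), 0])
    rw [Measure.volume_eq_prod] at h1 hi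
    rw [integral_prod _ hi] at h1
    simp only [Matrix.cons_val_zero, Matrix.cons_val_one, mul_zero, add_zero, integral_const_mul,
      ← hmx] at h1
    rw [Real.fourier_eq', Pi.zero_apply, ← h1]
    congr 1; funext v
    rw [smul_eq_mul, ex, mul_comm Complex.I]
    congr 4
    simp; ring
  have hzero : m = 0 := by
    have := hmc.fourierInv_fourier_eq hmi (by rw [hF]; exact integrable_zero _ _ _)
    rw [hF] at this
    rw [← this]
    funext v
    rw [Real.fourierInv_eq']
    simp
  have hp := congrFun hzero (p 0)
  rw [hmx] at hp
  rw [lineInt, Measure.restrict_univ, ← integral_sub_right_eq_self _ (p 1)]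
  rw [Pi.zero_apply] at hp
  rw [← hp]
  congr 1; funext y; congr 1
  ext i; fin_cases i <;> simp [eβ]

lemma inner_eα (p : Plane) : inner ℝ p eα = p 0 := by simp [inner_plane, eα]
lemma inner_eβ (p : Plane) : inner ℝ p eβ = p 1 := by simp [inner_plane, eβ]

lemma hasTemperateGrowth_inner (m : Plane) :
    (fun p : Plane => (inner ℝ p m : ℝ)).HasTemperateGrowth := by fun_prop

/-- Division by a coordinate inside the Schwartz class, done on the Fourier side: vanishing on the
axis means that the line integrals of the transform vanish, so the transform is a β-derivative, and
a derivative becomes multiplication by the coordinate. -/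
lemma exists_div_snd (Ψ : 𝓢(Plane, ℂ)) (h : ∀ p : Plane, p 1 = 0 → Ψ p = 0) :
    ∃ Z : 𝓢(Plane, ℂ), ∀ p, Ψ p = p 1 * Z p := by
  obtain ⟨Z, hZ⟩ := exists_line_primitive (𝓕 Ψ) (lineInt_eq_zero (𝓕 Ψ) fun a => by
    rw [← fourierInv_eq_osc, FourierPair.fourierInv_fourier_eq]
    exact h _ (by simp))
  refine ⟨-(2 * Real.pi * Complex.I) • 𝓕⁻ Z, fun p => ?_⟩
  have := congrArg (fun Θ => (𝓕⁻ Θ : 𝓢(Plane, ℂ)) p) hZ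
  simp only [FourierPair.fourierInv_fourier_eq] at this
  rw [← this, SchwartzMap.fourierInv_lineDerivOp_eq, smul_apply, smul_apply,
    SchwartzMap.smulLeftCLM_apply_apply (hasTemperateGrowth_inner eβ), inner_eβ]
  simp only [Complex.real_smul, smul_eq_mul]
  ring

/-- The exchange of the two coordinates. -/
def swapCLE : Plane ≃L[ℝ] Plane :=
  LinearEquiv.toContinuousLinearEquiv
    { toFun := fun p => !₂[p 1, p 0]
      invFun := fun p => !₂[p 1, p 0]
      map_add' := fun p q => by ext i; fin_cases i <;> simp
      map_smul' := fun r p => by ext i; fin_cases i <;> simp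
      left_inv := fun p => by ext i; fin_cases i <;> simp
      right_inv := fun p => by ext i; fin_cases i <;> simp }

@[simp] lemma swapCLE_apply (p : Plane) : swapCLE p = !₂[p 1, p 0] := rfl

lemma exists_div_fst (Ψ : 𝓢(Plane, ℂ)) (h : ∀ p : Plane, p 0 = 0 → Ψ p = 0) :
    ∃ Z : 𝓢(Plane, ℂ), ∀ p, Ψ p = p 0 * Z p := by
  obtain ⟨Z, hZ⟩ := exists_div_snd (SchwartzMap.compCLMOfContinuousLinearEquiv ℂ swapCLE Ψ)
    fun p hp => h _ (by simpa using hp)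
  refine ⟨SchwartzMap.compCLMOfContinuousLinearEquiv ℂ swapCLE Z, fun p => ?_⟩
  have := hZ (swapCLE p)
  simp only [SchwartzMap.compCLMOfContinuousLinearEquiv_apply, Function.comp_apply] at this ⊢
  have e : swapCLE (swapCLE p) = p := by ext i; fin_cases i <;> simp
  rw [e] at this
  simpa using this

lemma exists_div_both (Ψ : 𝓢(Plane, ℂ)) (h0 : ∀ p : Plane, p 0 = 0 → Ψ p = 0)
    (h1 : ∀ p : Plane, p 1 = 0 → Ψ p = 0) :
    ∃ Z : 𝓢(Plane, ℂ), ∀ p, Ψ p = p 0 * (p 1 * Z p) := by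
  obtain ⟨Z₁, hZ₁⟩ := exists_div_fst Ψ h0
  obtain ⟨Z, hZ⟩ := exists_div_snd Z₁ fun p hp => by
    -- Off the origin one can divide by p 0; continuity then adds the origin.
    have hne : ∀ x : ℝ, x ≠ 0 → Z₁ !₂[x, 0] = 0 := fun x hx => by
      have := hZ₁ !₂[x, 0]
      rw [h1 _ (by simp)] at this
      simpa [hx] using this.symm
    have hc : Continuous fun x : ℝ => Z₁ !₂[x, 0] := by fun_prop
    have hz : (fun x : ℝ => Z₁ !₂[x, 0]) = fun _ => 0 := by
      refine Continuous.ext_on (dense_compl_singleton (0 : ℝ)) hc continuous_const fun x hx => ?_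
      exact hne x hx
    have := congrFun hz (p 0)
    convert this using 2
    ext i; fin_cases i <;> simp [hp]
  exact ⟨Z, fun p => by rw [hZ₁, hZ]⟩

/-! ### Tensor products of Schwartz functions -/

lemma exists_schwartz_deriv_decay (ρ : 𝓢(ℝ, ℂ)) (k m : ℕ) :
    ∃ C : ℝ, 0 ≤ C ∧ ∀ j ≤ m, ∀ x, (1 + ‖x‖) ^ k * ‖iteratedFDeriv ℝ j ρ x‖ ≤ C :=
  ⟨2 ^ k * ((Finset.Iic (k, m)).sup (schwartzSeminormFamily ℂ ℝ ℂ)) ρ,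
    mul_nonneg (by positivity) (apply_nonneg _ _), fun _ hj x =>
    SchwartzMap.one_add_le_sup_seminorm_apply (𝕜 := ℂ) (m := (k, m)) le_rfl hj ρ x⟩

lemma norm_iteratedFDeriv_comp_proj_le (h : 𝓢(ℝ, ℂ)) (i : Fin 2) (j : ℕ) (p : Plane) :
    ‖iteratedFDeriv ℝ j (fun p : Plane => h (p i)) p‖ ≤ ‖iteratedFDeriv ℝ j h (p i)‖ := by
  have hL : ‖(EuclideanSpace.proj i : Plane →L[ℝ] ℝ)‖ ≤ 1 :=
    ContinuousLinearMap.opNorm_le_bound _ zero_le_one fun x => by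
      rw [one_mul]; exact PiLp.norm_apply_le x i
  have := (EuclideanSpace.proj i : Plane →L[ℝ] ℝ).iteratedFDeriv_comp_right
    (h.smooth j) p le_rfl
  change ‖iteratedFDeriv ℝ j (h ∘ (EuclideanSpace.proj i : Plane →L[ℝ] ℝ)) p‖ ≤ _
  rw [this]
  refine (ContinuousMultilinearMap.norm_compContinuousLinearMap_le _ _).trans ?_
  rw [Finset.prod_const]
  exact mul_le_of_le_one_right (norm_nonneg _) (pow_le_one₀ (norm_nonneg _) hL)

lemma norm_plane_le (p : Plane) : ‖p‖ ≤ (1 + ‖p 0‖) * (1 + ‖p 1‖) := by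
  refine (sq_le_sq₀ (norm_nonneg _) (by positivity)).1 ?_
  rw [EuclideanSpace.norm_sq_eq, Fin.sum_univ_two]
  nlinarith [norm_nonneg (p 0), norm_nonneg (p 1), mul_nonneg (norm_nonneg (p 0))
    (norm_nonneg (p 1)), sq_nonneg (‖p 0‖ * ‖p 1‖), mul_nonneg (mul_nonneg (norm_nonneg (p 0))
    (norm_nonneg (p 1))) (norm_nonneg (p 0)), mul_nonneg (mul_nonneg (norm_nonneg (p 0))
    (norm_nonneg (p 1))) (norm_nonneg (p 1))]

/-- The map `h ↦ h(α) ρ(β)`. -/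
def tensorCLM (ρ : 𝓢(ℝ, ℂ)) : 𝓢(ℝ, ℂ) →L[ℂ] 𝓢(Plane, ℂ) :=
  SchwartzMap.mkCLM (fun h p => h (p 0) * ρ (p 1)) (fun f g p => by simp [add_mul])
    (fun a f p => by simp [mul_assoc])
    (fun h => (h.smooth'.comp (by fun_prop)).mul (ρ.smooth'.comp (by fun_prop)))
    (fun ⟨k, m⟩ => by
      obtain ⟨C, hC, hρ⟩ := exists_schwartz_deriv_decay ρ k m
      refine ⟨Finset.Iic (k, m), 2 ^ m * (2 ^ k * C), by positivity, fun h p => ?_⟩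
      set S := ((Finset.Iic (k, m)).sup (schwartzSeminormFamily ℂ ℝ ℂ)) h
      have hS : 0 ≤ S := apply_nonneg _ _
      have hc : ∀ (u : 𝓢(ℝ, ℂ)) (i : Fin 2), ContDiff ℝ m fun p : Plane => u (p i) :=
        fun u i => (u.smooth m).comp (by fun_prop)
      have h1 := norm_iteratedFDeriv_mul_le (hc h 0) (hc ρ 1) p (n := m) le_rfl
      refine (mul_le_mul_of_nonneg_left h1 (by positivity)).trans ?_
      have e : (2 : ℝ) ^ m * (2 ^ k * C) * S =
          ∑ i ∈ Finset.range (m + 1), (m.choose i : ℝ) * (2 ^ k * C * S) := by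
        rw [← Finset.sum_mul, ← Nat.cast_sum, Nat.sum_range_choose]
        push_cast; ring
      rw [e, Finset.mul_sum]
      refine Finset.sum_le_sum fun i hi => ?_
      have hi' : i ≤ m := Nat.lt_succ_iff.1 (Finset.mem_range.1 hi)
      have a1 := (mul_le_mul_of_nonneg_left (norm_iteratedFDeriv_comp_proj_le h 0 i p)
        (by positivity : 0 ≤ (1 + ‖p 0‖) ^ k)).trans
        (SchwartzMap.one_add_le_sup_seminorm_apply (𝕜 := ℂ) (m := (k, m)) le_rfl hi' h (p 0))
      have a2 := (mul_le_mul_of_nonneg_left (norm_iteratedFDeriv_comp_proj_le ρ 1 (m - i) p)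
        (by positivity : 0 ≤ (1 + ‖p 1‖) ^ k)).trans (hρ (m - i) (Nat.sub_le _ _) (p 1))
      calc _ ≤ ((1 + ‖p 0‖) * (1 + ‖p 1‖)) ^ k * ((m.choose i : ℝ) *
            ‖iteratedFDeriv ℝ i (fun p : Plane => h (p 0)) p‖ *
            ‖iteratedFDeriv ℝ (m - i) (fun p : Plane => ρ (p 1)) p‖) := by
            gcongr; exact norm_plane_le p
        _ = (m.choose i : ℝ) *
            (((1 + ‖p 0‖) ^ k * ‖iteratedFDeriv ℝ i (fun p : Plane => h (p 0)) p‖) *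
            ((1 + ‖p 1‖) ^ k * ‖iteratedFDeriv ℝ (m - i) (fun p : Plane => ρ (p 1)) p‖)) := by
            rw [mul_pow]; ring
        _ ≤ (m.choose i : ℝ) * ((2 ^ k * S) * C) := by
            refine mul_le_mul_of_nonneg_left (mul_le_mul a1 a2 (by positivity) (by positivity))
              (by positivity)
        _ = _ := by ring)

@[simp] lemma tensorCLM_apply (ρ h : 𝓢(ℝ, ℂ)) (p : Plane) :
    tensorCLM ρ h p = h (p 0) * ρ (p 1) := rfl

/-- The product of two Schwartz functions of the line. -/
def schwartzMul (χ h : 𝓢(ℝ, ℂ)) : 𝓢(ℝ, ℂ) := SchwartzMap.smulLeftCLM ℂ χ h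

@[simp] lemma schwartzMul_apply (χ h : 𝓢(ℝ, ℂ)) (x : ℝ) : schwartzMul χ h x = χ x * h x := by
  rw [schwartzMul, SchwartzMap.smulLeftCLM_apply_apply χ.hasTemperateGrowth, smul_eq_mul]

/-! ### Products with dilated Schwartz functions. -/

lemma deriv_dilate_mul (χ h : 𝓢(ℝ, ℂ)) (r : ℝ) : deriv (fun x => χ (r * x) * h x) =
    fun x => (r : ℂ) * (SchwartzMap.derivCLM ℂ ℂ χ (r * x) * h x) +
      χ (r * x) * SchwartzMap.derivCLM ℂ ℂ h x := by
  funext x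
  have h1 : HasDerivAt (fun x => χ (r * x)) (deriv χ (r * x) * r) x := by
    have := (χ.differentiableAt (x := r * x)).hasDerivAt.scomp x ((hasDerivAt_id x).const_mul r)
    simpa [Function.comp_def, mul_comm] using this
  rw [(h1.fun_mul (h.differentiableAt (x := x)).hasDerivAt).deriv]
  simp only [SchwartzMap.derivCLM_apply]
  ring

lemma contDiff_dilate_mul (χ h : 𝓢(ℝ, ℂ)) (r : ℝ) (m : ℕ) :
    ContDiff ℝ m fun x => χ (r * x) * h x :=
  ((χ.smooth m).comp (by fun_prop)).mul (h.smooth m)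

lemma exists_bound_dilate_mul (k m : ℕ) : ∀ χ h : 𝓢(ℝ, ℂ), ∃ C : ℝ, 0 ≤ C ∧
    ∀ r ∈ Icc (0 : ℝ) 1, ∀ x, |x| ^ k * ‖iteratedDeriv m (fun x => χ (r * x) * h x) x‖ ≤ C := by
  induction m with
  | zero =>
    intro χ h
    obtain ⟨C₁, hC₁, h₁⟩ := exists_schwartz_deriv_decay χ 0 0
    obtain ⟨C₂, hC₂, h₂⟩ := exists_schwartz_deriv_decay h k 0
    refine ⟨C₁ * C₂, by positivity, fun r _ x => ?_⟩
    have a1 := h₁ 0 le_rfl (r * x)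
    have a2 := h₂ 0 le_rfl x
    rw [norm_iteratedFDeriv_zero] at a1 a2
    rw [pow_zero, one_mul] at a1
    rw [iteratedDeriv_zero, norm_mul]
    calc _ ≤ ‖χ (r * x)‖ * ((1 + ‖x‖) ^ k * ‖h x‖) := by
          rw [Real.norm_eq_abs, mul_left_comm]; gcongr; linarith
      _ ≤ _ := by gcongr
  | succ m ih =>
    intro χ h
    obtain ⟨C₁, hC₁, h₁⟩ := ih (SchwartzMap.derivCLM ℂ ℂ χ) h
    obtain ⟨C₂, hC₂, h₂⟩ := ih χ (SchwartzMap.derivCLM ℂ ℂ h)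
    refine ⟨C₁ + C₂, by positivity, fun r hr x => ?_⟩
    rw [iteratedDeriv_succ', deriv_dilate_mul, iteratedDeriv_fun_add, iteratedDeriv_const_mul_field]
    · refine (mul_le_mul_of_nonneg_left (norm_add_le _ _) (by positivity)).trans ?_
      rw [mul_add]
      refine add_le_add ?_ (h₂ r hr x)
      refine le_trans ?_ (h₁ r hr x)
      rw [norm_mul, Complex.norm_real, Real.norm_eq_abs, abs_of_nonneg hr.1]
      exact mul_le_mul_of_nonneg_left (mul_le_of_le_one_left (norm_nonneg _) hr.2) (by positivity)
    · exact (contDiff_const.mul (contDiff_dilate_mul _ h r m)).contDiffAt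
    · exact (contDiff_dilate_mul χ _ r m).contDiffAt

/-- The factor r comes from the mean value inequality when no derivative is taken, and from the
chain rule when a derivative falls on the dilated function. -/
lemma exists_bound_dilate_sub (k m : ℕ) : ∀ χ h : 𝓢(ℝ, ℂ), ∃ C : ℝ, 0 ≤ C ∧
    ∀ r ∈ Icc (0 : ℝ) 1, ∀ x,
      |x| ^ k * ‖iteratedDeriv m (fun x => χ (r * x) * h x - χ 0 * h x) x‖ ≤ r * C := by
  induction m with
  | zero =>
    intro χ h
    obtain ⟨C₁, hC₁, h₁⟩ := exists_schwartz_deriv_decay (SchwartzMap.derivCLM ℂ ℂ χ) 0 0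
    obtain ⟨C₂, hC₂, h₂⟩ := exists_schwartz_deriv_decay h (k + 1) 0
    refine ⟨C₁ * C₂, by positivity, fun r hr x => ?_⟩
    have a1 : ‖χ (r * x) - χ 0‖ ≤ C₁ * ‖r * x - 0‖ :=
      convex_univ.norm_image_sub_le_of_norm_deriv_le (fun y _ => χ.differentiableAt)
        (fun y _ => by
          have := h₁ 0 le_rfl y
          rwa [norm_iteratedFDeriv_zero, pow_zero, one_mul] at this) (mem_univ 0) (mem_univ _)
    have a2 := h₂ 0 le_rfl x
    rw [norm_iteratedFDeriv_zero] at a2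
    rw [sub_zero, norm_mul, Real.norm_eq_abs, Real.norm_eq_abs, abs_of_nonneg hr.1] at a1
    rw [iteratedDeriv_zero, ← sub_mul, norm_mul]
    calc _ ≤ |x| ^ k * (C₁ * (r * |x|) * ‖h x‖) := by gcongr
      _ = r * (C₁ * (|x| ^ (k + 1) * ‖h x‖)) := by ring
      _ ≤ r * (C₁ * ((1 + ‖x‖) ^ (k + 1) * ‖h x‖)) := by
          have hr0 := hr.1
          have : |x| ≤ 1 + ‖x‖ := by rw [Real.norm_eq_abs]; linarith
          gcongr
      _ ≤ _ := by have hr0 := hr.1; gcongr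
  | succ m ih =>
    intro χ h
    obtain ⟨C₁, hC₁, h₁⟩ := exists_bound_dilate_mul k m (SchwartzMap.derivCLM ℂ ℂ χ) h
    obtain ⟨C₂, hC₂, h₂⟩ := ih χ (SchwartzMap.derivCLM ℂ ℂ h)
    refine ⟨C₁ + C₂, by positivity, fun r hr x => ?_⟩
    have e : deriv (fun x => χ (r * x) * h x - χ 0 * h x) = fun x =>
        (r : ℂ) * (SchwartzMap.derivCLM ℂ ℂ χ (r * x) * h x) +
          (χ (r * x) * SchwartzMap.derivCLM ℂ ℂ h x - χ 0 * SchwartzMap.derivCLM ℂ ℂ h x) := by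
      funext x
      rw [deriv_fun_sub ((contDiff_dilate_mul χ h r 1).differentiable one_ne_zero x)
        (h.differentiableAt.const_mul _), deriv_dilate_mul, deriv_const_mul _ h.differentiableAt,
        add_sub_assoc]
      rfl
    rw [iteratedDeriv_succ', e, iteratedDeriv_fun_add, iteratedDeriv_const_mul_field]
    · refine (mul_le_mul_of_nonneg_left (norm_add_le _ _) (by positivity)).trans ?_
      rw [mul_add, mul_add]
      refine add_le_add ?_ (h₂ r hr x)
      rw [norm_mul, Complex.norm_real, Real.norm_eq_abs, abs_of_nonneg hr.1, mul_left_comm]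
      exact mul_le_mul_of_nonneg_left (h₁ r hr x) hr.1
    · exact (contDiff_const.mul (contDiff_dilate_mul _ h r m)).contDiffAt
    · exact ((contDiff_dilate_mul χ _ r m).sub
        (contDiff_const.mul (SchwartzMap.smooth _ m))).contDiffAt

lemma tendsto_dilate_mul {χ h : 𝓢(ℝ, ℂ)} (hχ : χ 0 = 1) {r : ℕ → ℝ} (hr : ∀ j, r j ∈ Icc (0 : ℝ) 1)
    (hr0 : Tendsto r atTop (𝓝 0)) {u : ℕ → 𝓢(ℝ, ℂ)} (hu : ∀ j x, u j x = χ (r j * x) * h x) :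
    Tendsto u atTop (𝓝 h) := by
  rw [(schwartz_withSeminorms ℂ ℝ ℂ).tendsto_nhds]
  rintro ⟨k, m⟩ ε hε
  obtain ⟨C, hC, hb⟩ := exists_bound_dilate_sub k m χ h
  have hlim : Tendsto (fun j => r j * C) atTop (𝓝 0) := by simpa using hr0.mul_const C
  filter_upwards [hlim.eventually (gt_mem_nhds hε)] with j hj
  refine lt_of_le_of_lt ?_ hj
  refine SchwartzMap.seminorm_le_bound' ℂ k m _ (mul_nonneg (hr j).1 hC) fun x => ?_
  have e : ⇑(u j - h) = fun x => χ (r j * x) * h x - χ 0 * h x := by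
    funext x
    rw [sub_apply, hu, hχ, one_mul]
  rw [e]
  exact hb _ (hr j) x

/-! ### Uniqueness -/

lemma exists_dilate (ψ : 𝓢(ℝ, ℂ)) {r : ℝ} (hr : r ≠ 0) : ∃ u : 𝓢(ℝ, ℂ), ∀ x, u x = ψ (r * x) :=
  ⟨SchwartzMap.compCLMOfContinuousLinearEquiv ℂ
    (ContinuousLinearEquiv.smulLeft (R₁ := ℝ) (Units.mk0 r hr)) ψ, fun _ => rfl⟩

lemma exists_neg_arg (ψ : 𝓢(ℝ, ℂ)) : ∃ u : 𝓢(ℝ, ℂ), ∀ x, u x = ψ (-x) := by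
  simpa using exists_dilate ψ (r := -1) (by norm_num)

lemma exists_restrict (Ψ : 𝓢(Plane, ℂ)) :
    (∃ h : 𝓢(ℝ, ℂ), ∀ x, h x = Ψ !₂[x, 0]) ∧ ∃ k : 𝓢(ℝ, ℂ), ∀ x, k x = Ψ !₂[0, x] := by
  have key : ∀ v : Plane, ‖v‖ = 1 → ∃ h : 𝓢(ℝ, ℂ), ∀ x : ℝ, h x = Ψ (x • v) := fun v hv => by
    refine ⟨SchwartzMap.compCLMOfAntilipschitz ℂ (K := 1) (g := fun x : ℝ => x • v)
      (((ContinuousLinearMap.id ℝ ℝ).smulRight v).hasTemperateGrowth)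
      (AntilipschitzWith.of_le_mul_dist fun x y => ?_) Ψ, fun _ => rfl⟩
    rw [dist_eq_norm, dist_eq_norm, ← sub_smul, norm_smul, hv]
    simp
  have h0 : ‖eα‖ = 1 := by simp [eα, EuclideanSpace.norm_eq, Fin.sum_univ_two]
  have h1 : ‖eβ‖ = 1 := by simp [eβ, EuclideanSpace.norm_eq, Fin.sum_univ_two]
  constructor
  · obtain ⟨h, hh⟩ := key eα h0
    refine ⟨h, fun x => ?_⟩
    rw [hh]; congr 1; ext i; fin_cases i <;> simp [eα]
  · obtain ⟨h, hh⟩ := key eβ h1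
    refine ⟨h, fun x => ?_⟩
    rw [hh]; congr 1; ext i; fin_cases i <;> simp [eβ]

/-- Reduced to the plane by tensoring with ρ and restricting the quotient to the axis, where ρ(0) =
1. -/
lemma exists_div_line {h ρ : 𝓢(ℝ, ℂ)} (hρ : ρ 0 = 1) (h0 : h 0 = 0) :
    ∃ z : 𝓢(ℝ, ℂ), ∀ x, h x = x * z x := by
  obtain ⟨Z, hZ⟩ := exists_div_fst (tensorCLM ρ h) fun p hp => by simp [hp, h0]
  obtain ⟨z, hz⟩ := (exists_restrict Z).1
  refine ⟨z, fun x => ?_⟩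
  have := hZ !₂[x, 0]
  simpa [hρ, ← hz] using this

/-- The map `!₂[t, x] ↦ !₂[t + x, t - x]` inverted. -/
def rotInvCLE : Plane ≃L[ℝ] Plane :=
  LinearEquiv.toContinuousLinearEquiv
    { toFun := fun p => !₂[(p 0 + p 1) / 2, (p 0 - p 1) / 2]
      invFun := fun p => !₂[p 0 + p 1, p 0 - p 1]
      map_add' := fun p q => by ext i; fin_cases i <;> simp <;> ring
      map_smul' := fun r p => by ext i; fin_cases i <;> simp <;> ring
      left_inv := fun p => by ext i; fin_cases i <;> simp <;> ring
      right_inv := fun p => by ext i; fin_cases i <;> simp }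

lemma exists_rot (ψ φ : 𝓢(ℝ, ℂ)) :
    ∃ Θ : 𝓢(Plane, ℂ), ∀ t x : ℝ, Θ !₂[t + x, t - x] = ψ t * φ x := by
  refine ⟨SchwartzMap.compCLMOfContinuousLinearEquiv ℂ rotInvCLE (tensorCLM φ ψ), fun t x => ?_⟩
  have e : rotInvCLE !₂[t + x, t - x] = !₂[t, x] := by
    change !₂[_, _] = _
    ext i; fin_cases i <;> simp
  rw [SchwartzMap.compCLMOfContinuousLinearEquiv_apply, Function.comp_apply, e]
  simp

lemma fourierInv_rot {Θ : 𝓢(Plane, ℂ)} {ψ φ : 𝓢(ℝ, ℂ)}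
    (hΘ : ∀ t x : ℝ, Θ !₂[t + x, t - x] = ψ t * φ x) (p : Plane) :
    (𝓕⁻ Θ : 𝓢(Plane, ℂ)) p =
      2 * ((𝓕⁻ ψ : 𝓢(ℝ, ℂ)) (p 0 + p 1) * (𝓕⁻ φ : 𝓢(ℝ, ℂ)) (p 0 - p 1)) := by
  have hpi : 2 * Real.pi ≠ 0 := two_pi_pos.ne'
  have e0 : p = (2 * Real.pi)⁻¹ • ((2 * Real.pi) • p) := by rw [smul_smul, inv_mul_cancel₀ hpi, one_smul]
  have e1 : ∀ x : ℝ, x = (2 * Real.pi)⁻¹ * (2 * Real.pi * x) := fun x => by field_simp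
  rw [e1 (p 0 + p 1), e1 (p 0 - p 1), fourierInv_eq_osc1, fourierInv_eq_osc1]
  conv_lhs => rw [e0]
  rw [fourierInv_eq_osc, osc, integral_rot]
  have e : ∀ q : ℝ × ℝ, ex ((!₂[q.1 + q.2, q.1 - q.2] : Plane) 0 * ((2 * Real.pi) • p) 0 +
        (!₂[q.1 + q.2, q.1 - q.2] : Plane) 1 * ((2 * Real.pi) • p) 1) *
        Θ !₂[q.1 + q.2, q.1 - q.2] =
      (ex (2 * Real.pi * (p 0 + p 1) * q.1) * ψ q.1) *
        (ex (2 * Real.pi * (p 0 - p 1) * q.2) * φ q.2) := fun q => by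
    rw [hΘ, mul_mul_mul_comm, ← ex_add]
    congr 2
    simp; ring
  simp only [e]
  rw [Measure.volume_eq_prod,
    integral_prod_mul (fun t => ex (2 * Real.pi * (p 0 + p 1) * t) * ψ t)
      (fun x => ex (2 * Real.pi * (p 0 - p 1) * x) * φ x)]
  simp [osc1]

/-- Such a Ψ is p 0 · p 1 times a Schwartz function Z, so its transform is, up to the factor (2πi)²,
the mixed derivative of the transform of Z, on which V vanishes. -/
lemma apply_fourier_eq_zero {V : 𝓢'(Plane, Vec n)} (hV : ∂_{eα} (∂_{eβ} V) = 0) (Ψ : 𝓢(Plane, ℂ))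
    (h0 : ∀ p : Plane, p 0 = 0 → Ψ p = 0) (h1 : ∀ p : Plane, p 1 = 0 → Ψ p = 0) :
    V (𝓕 Ψ) = 0 := by
  obtain ⟨Z, hZ⟩ := exists_div_both Ψ h0 h1
  have hpi : (2 * Real.pi * Complex.I) ≠ 0 := by simp [Real.pi_ne_zero]
  have e : (∂_{eβ} (∂_{eα} (𝓕 Z)) : 𝓢(Plane, ℂ)) =
      𝓕 ((2 * Real.pi * Complex.I) ^ 2 • Ψ) := by
    rw [SchwartzMap.lineDerivOp_fourier_eq, SchwartzMap.lineDerivOp_fourier_eq]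
    congr 1
    ext p
    rw [smul_apply, SchwartzMap.smulLeftCLM_apply_apply (hasTemperateGrowth_inner eβ), smul_apply,
      SchwartzMap.smulLeftCLM_apply_apply (hasTemperateGrowth_inner eα), smul_apply, hZ, inner_eα,
      inner_eβ]
    simp only [Complex.real_smul, smul_eq_mul]
    ring
  have h := congrArg (fun T : 𝓢'(Plane, Vec n) => T (𝓕 Z)) hV
  simp only [TemperedDistribution.lineDerivOp_apply_apply, LineDeriv.lineDerivOp_neg, neg_neg] at h
  rw [e, FourierTransform.fourier_smul, map_smul] at h
  exact (smul_eq_zero.1 h).resolve_left (pow_ne_zero 2 hpi)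

/-- By the previous lemma V sees only the restrictions of the inverse transform to the two axes;
this is V = a(α) + b(β) on the Fourier side. -/
lemma exists_axes {V : 𝓢'(Plane, Vec n)} (hV : ∂_{eα} (∂_{eβ} V) = 0) {ρ : 𝓢(ℝ, ℂ)}
    (hρ : ρ 0 = 1) :
    ∃ A B : 𝓢(ℝ, ℂ) →L[ℂ] Vec n, ∀ (Θ : 𝓢(Plane, ℂ)) (h k : 𝓢(ℝ, ℂ)),
      (∀ x, h x = (𝓕⁻ Θ : 𝓢(Plane, ℂ)) !₂[x, 0]) → (∀ x, k x = (𝓕⁻ Θ : 𝓢(Plane, ℂ)) !₂[0, x]) →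
        V Θ = A h + B k := by
  let W : 𝓢(Plane, ℂ) →L[ℂ] Vec n :=
    ContinuousLinearMap.comp (show 𝓢(Plane, ℂ) →L[ℂ] Vec n from V)
      (FourierTransform.fourierCLM ℂ 𝓢(Plane, ℂ))
  let δ₀ : 𝓢(ℝ, ℂ) →L[ℂ] ℂ := (BoundedContinuousFunction.evalCLM ℂ 0).comp
    (SchwartzMap.toBoundedContinuousFunctionCLM ℂ ℝ ℂ)
  have hδ : ∀ h, δ₀ h = h 0 := fun _ => rfl
  refine ⟨W.comp (tensorCLM ρ) - δ₀.smulRight (W (tensorCLM ρ ρ)),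
    W.comp ((SchwartzMap.compCLMOfContinuousLinearEquiv ℂ swapCLE).comp (tensorCLM ρ)),
    fun Θ h k hh hk => ?_⟩
  have h00 : k 0 = h 0 := by
    rw [hh, hk]
  -- Both restrictions are extended by tensoring with ρ. Each extension also has a trace on the
  -- other axis, and the common value at the origin, counted twice, is corrected by h(0) ρ⊗ρ.
  have := apply_fourier_eq_zero hV (𝓕⁻ Θ - tensorCLM ρ h + h 0 • tensorCLM ρ ρ -
    SchwartzMap.compCLMOfContinuousLinearEquiv ℂ swapCLE (tensorCLM ρ k)) (fun p hp => ?_)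
    (fun p hp => ?_)
  · change W _ = 0 at this
    rw [map_sub, map_add, map_sub, map_smul] at this
    have e : W (𝓕⁻ Θ) = V Θ := by
      change V (𝓕 (𝓕⁻ Θ)) = _
      rw [FourierInvPair.fourier_fourierInv_eq]
    rw [e] at this
    change _ = W (tensorCLM ρ h) - δ₀ h • W (tensorCLM ρ ρ) +
      W (SchwartzMap.compCLMOfContinuousLinearEquiv ℂ swapCLE (tensorCLM ρ k))
    rw [hδ]
    rw [sub_eq_zero] at this
    rw [← this]
    abel
  · have hp' : p = !₂[0, p 1] := by ext i; fin_cases i <;> simp [hp]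
    have : (𝓕⁻ Θ : 𝓢(Plane, ℂ)) p = k (p 1) := by rw [hk, ← hp']
    simp [this, hp, hρ]
  · have hp' : p = !₂[p 0, 0] := by ext i; fin_cases i <;> simp [hp]
    have : (𝓕⁻ Θ : 𝓢(Plane, ℂ)) p = h (p 0) := by rw [hh, ← hp']
    simp [this, hp, hρ, h00]

/-- A compactly supported Schwartz function of integral one. -/
lemma exists_schwartz_integral_one : ∃ ψ : 𝓢(ℝ, ℂ), (∀ x, 2 ≤ |x| → ψ x = 0) ∧ ∫ x, ψ x = 1 := by
  let b : ContDiffBump (0 : ℝ) := ⟨1, 2, one_pos, one_lt_two⟩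
  refine ⟨HasCompactSupport.toSchwartzMap (f := fun x => ((b.normed volume x : ℝ) : ℂ))
    (b.hasCompactSupport_normed.comp_left Complex.ofReal_zero)
    (Complex.ofRealCLM.contDiff.comp b.contDiff_normed), fun x hx => ?_, ?_⟩
  · change ((b.normed volume x : ℝ) : ℂ) = 0
    have : x ∉ Function.support (b.normed volume) := by
      rw [b.support_normed_eq, Metric.mem_ball, dist_zero_right, Real.norm_eq_abs]
      exact not_lt.2 hx
    rw [Function.notMem_support.1 this, Complex.ofReal_zero]
  · change ∫ x, ((b.normed volume x : ℝ) : ℂ) = 1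
    rw [integral_complex_ofReal, b.integral_normed, Complex.ofReal_one]

/-- With ψ = r⁻¹ψ₀(·/r) approximating the Dirac mass at t = 0, its inverse transform is χ(r·) with
χ(0) = ∫ψ₀ = 1. As r → 0 the left side of H tends to A h₀ + B k₀ by `tendsto_dilate_mul`, and the
right side to a multiple of w 0. -/
lemma trace_limit {ψ₀ : 𝓢(ℝ, ℂ)} (hψ₀ : ∀ x, 2 ≤ |x| → ψ₀ x = 0) (hI : ∫ x, ψ₀ x = 1)
    (A B : 𝓢(ℝ, ℂ) →L[ℂ] Vec n) {w : ℝ → Vec n} (hw : Continuous w) (hw0 : w 0 = 0)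
    (h₀ k₀ : 𝓢(ℝ, ℂ)) (c : ℂ)
    (H : ∀ ψ h k : 𝓢(ℝ, ℂ), HasCompactSupport ψ → (∀ x, h x = (𝓕⁻ ψ : 𝓢(ℝ, ℂ)) x * h₀ x) →
      (∀ x, k x = (𝓕⁻ ψ : 𝓢(ℝ, ℂ)) x * k₀ x) → A h + B k = c • ∫ t, ψ t • w t) :
    A h₀ + B k₀ = 0 := by
  set r : ℕ → ℝ := fun j => 1 / ((j : ℝ) + 1) with hr
  have hr0 : Tendsto r atTop (𝓝 0) := tendsto_one_div_add_atTop_nhds_zero_nat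
  have hrp : ∀ j, 0 < r j := fun j => by positivity
  have hrI : ∀ j, r j ∈ Icc (0 : ℝ) 1 := fun j => ⟨(hrp j).le, by
    rw [hr]; exact (div_le_one (by positivity)).2 (by linarith [(Nat.cast_nonneg j : (0 : ℝ) ≤ j)])⟩
  have hχ : (𝓕⁻ ψ₀ : 𝓢(ℝ, ℂ)) 0 = 1 := by
    have := fourierInv_eq_osc1 ψ₀ 0
    rw [mul_zero] at this
    rw [this, osc1]
    simpa using hI
  choose d hd using fun j => exists_dilate (𝓕⁻ ψ₀) (hrp j).ne'
  choose e he using fun j => exists_dilate ψ₀ (inv_ne_zero (hrp j).ne')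
  have hinv : ∀ j x, (𝓕⁻ ((r j)⁻¹ • e j) : 𝓢(ℝ, ℂ)) x = d j x := fun j x => by
    have hpi : 2 * Real.pi ≠ 0 := two_pi_pos.ne'
    have e1 : ∀ x : ℝ, x = (2 * Real.pi)⁻¹ * (2 * Real.pi * x) := fun x => by field_simp
    rw [hd, e1 x, e1 (r j * _), fourierInv_eq_osc1, fourierInv_eq_osc1, osc1, osc1, ← e1]
    have := Measure.integral_comp_mul_left
      (fun y => ex (2 * Real.pi * (r j * x) * y) * ψ₀ y) (r j)⁻¹
    rw [inv_inv, abs_of_pos (hrp j)] at this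
    rw [← inv_smul_smul₀ (hrp j).ne' (∫ y, ex (2 * Real.pi * (r j * x) * y) * ψ₀ y), ← this,
      ← integral_smul]
    congr 1; funext y
    rw [smul_apply, he, mul_smul_comm]
    congr 3
    have := (hrp j).ne'
    field_simp
  have hA : Tendsto (fun j => A (schwartzMul (d j) h₀) + B (schwartzMul (d j) k₀)) atTop
      (𝓝 (A h₀ + B k₀)) := by
    refine ((A.continuous.tendsto _).comp (tendsto_dilate_mul hχ hrI hr0 fun j x => ?_)).add
      ((B.continuous.tendsto _).comp (tendsto_dilate_mul hχ hrI hr0 fun j x => ?_))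
    · rw [schwartzMul_apply, hd]
    · rw [schwartzMul_apply, hd]
  have hsupp : ∀ j, HasCompactSupport ((r j)⁻¹ • e j : 𝓢(ℝ, ℂ)) := fun j => by
    refine HasCompactSupport.intro (isCompact_Icc (a := -(2 * r j)) (b := 2 * r j)) fun x hx => ?_
    rw [smul_apply, he, hψ₀, smul_zero]
    rw [abs_mul, abs_inv, abs_of_pos (hrp j), ← div_eq_inv_mul, le_div_iff₀ (hrp j)]
    by_contra! hlt
    exact hx (abs_le.1 hlt.le)
  -- The substitution t ↦ r t puts all integrals on the fixed interval [-2, 2], where they depend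
  -- continuously on r.
  have hval : ∀ j, A (schwartzMul (d j) h₀) + B (schwartzMul (d j) k₀) =
      c • ∫ t in (-2 : ℝ)..2, ψ₀ t • w (r j * t) := fun j => by
    rw [H ((r j)⁻¹ • e j) _ _ (hsupp j) (fun x => by rw [schwartzMul_apply, hinv])
      (fun x => by rw [schwartzMul_apply, hinv])]
    congr 1
    have := Measure.integral_comp_mul_left (fun y => ψ₀ y • w (r j * y)) (r j)⁻¹
    rw [inv_inv, abs_of_pos (hrp j)] at this
    rw [intervalIntegral.integral_eq_integral_of_support_subset,
      ← inv_smul_smul₀ (hrp j).ne' (∫ y, ψ₀ y • w (r j * y)), ← this, ← integral_smul]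
    · congr 1; funext y
      rw [smul_apply, he, smul_assoc, mul_inv_cancel_left₀ (hrp j).ne']
    · intro x hx
      have hx' : ψ₀ x ≠ 0 := fun h => hx (by simp [h])
      have := abs_lt.1 (not_le.1 fun h => hx' (hψ₀ x h))
      exact ⟨this.1, this.2.le⟩
  simp only [hval] at hA
  have hc : Continuous fun s : ℝ => ∫ t in (-2 : ℝ)..2, ψ₀ t • w (s * t) :=
    intervalIntegral.continuous_parametric_intervalIntegral_of_continuous' (by
      unfold Function.uncurry; fun_prop) _ _
  have hB := ((hc.tendsto 0).comp hr0).const_smul c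
  simp only [Function.comp_def, zero_mul, hw0, smul_zero, intervalIntegral.integral_zero] at hB
  exact tendsto_nhds_unique hA hB

lemma fourierInv_deriv (ψ : 𝓢(ℝ, ℂ)) (x : ℝ) :
    (𝓕⁻ (SchwartzMap.derivCLM ℂ ℂ ψ) : 𝓢(ℝ, ℂ)) x =
      -(2 * Real.pi * Complex.I) * (x * (𝓕⁻ ψ : 𝓢(ℝ, ℂ)) x) := by
  have := SchwartzMap.fourierInv_lineDerivOp_eq ψ (1 : ℝ)
  have e : (∂_{(1 : ℝ)} ψ : 𝓢(ℝ, ℂ)) = SchwartzMap.derivCLM ℂ ℂ ψ := by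
    ext x
    rw [SchwartzMap.lineDerivOp_apply_eq_fderiv, SchwartzMap.derivCLM_apply, fderiv_apply_one_eq_deriv]
  rw [← e, this, smul_apply, SchwartzMap.smulLeftCLM_apply_apply (by fun_prop)]
  simp [mul_assoc]

/-- On the Fourier side the two traces say A h + B ȟ = 0 and A(xh) + B(xȟ) = 0, with ȟ the
reflection of h. They are the transforms of a(x) + b(-x) = 0 and a′(x) + b′(-x) = 0. -/
lemma eq_zero_of_trace_eq_zero {V : 𝓢'(Plane, Vec n)} (hV : IsHomogeneousSolution 0 V) : V = 0 := by
  obtain ⟨ψ₀, hψ₀, hI⟩ := exists_schwartz_integral_one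
  have hχ : (𝓕⁻ ψ₀ : 𝓢(ℝ, ℂ)) 0 = 1 := by
    have := fourierInv_eq_osc1 ψ₀ 0
    rw [mul_zero] at this
    rw [this, osc1]
    simpa using hI
  obtain ⟨A, B, hAB⟩ := exists_axes hV.equation hχ
  have hrot : ∀ (Θ : 𝓢(Plane, ℂ)) (ψ φ h k : 𝓢(ℝ, ℂ)),
      (∀ t x : ℝ, Θ !₂[t + x, t - x] = ψ t * φ x) →
      (∀ x, h x = (𝓕⁻ ψ : 𝓢(ℝ, ℂ)) x * (𝓕⁻ φ : 𝓢(ℝ, ℂ)) x) →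
      (∀ x, k x = (𝓕⁻ ψ : 𝓢(ℝ, ℂ)) x * (𝓕⁻ φ : 𝓢(ℝ, ℂ)) (-x)) →
      V Θ = (2 : ℂ) • (A h + B k) := fun Θ ψ φ h k hΘ hh hk => by
    rw [smul_add, ← map_smul, ← map_smul]
    refine hAB Θ _ _ (fun x => ?_) (fun x => ?_)
    · rw [fourierInv_rot hΘ, smul_apply, hh]; simp
    · rw [fourierInv_rot hΘ, smul_apply, hk]; simp
  let M : 𝓢(ℝ, ℂ) →L[ℂ] 𝓢(ℝ, ℂ) := SchwartzMap.smulLeftCLM ℂ (fun x : ℝ => (x : ℂ))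
  have hM : ∀ h x, M h x = x * h x := fun h x =>
    SchwartzMap.smulLeftCLM_apply_apply (Complex.ofRealCLM.hasTemperateGrowth) h x
  have h1 : ∀ h k : 𝓢(ℝ, ℂ), (∀ x, k x = h (-x)) → A h + B k = 0 := fun h₀ k₀ hk₀ => by
    obtain ⟨w, hw, hwV, hw0⟩ := hV.trace
    refine trace_limit hψ₀ hI A B (hw (𝓕 h₀)) (by rw [hw0]; rfl) h₀ k₀ 1
      fun ψ h k hψ hh hk => ?_
    obtain ⟨Θ, hΘ⟩ := exists_rot ψ (𝓕 h₀)
    have e1 := hwV Θ ψ _ hψ hΘ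
    rw [hrot Θ ψ _ h k hΘ (by simpa using hh) (by simpa [← hk₀] using hk)] at e1
    rw [one_smul]
    exact smul_right_injective _ (two_ne_zero' ℂ) e1
  have h2 : ∀ h k : 𝓢(ℝ, ℂ), (∀ x, k x = h (-x)) → A (M h) + B (M k) = 0 := fun h₀ k₀ hk₀ => by
    obtain ⟨w, hw, hwV, hw0⟩ := hV.trace_deriv
    refine trace_limit hψ₀ hI (A.comp M) (B.comp M) (hw (𝓕 h₀)) (by rw [hw0]; rfl) h₀ k₀
      (2 * Real.pi * Complex.I)⁻¹ fun ψ h k hψ hh hk => ?_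
    have hpi : (2 * Real.pi * Complex.I) ≠ 0 := by simp [Real.pi_ne_zero]
    obtain ⟨Θ, hΘ⟩ := exists_rot ψ (𝓕 h₀)
    have e1 := hwV Θ ψ _ hψ hΘ
    rw [lineDeriv_add_apply, hrot _ (SchwartzMap.derivCLM ℂ ℂ ψ) _
      (-(2 * Real.pi * Complex.I) • M h) (-(2 * Real.pi * Complex.I) • M k) (lineDeriv_rot hΘ)
      (fun x => by rw [smul_apply, hM, hh, fourierInv_deriv]; simp; ring)
      (fun x => by rw [smul_apply, hM, hk, fourierInv_deriv, hk₀]; simp; ring), ← smul_neg] at e1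
    have e2 := smul_right_injective _ (two_ne_zero' ℂ) e1
    rw [← e2, map_smul, map_smul, ← smul_add, neg_smul, neg_neg, inv_smul_smul₀ hpi]
    rfl
  -- Reflection sends x h to -x ȟ, so the first relation applied to x h has the opposite sign from
  -- the second. Hence B kills all multiples of x: b is constant.
  have h3 : ∀ k, B (M k) = 0 := fun k => by
    obtain ⟨h, hh⟩ := exists_neg_arg k
    have e1 := h2 h k fun x => by rw [hh, neg_neg]
    have e2 := h1 (M h) (-(M k)) fun x => by
      rw [neg_apply, hM, hM, hh, neg_neg]; push_cast; ring
    rw [map_neg, ← sub_eq_add_neg, sub_eq_zero] at e2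
    rw [e2, ← two_smul ℂ, smul_eq_zero] at e1
    exact e1.resolve_left two_ne_zero
  ext1 Θ
  obtain ⟨⟨h, hh⟩, k, hk⟩ := exists_restrict (𝓕⁻ Θ)
  obtain ⟨h', hh'⟩ := exists_neg_arg h
  -- The restrictions to the two axes agree at the origin, so k and the reflection of h differ by a
  -- multiple of x, which B does not see.
  obtain ⟨z, hz⟩ := exists_div_line (h := k - h') hχ (by
    rw [sub_apply, hh', neg_zero, hk, hh, sub_self])
  have ez : k - h' = M z := by ext x; rw [hz, hM]
  have e1 := h1 h h' hh'
  have e2 := h3 z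
  rw [← ez, map_sub, sub_eq_zero] at e2
  rw [hAB Θ h k hh hk, e2, e1]
  rfl

lemma HasAntidiagonalTrace.sub {u v : 𝓢'(Plane, Vec n)} {S T : 𝓢'(ℝ, Vec n)}
    (hu : HasAntidiagonalTrace u S) (hv : HasAntidiagonalTrace v T) :
    HasAntidiagonalTrace (u - v) (S - T) := by
  obtain ⟨w, hw, hwu, hw0⟩ := hu
  obtain ⟨z, hz, hzv, hz0⟩ := hv
  refine ⟨fun t => w t - z t, fun φ => (hw φ).sub (hz φ), fun Θ ψ φ hψ hΘ => ?_, by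
    simp only [hw0, hz0]⟩
  have hi : ∀ {y : ℝ → Vec n}, Continuous y → Integrable fun t => ψ t • y t := fun hy =>
    (ψ.continuous.smul hy).integrable_of_hasCompactSupport hψ.smul_right
  change u Θ - v Θ = (2 : ℂ) • ∫ t, ψ t • (w t φ - z t φ)
  simp only [smul_sub]
  rw [integral_sub (hi (hw φ)) (hi (hz φ)), smul_sub, hwu Θ ψ φ hψ hΘ, hzv Θ ψ φ hψ hΘ]

lemma IsHomogeneousSolution.unique {f U U' : 𝓢'(Plane, Vec n)} (hU : IsHomogeneousSolution f U)
    (hU' : IsHomogeneousSolution f U') : U' = U := by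
  have hd : ∀ (v : Plane) (u u' : 𝓢'(Plane, Vec n)), ∂_{v} (u' - u) = ∂_{v} u' - ∂_{v} u :=
    fun v u u' => by
      rw [sub_eq_add_neg, LineDeriv.lineDerivOp_add, LineDeriv.lineDerivOp_neg, ← sub_eq_add_neg]
  refine sub_eq_zero.1 (eq_zero_of_trace_eq_zero ⟨?_, ?_, ?_⟩)
  · rw [hd, hd, hU'.equation, hU.equation, sub_self]
  · simpa using hU'.trace.sub hU.trace
  · have := hU'.trace_deriv.sub hU.trace_deriv
    rw [sub_self] at this
    convert this using 1
    rw [hd, hd]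
    abel

/-! ### Fourier transforms of the localised kernels on the line -/

lemma integrable_brk_sq_mul (κ : 𝓢(ℝ, ℂ)) : Integrable (fun x => (|x| + 2) ^ 2 * ‖κ x‖) := by
  have h2 := κ.integrable_pow_mul volume 2
  have h1 := (κ.integrable_pow_mul volume 1).const_mul 4
  have h0 := (κ.integrable (μ := volume)).norm.const_mul 4
  refine ((h2.add h1).add h0).congr (ae_of_all _ fun x => ?_)
  simp only [Pi.add_apply, Real.norm_eq_abs, pow_one]
  ring

lemma integrable_growth_schwartz {u : ℝ → ℂ} (hu : Continuous u)
    (hb : ∀ y, ‖u y‖ ≤ (|y| + 2) ^ 2) (κ : 𝓢(ℝ, ℂ)) : Integrable fun y => κ y * u y := by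
  refine (integrable_brk_sq_mul κ).mono' (κ.continuous.mul hu).aestronglyMeasurable
    (ae_of_all _ fun y => ?_)
  rw [norm_mul, mul_comm]
  exact mul_le_mul_of_nonneg_right (hb y) (norm_nonneg _)

lemma integrable_ex_mul {h : ℝ → ℂ} (hh : Integrable h) (ω : ℝ) :
    Integrable fun y => ex (ω * y) * h y :=
  hh.norm.mono' ((Continuous.aestronglyMeasurable (by fun_prop)).mul hh.aestronglyMeasurable)
    (ae_of_all _ fun y => by simp)

lemma norm_osc1_le (h : ℝ → ℂ) (ω : ℝ) : ‖osc1 h ω‖ ≤ ∫ y, ‖h y‖ := by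
  refine (norm_integral_le_integral_norm _).trans (le_of_eq ?_)
  simp

lemma norm_osc1_growth_le {u : ℝ → ℂ} (hu : Continuous u) (hb : ∀ y, ‖u y‖ ≤ (|y| + 2) ^ 2)
    (κ : 𝓢(ℝ, ℂ)) (ω : ℝ) :
    ‖osc1 (fun y => κ y * u y) ω‖ ≤ ∫ y, (|y| + 2) ^ 2 * ‖κ y‖ := by
  refine (norm_osc1_le _ ω).trans ?_
  refine integral_mono (integrable_growth_schwartz hu hb κ).norm (integrable_brk_sq_mul κ)
    fun y => ?_
  change ‖κ y * u y‖ ≤ (|y| + 2) ^ 2 * ‖κ y‖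
  rw [norm_mul, mul_comm]
  exact mul_le_mul_of_nonneg_right (hb y) (norm_nonneg _)

lemma osc1_add {h₁ h₂ : ℝ → ℂ} (i₁ : Integrable h₁) (i₂ : Integrable h₂) (ω : ℝ) :
    osc1 (fun y => h₁ y + h₂ y) ω = osc1 h₁ ω + osc1 h₂ ω := by
  simp only [osc1, mul_add]
  exact integral_add (integrable_ex_mul i₁ ω) (integrable_ex_mul i₂ ω)

lemma osc1_const_mul (c : ℂ) (h : ℝ → ℂ) (ω : ℝ) :
    osc1 (fun y => c * h y) ω = c * osc1 h ω := by
  rw [osc1, osc1, ← integral_const_mul]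
  congr 1; funext y; ring

lemma osc1_ex_mul (a : ℝ) (h : ℝ → ℂ) (ω : ℝ) :
    osc1 (fun y => h y * ex (a * y)) ω = osc1 h (ω + a) := by
  rw [osc1, osc1]
  congr 1; funext y
  rw [add_mul, ex_add]; ring

/-- Integration by parts: a power of ω is traded for a derivative of the cut-off or of u. -/
lemma I_mul_osc1 {u u' : ℝ → ℂ} (hd : ∀ y, HasDerivAt u (u' y) y) (hu' : Continuous u')
    (hb : ∀ y, ‖u y‖ ≤ (|y| + 2) ^ 2) (hb' : ∀ y, ‖u' y‖ ≤ (|y| + 2) ^ 2) (κ : 𝓢(ℝ, ℂ)) (ω : ℝ) :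
    Complex.I * ω * osc1 (fun y => κ y * u y) ω =
      -(osc1 (fun y => SchwartzMap.derivCLM ℂ ℂ κ y * u y) ω + osc1 (fun y => κ y * u' y) ω) := by
  have hu : Continuous u := continuous_iff_continuousAt.2 fun y => (hd y).continuousAt
  have i1 := integrable_growth_schwartz hu hb (SchwartzMap.derivCLM ℂ ℂ κ)
  have i2 := integrable_growth_schwartz hu' hb' κ
  have i3 := integrable_growth_schwartz hu hb κ
  have := integral_mul_deriv_eq_deriv_mul_of_integrable (u := fun y => ex (ω * y))
    (v := fun y => κ y * u y) (u' := fun y => Complex.I * ω * ex (ω * y))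
    (v' := fun y => SchwartzMap.derivCLM ℂ ℂ κ y * u y + κ y * u' y)
    (fun y _ => hasDerivAt_ex_mul ω y)
    (fun y _ => κ.differentiableAt.hasDerivAt.fun_mul (hd y))
    (integrable_ex_mul (i1.add i2) ω)
    (((integrable_ex_mul i3 ω).const_mul (Complex.I * ω)).congr
      (ae_of_all _ fun y => (mul_assoc _ _ _).symm)) (integrable_ex_mul i3 ω)
  rw [← osc1_add i1 i2]
  simp only [osc1]
  rw [this, neg_neg, ← integral_const_mul]
  congr 1; funext y; ring

lemma norm_D_le_growth (τ y : ℝ) : ‖D τ y‖ ≤ (|y| + 2) ^ 2 := by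
  nlinarith [norm_D_le τ y, abs_nonneg y]

lemma norm_Q_le_growth (τ ξ y : ℝ) : ‖Q τ ξ y‖ ≤ (|y| + 2) ^ 2 := by
  nlinarith [norm_Q_le τ ξ y, abs_nonneg y]

lemma brk_pow_le_of_abs_le (k : ℕ) {τ : ℝ} (hτ : |τ| ≤ 1) (ω : ℝ) :
    (brk (ω + τ) ^ k)⁻¹ ≤ 2 ^ k * (brk ω ^ k)⁻¹ := by
  rw [← inv_pow, ← inv_pow, ← mul_pow]
  have : (brk (ω + τ))⁻¹ ≤ 2 * (brk ω)⁻¹ := by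
    rw [← div_eq_mul_inv, inv_eq_one_div, div_le_div_iff₀ (brk_pos _) (brk_pos _)]
    unfold brk
    have := abs_sub_abs_le_abs_sub ω (-τ)
    rw [sub_neg_eq_add, abs_neg] at this
    nlinarith [abs_nonneg (ω + τ)]
  exact pow_le_pow_left₀ (inv_brk_pos _).le this k

lemma le_inv_brk_succ {a C₁ C₂ : ℝ} {k : ℕ} {ω : ℝ} (h1 : a ≤ C₁ * (brk ω ^ k)⁻¹)
    (h2 : |ω| * a ≤ C₂ * (brk ω ^ k)⁻¹) : a ≤ (C₁ + C₂) * (brk ω ^ (k + 1))⁻¹ := by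
  have hb := pow_pos (brk_pos ω) k
  rw [le_mul_inv_iff₀ hb] at h1 h2
  rw [le_mul_inv_iff₀ (pow_pos (brk_pos ω) _), pow_succ]
  unfold brk at *
  linarith

/-- Each integration by parts gains one power of ω. The derivative of `D` is a character of
frequency at most 1, which shifts ω harmlessly; the induction runs over all κ because κ is
differentiated too. -/
lemma exists_osc1_D_small (k : ℕ) : ∀ κ : 𝓢(ℝ, ℂ), ∃ C : ℝ, 0 ≤ C ∧ ∀ τ, |τ| ≤ 1 → ∀ ω,
    ‖osc1 (fun y => κ y * D τ y) ω‖ ≤ C * (brk ω ^ k)⁻¹ := by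
  induction k with
  | zero =>
    intro κ
    refine ⟨∫ y, (|y| + 2) ^ 2 * ‖κ y‖, integral_nonneg fun y => by positivity, fun τ _ ω => ?_⟩
    simpa using norm_osc1_growth_le (by fun_prop) (norm_D_le_growth τ) κ ω
  | succ k ih =>
    intro κ
    obtain ⟨C₁, hC₁, h₁⟩ := ih κ
    obtain ⟨C₂, hC₂, h₂⟩ := ih (SchwartzMap.derivCLM ℂ ℂ κ)
    obtain ⟨C₃, hC₃, h₃⟩ := exists_norm_osc1_le k κ
    refine ⟨C₁ + (C₂ + C₃ * 2 ^ k), by positivity, fun τ hτ ω => le_inv_brk_succ (h₁ τ hτ ω) ?_⟩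
    have e := congrArg norm (I_mul_osc1 (hasDerivAt_D τ) (by fun_prop) (norm_D_le_growth τ)
      (fun y => by rw [norm_ex]; nlinarith [abs_nonneg y]) κ ω)
    rw [osc1_ex_mul, norm_mul, norm_mul, Complex.norm_I, one_mul, Complex.norm_real,
      Real.norm_eq_abs, norm_neg] at e
    rw [e]
    refine (norm_add_le _ _).trans ?_
    rw [add_mul]
    refine add_le_add (h₂ τ hτ ω) ((h₃ _).trans ?_)
    rw [mul_assoc]
    exact mul_le_mul_of_nonneg_left (brk_pow_le_of_abs_le k hτ ω) hC₃

lemma exists_osc1_Q_small (k : ℕ) : ∀ κ : 𝓢(ℝ, ℂ), ∃ C : ℝ, 0 ≤ C ∧ ∀ τ ξ, |τ| ≤ 1 → |ξ| ≤ 1 →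
    ∀ ω, ‖osc1 (fun y => κ y * Q τ ξ y) ω‖ ≤ C * (brk ω ^ k)⁻¹ := by
  induction k with
  | zero =>
    intro κ
    refine ⟨∫ y, (|y| + 2) ^ 2 * ‖κ y‖, integral_nonneg fun y => by positivity,
      fun τ ξ _ _ ω => ?_⟩
    simpa using norm_osc1_growth_le (by fun_prop) (norm_Q_le_growth τ ξ) κ ω
  | succ k ih =>
    intro κ
    obtain ⟨C₁, hC₁, h₁⟩ := ih κ
    obtain ⟨C₂, hC₂, h₂⟩ := ih (SchwartzMap.derivCLM ℂ ℂ κ)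
    obtain ⟨C₃, hC₃, h₃⟩ := exists_osc1_D_small k κ
    refine ⟨C₁ + (C₂ + C₃ * 2 ^ k), by positivity,
      fun τ ξ hτ hξ ω => le_inv_brk_succ (h₁ τ ξ hτ hξ ω) ?_⟩
    have e := congrArg norm (I_mul_osc1 (hasDerivAt_Q τ ξ) (by fun_prop) (norm_Q_le_growth τ ξ)
      (fun y => by
        rw [norm_neg, norm_mul, norm_ex, one_mul, D_neg, norm_neg]
        exact norm_D_le_growth _ y) κ ω)
    have e1 : (fun y => κ y * -(ex (τ * y) * D ξ (-y))) =
        fun y => (κ y * D (-ξ) y) * ex (τ * y) := by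
      funext y; rw [D_neg]; ring
    rw [e1, osc1_ex_mul, norm_mul, norm_mul, Complex.norm_I, one_mul, Complex.norm_real,
      Real.norm_eq_abs, norm_neg] at e
    rw [e]
    refine (norm_add_le _ _).trans ?_
    rw [add_mul]
    refine add_le_add (h₂ τ ξ hτ hξ ω) ((h₃ (-ξ) (by rwa [abs_neg]) _).trans ?_)
    rw [mul_assoc]
    exact mul_le_mul_of_nonneg_left (brk_pow_le_of_abs_le k hτ ω) hC₃

/-- The size of the Fourier transform of a localised primitive of `e^{iτy}`. -/
def kr (ω τ : ℝ) : ℝ := (brk τ)⁻¹ * ((brk (ω + τ) ^ 4)⁻¹ + (brk ω ^ 4)⁻¹)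

lemma inv_brk_pow_pos (k : ℕ) (ω : ℝ) : 0 < (brk ω ^ k)⁻¹ := inv_pos.2 (pow_pos (brk_pos ω) k)

lemma kr_pos (ω τ : ℝ) : 0 < kr ω τ :=
  mul_pos (inv_brk_pos τ) (add_pos (inv_brk_pow_pos 4 _) (inv_brk_pow_pos 4 _))

lemma inv_brk_pow_le_kr {τ : ℝ} (hτ : |τ| ≤ 1) (ω : ℝ) : (brk ω ^ 4)⁻¹ ≤ 2 * kr ω τ := by
  have h1 := one_le_two_mul_inv_brk hτ
  have h2 := inv_brk_pow_pos 4 ω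
  have h3 := inv_brk_pow_pos 4 (ω + τ)
  unfold kr
  nlinarith [inv_brk_pos τ, mul_pos (inv_brk_pos τ) h3]

lemma le_of_abs_mul_le {a b S : ℝ} (ha : 1 ≤ |a|) (hS : 0 ≤ S) (h : |a| * b ≤ S) :
    b ≤ 2 * (brk a)⁻¹ * S := by
  have h1 : b ≤ |a|⁻¹ * S := by rwa [le_inv_mul_iff₀ (by linarith)]
  exact h1.trans (mul_le_mul_of_nonneg_right (inv_abs_le ha) hS)

/-- For |τ| ≥ 1 the primitive is (e^{iτy} - 1)/(iτ), so the transform is that of κ shifted by τ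
minus that of κ, divided by τ; this is the shape of `kr`. -/
lemma exists_osc1_D_le (κ : 𝓢(ℝ, ℂ)) : ∃ C : ℝ, 0 ≤ C ∧ ∀ τ ω,
    ‖osc1 (fun y => κ y * D τ y) ω‖ ≤ C * kr ω τ := by
  obtain ⟨C₁, hC₁, h₁⟩ := exists_osc1_D_small 4 κ
  obtain ⟨C₂, hC₂, h₂⟩ := exists_norm_osc1_le 4 κ
  refine ⟨2 * C₁ + 2 * C₂, by positivity, fun τ ω => ?_⟩
  have hk := (kr_pos ω τ).le
  rcases le_total |τ| 1 with hτ | hτ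
  · calc _ ≤ C₁ * (brk ω ^ 4)⁻¹ := h₁ τ hτ ω
      _ ≤ C₁ * (2 * kr ω τ) := mul_le_mul_of_nonneg_left (inv_brk_pow_le_kr hτ ω) hC₁
      _ ≤ _ := by nlinarith [mul_nonneg hC₂ hk]
  · have e : Complex.I * τ * osc1 (fun y => κ y * D τ y) ω = osc1 κ (ω + τ) - osc1 κ ω := by
      have e1 : (fun y => κ y * D τ y) = fun y => D τ y * κ y := by funext y; ring
      rw [← osc1_const_mul, ← osc1_ex_mul, osc1, osc1, osc1, ← integral_sub]
      · congr 1; funext y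
        have := I_mul_D τ y
        linear_combination (ex (ω * y) * κ y) * this
      · exact integrable_ex_mul (integrable_growth_schwartz (by fun_prop)
          (fun y => by rw [norm_ex]; nlinarith [abs_nonneg y]) κ) ω
      · exact integrable_ex_mul κ.integrable ω
    have e2 := congrArg norm e
    rw [norm_mul, norm_mul, Complex.norm_I, one_mul, Complex.norm_real, Real.norm_eq_abs] at e2
    have h3 : |τ| * ‖osc1 (fun y => κ y * D τ y) ω‖ ≤
        C₂ * ((brk (ω + τ) ^ 4)⁻¹ + (brk ω ^ 4)⁻¹) := by
      rw [e2, mul_add]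
      exact (norm_sub_le _ _).trans (add_le_add (h₂ _) (h₂ _))
    have hp := (add_pos (inv_brk_pow_pos 4 (ω + τ)) (inv_brk_pow_pos 4 ω)).le
    calc _ ≤ (2 * (brk τ)⁻¹) * (C₂ * ((brk (ω + τ) ^ 4)⁻¹ + (brk ω ^ 4)⁻¹)) :=
          le_of_abs_mul_le hτ (mul_nonneg hC₂ hp) h3
      _ = 2 * C₂ * kr ω τ := by unfold kr; ring
      _ ≤ _ := by nlinarith [mul_nonneg hC₁ hk]

lemma kr_shift_le {τ ξ : ℝ} (hξ : |ξ| ≤ 1) (ω : ℝ) :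
    kr (ω + τ) (-ξ) ≤ 17 * (brk (ω + τ) ^ 4)⁻¹ := by
  have h := brk_pow_le_of_abs_le 4 (τ := -ξ) (by rwa [abs_neg]) (ω + τ)
  have h1 : (brk (-ξ))⁻¹ ≤ 1 := inv_le_one_of_one_le₀ (one_le_brk _)
  have h0 := inv_brk_pow_pos 4 (ω + τ)
  unfold kr
  have := add_pos (inv_brk_pow_pos 4 (ω + τ + -ξ)) h0
  nlinarith [inv_brk_pos (-ξ)]

/-- If |ξ| ≥ 1, division by ξ reduces to primitives at τ and τ-ξ. If only |τ| ≥ 1, division by τ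
leaves a modulated primitive at the small frequency -ξ, which is concentrated near -τ in ω. If both
are small, rapid decay in ω suffices. -/
lemma exists_osc1_Q_le (κ : 𝓢(ℝ, ℂ)) : ∃ C : ℝ, 0 ≤ C ∧ ∀ τ ξ ω,
    ‖osc1 (fun y => κ y * Q τ ξ y) ω‖ ≤ C * ((brk ξ)⁻¹ * (kr ω τ + kr ω (τ - ξ))) := by
  obtain ⟨C₁, hC₁, h₁⟩ := exists_osc1_Q_small 4 κ
  obtain ⟨C₂, hC₂, h₂⟩ := exists_osc1_D_le κ
  have iD : ∀ τ, Integrable fun y => κ y * D τ y := fun τ =>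
    integrable_growth_schwartz (by fun_prop) (norm_D_le_growth τ) κ
  refine ⟨4 * C₁ + 100 * C₂, by positivity, fun τ ξ ω => ?_⟩
  have hk1 := (kr_pos ω τ).le
  have hk2 := (kr_pos ω (τ - ξ)).le
  have hb := (inv_brk_pos ξ).le
  have hR : 0 ≤ (brk ξ)⁻¹ * (kr ω τ + kr ω (τ - ξ)) := mul_nonneg hb (add_nonneg hk1 hk2)
  rcases le_total |ξ| 1 with hξ | hξ
  · have hξ2 := one_le_two_mul_inv_brk hξ
    rcases le_total |τ| 1 with hτ | hτ
    · calc _ ≤ C₁ * (brk ω ^ 4)⁻¹ := h₁ τ ξ hτ hξ ω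
        _ ≤ C₁ * (2 * kr ω τ) := mul_le_mul_of_nonneg_left (inv_brk_pow_le_kr hτ ω) hC₁
        _ ≤ C₁ * (4 * ((brk ξ)⁻¹ * (kr ω τ + kr ω (τ - ξ)))) := by
            refine mul_le_mul_of_nonneg_left ?_ hC₁
            nlinarith [mul_nonneg hb hk2]
        _ ≤ _ := by nlinarith [mul_nonneg hC₂ hR]
    · have e : Complex.I * τ * osc1 (fun y => κ y * Q τ ξ y) ω =
          osc1 (fun y => κ y * D (-ξ) y) (ω + τ) - osc1 (fun y => κ y * D (τ - ξ) y) ω := by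
        rw [← osc1_const_mul, ← osc1_ex_mul, osc1, osc1, osc1, ← integral_sub]
        · congr 1; funext y
          have := I_mul_Q_left τ ξ y
          rw [D_neg] at this
          linear_combination (ex (ω * y) * κ y) * this
        · refine integrable_ex_mul ?_ ω
          refine ((integrable_ex_mul (iD (-ξ)) τ)).congr (ae_of_all _ fun y => mul_comm _ _)
        · exact integrable_ex_mul (iD _) ω
      have e2 := congrArg norm e
      rw [norm_mul, norm_mul, Complex.norm_I, one_mul, Complex.norm_real, Real.norm_eq_abs] at e2
      have hp := (inv_brk_pow_pos 4 (ω + τ)).le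
      have h3 : |τ| * ‖osc1 (fun y => κ y * Q τ ξ y) ω‖ ≤
          C₂ * (17 * (brk (ω + τ) ^ 4)⁻¹ + kr ω (τ - ξ)) := by
        rw [e2, mul_add]
        refine (norm_sub_le _ _).trans (add_le_add ((h₂ _ _).trans ?_) (h₂ _ _))
        exact mul_le_mul_of_nonneg_left (kr_shift_le hξ ω) hC₂
      have h4 := le_of_abs_mul_le hτ (mul_nonneg hC₂ (by positivity)) h3
      have h5 : (brk τ)⁻¹ * (17 * (brk (ω + τ) ^ 4)⁻¹ + kr ω (τ - ξ)) ≤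
          17 * (kr ω τ + kr ω (τ - ξ)) := by
        have h6 : (brk τ)⁻¹ ≤ 1 := inv_le_one_of_one_le₀ (one_le_brk _)
        have h7 : (brk τ)⁻¹ * (brk (ω + τ) ^ 4)⁻¹ ≤ kr ω τ := by
          unfold kr
          exact mul_le_mul_of_nonneg_left (by linarith [inv_brk_pow_pos 4 ω]) (inv_brk_pos τ).le
        nlinarith
      calc _ ≤ _ := h4
        _ = 2 * C₂ * ((brk τ)⁻¹ * (17 * (brk (ω + τ) ^ 4)⁻¹ + kr ω (τ - ξ))) := by ring
        _ ≤ 2 * C₂ * (17 * (kr ω τ + kr ω (τ - ξ))) :=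
            mul_le_mul_of_nonneg_left h5 (by positivity)
        _ ≤ 2 * C₂ * (17 * (2 * ((brk ξ)⁻¹ * (kr ω τ + kr ω (τ - ξ))))) := by
            refine mul_le_mul_of_nonneg_left ?_ (by positivity)
            nlinarith
        _ ≤ _ := by nlinarith [mul_nonneg hC₂ hR, mul_nonneg hC₁ hR]
  · have e : Complex.I * ξ * osc1 (fun y => κ y * Q τ ξ y) ω =
        osc1 (fun y => κ y * D τ y) ω - osc1 (fun y => κ y * D (τ - ξ) y) ω := by
      rw [← osc1_const_mul, osc1, osc1, osc1, ← integral_sub]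
      · congr 1; funext y
        linear_combination (ex (ω * y) * κ y) * I_mul_Q_right τ ξ y
      · exact integrable_ex_mul (iD _) ω
      · exact integrable_ex_mul (iD _) ω
    have e2 := congrArg norm e
    rw [norm_mul, norm_mul, Complex.norm_I, one_mul, Complex.norm_real, Real.norm_eq_abs] at e2
    have h3 : |ξ| * ‖osc1 (fun y => κ y * Q τ ξ y) ω‖ ≤ C₂ * (kr ω τ + kr ω (τ - ξ)) := by
      rw [e2, mul_add]
      exact (norm_sub_le _ _).trans (add_le_add (h₂ _ _) (h₂ _ _))
    calc _ ≤ _ := le_of_abs_mul_le hξ (mul_nonneg hC₂ (by positivity)) h3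
      _ = 2 * C₂ * ((brk ξ)⁻¹ * (kr ω τ + kr ω (τ - ξ))) := by ring
      _ ≤ _ := by nlinarith [mul_nonneg hC₂ hR, mul_nonneg hC₁ hR]

/-! ### Sobolev bounds for the localised solution -/

/-- The Fourier transform in `p` of `κ₁(α) κ₂(β)` times the kernel `Ek (ζ 0) (ζ 1)`. -/
def locE (κ₁ κ₂ : 𝓢(ℝ, ℂ)) (z ζ : Plane) : ℂ :=
  ∫ p : Plane, (ex (-(p 0 * z 0 + p 1 * z 1)) * tensorCLM κ₂ κ₁ p) * Ek (ζ 0) (ζ 1) (p 0) (p 1)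

lemma locE_eq (κ₁ κ₂ : 𝓢(ℝ, ℂ)) (z ζ : Plane) : locE κ₁ κ₂ z ζ =
    osc1 (fun y => κ₁ y * D (ζ 0) y) (-z 0) * osc1 (fun y => κ₂ y * D (ζ 1) y) (-z 1) +
      osc1 (fun y => κ₁ y * Q (ζ 0) (ζ 1) y) (-z 0) * osc1 κ₂ (-z 1) +
      osc1 κ₁ (-z 0) * osc1 (fun y => κ₂ y * Q (ζ 1) (ζ 0) y) (-z 1) := by
  have iD : ∀ (κ : 𝓢(ℝ, ℂ)) τ ω, Integrable fun y => ex (ω * y) * (κ y * D τ y) := fun κ τ ω =>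
    integrable_ex_mul (integrable_growth_schwartz (by fun_prop) (norm_D_le_growth τ) κ) ω
  have iQ : ∀ (κ : 𝓢(ℝ, ℂ)) τ ξ ω, Integrable fun y => ex (ω * y) * (κ y * Q τ ξ y) :=
    fun κ τ ξ ω =>
      integrable_ex_mul (integrable_growth_schwartz (by fun_prop) (norm_Q_le_growth τ ξ) κ) ω
  have i1 : ∀ (κ : 𝓢(ℝ, ℂ)) ω, Integrable fun y => ex (ω * y) * κ y := fun κ ω =>
    integrable_ex_mul κ.integrable ω
  have e : ∀ q : ℝ × ℝ, (ex (-(q.1 * z 0 + q.2 * z 1)) * (κ₁ q.1 * κ₂ q.2)) *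
      Ek (ζ 0) (ζ 1) q.1 q.2 =
      (ex (-z 0 * q.1) * (κ₁ q.1 * D (ζ 0) q.1)) * (ex (-z 1 * q.2) * (κ₂ q.2 * D (ζ 1) q.2)) +
      (ex (-z 0 * q.1) * (κ₁ q.1 * Q (ζ 0) (ζ 1) q.1)) * (ex (-z 1 * q.2) * κ₂ q.2) +
      (ex (-z 0 * q.1) * κ₁ q.1) * (ex (-z 1 * q.2) * (κ₂ q.2 * Q (ζ 1) (ζ 0) q.2)) := fun q => by
    rw [show -(q.1 * z 0 + q.2 * z 1) = -z 0 * q.1 + -z 1 * q.2 by ring, ex_add, Ek]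
    ring
  rw [locE, integral_plane]
  simp only [tensorCLM_apply, Matrix.cons_val_zero, Matrix.cons_val_one, e]
  rw [Measure.volume_eq_prod, integral_add (((iD _ _ _).mul_prod (iD _ _ _)).fun_add
    ((iQ _ _ _ _).mul_prod (i1 _ _))) ((i1 _ _).mul_prod (iQ _ _ _ _)),
    integral_add ((iD _ _ _).mul_prod (iD _ _ _)) ((iQ _ _ _ _).mul_prod (i1 _ _)),
    integral_prod_mul (fun y => ex (-z 0 * y) * (κ₁ y * D (ζ 0) y))
      (fun y => ex (-z 1 * y) * (κ₂ y * D (ζ 1) y)),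
    integral_prod_mul (fun y => ex (-z 0 * y) * (κ₁ y * Q (ζ 0) (ζ 1) y))
      (fun y => ex (-z 1 * y) * κ₂ y),
    integral_prod_mul (fun y => ex (-z 0 * y) * κ₁ y)
      (fun y => ex (-z 1 * y) * (κ₂ y * Q (ζ 1) (ζ 0) y))]
  rfl

/-- The sum of the three kernels. -/
def kerSum (z ζ : Plane) : ℝ≥0∞ := kerProd z ζ + kerα z ζ + kerβ z ζ

lemma bw_neg_four (x : ℝ) : bw (-4) x = ENNReal.ofReal (brk x ^ 4)⁻¹ := by
  rw [bw, Real.rpow_neg (brk_pos x).le, show (4 : ℝ) = (4 : ℕ) by norm_num, Real.rpow_natCast]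

lemma ofReal_kr (z τ : ℝ) : ENNReal.ofReal (kr (-z) τ) = k0 z τ := by
  rw [kr, k0, ENNReal.ofReal_mul (inv_brk_pos τ).le, ofReal_inv_brk,
    ENNReal.ofReal_add (inv_brk_pow_pos 4 _).le (inv_brk_pow_pos 4 _).le, bw_neg_four, bw_neg_four,
    brk_neg, show -z + τ = -(z - τ) by ring, brk_neg]

/-- `Ek` is a sum of three products in α and β, so its localised transform factorises. D·D gives the
product kernel. Each `Q` gives a part at frequency τ or ξ, absorbed into the product kernel, and a
part at the difference frequency. -/
lemma exists_enorm_locE_le (κ₁ κ₂ : 𝓢(ℝ, ℂ)) : ∃ C : ℝ, ∀ z ζ,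
    ‖locE κ₁ κ₂ z ζ‖ₑ ≤ ENNReal.ofReal C * kerSum z ζ := by
  obtain ⟨A₁, hA₁, a₁⟩ := exists_osc1_D_le κ₁
  obtain ⟨A₂, hA₂, a₂⟩ := exists_osc1_D_le κ₂
  obtain ⟨B₁, hB₁, b₁⟩ := exists_osc1_Q_le κ₁
  obtain ⟨B₂, hB₂, b₂⟩ := exists_osc1_Q_le κ₂
  obtain ⟨C₁, hC₁, c₁⟩ := exists_norm_osc1_le 4 κ₁
  obtain ⟨C₂, hC₂, c₂⟩ := exists_norm_osc1_le 4 κ₂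
  refine ⟨A₁ * A₂ + B₁ * C₂ + C₁ * B₂, fun z ζ => ?_⟩
  set x := kr (-z 0) (ζ 0) with hx
  set y := kr (-z 1) (ζ 1) with hy
  set u := kr (-z 0) (ζ 0 - ζ 1) with hu
  set v := kr (-z 1) (ζ 1 - ζ 0) with hv
  have hx0 : 0 < x := kr_pos _ _
  have hy0 : 0 < y := kr_pos _ _
  have hu0 : 0 < u := kr_pos _ _
  have hv0 : 0 < v := kr_pos _ _
  have p0 := inv_brk_pow_pos 4 (z 0)
  have p1 := inv_brk_pow_pos 4 (z 1)
  have q0 := inv_brk_pos (ζ 0)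
  have q1 := inv_brk_pos (ζ 1)
  -- The factor ⟨b⟩⁻¹ from `Q` and the transform of the bare cut-off together form the part of `kr`
  -- near frequency zero.
  have hle : ∀ a b : ℝ, (brk b)⁻¹ * (brk a ^ 4)⁻¹ ≤ kr (-a) b := fun a b => by
    unfold kr
    rw [brk_neg a]
    exact mul_le_mul_of_nonneg_left (by linarith [inv_brk_pow_pos 4 (-a + b)]) (inv_brk_pos b).le
  have e : kerSum z ζ = ENNReal.ofReal (x * y + (brk (ζ 1))⁻¹ * u * (brk (z 1) ^ 4)⁻¹ +
      (brk (ζ 0))⁻¹ * v * (brk (z 0) ^ 4)⁻¹) := by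
    rw [ENNReal.ofReal_add (by positivity) (by positivity), ENNReal.ofReal_add (by positivity)
      (by positivity), ENNReal.ofReal_mul hx0.le, ENNReal.ofReal_mul (by positivity),
      ENNReal.ofReal_mul q1.le, ENNReal.ofReal_mul (by positivity), ENNReal.ofReal_mul q0.le,
      hx, hy, hu, hv, ofReal_kr, ofReal_kr, ofReal_kr, ofReal_kr, ofReal_inv_brk, ofReal_inv_brk,
      ← bw_neg_four, ← bw_neg_four]
    rfl
  rw [e, ← ENNReal.ofReal_mul (by positivity), ← ofReal_norm]
  refine ENNReal.ofReal_le_ofReal ?_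
  have t1 : ‖osc1 (fun y => κ₁ y * D (ζ 0) y) (-z 0) * osc1 (fun y => κ₂ y * D (ζ 1) y) (-z 1)‖ ≤
      A₁ * A₂ * (x * y) := by
    rw [norm_mul]
    calc _ ≤ (A₁ * x) * (A₂ * y) := mul_le_mul (a₁ _ _) (a₂ _ _) (norm_nonneg _) (by positivity)
      _ = _ := by ring
  have t2 : ‖osc1 (fun y => κ₁ y * Q (ζ 0) (ζ 1) y) (-z 0) * osc1 κ₂ (-z 1)‖ ≤
      B₁ * C₂ * (x * y + (brk (ζ 1))⁻¹ * u * (brk (z 1) ^ 4)⁻¹) := by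
    rw [norm_mul]
    have c := c₂ (-z 1)
    rw [brk_neg] at c
    calc _ ≤ (B₁ * ((brk (ζ 1))⁻¹ * (x + u))) * (C₂ * (brk (z 1) ^ 4)⁻¹) :=
          mul_le_mul (b₁ _ _ _) c (norm_nonneg _) (by positivity)
      _ = B₁ * C₂ * (x * ((brk (ζ 1))⁻¹ * (brk (z 1) ^ 4)⁻¹) +
          (brk (ζ 1))⁻¹ * u * (brk (z 1) ^ 4)⁻¹) := by ring
      _ ≤ _ := by
          have := hle (z 1) (ζ 1)
          gcongr
  have t3 : ‖osc1 κ₁ (-z 0) * osc1 (fun y => κ₂ y * Q (ζ 1) (ζ 0) y) (-z 1)‖ ≤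
      C₁ * B₂ * (x * y + (brk (ζ 0))⁻¹ * v * (brk (z 0) ^ 4)⁻¹) := by
    rw [norm_mul]
    have c := c₁ (-z 0)
    rw [brk_neg] at c
    calc _ ≤ (C₁ * (brk (z 0) ^ 4)⁻¹) * (B₂ * ((brk (ζ 0))⁻¹ * (y + v))) :=
          mul_le_mul c (b₂ _ _ _) (norm_nonneg _) (by positivity)
      _ = C₁ * B₂ * (((brk (ζ 0))⁻¹ * (brk (z 0) ^ 4)⁻¹) * y +
          (brk (ζ 0))⁻¹ * v * (brk (z 0) ^ 4)⁻¹) := by ring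
      _ ≤ _ := by
          have := hle (z 0) (ζ 0)
          gcongr
  rw [locE_eq]
  refine (norm_add₃_le).trans ((add_le_add (add_le_add t1 t2) t3).trans ?_)
  have h2 : 0 < (brk (ζ 1))⁻¹ * u * (brk (z 1) ^ 4)⁻¹ := by positivity
  have h3 : 0 < (brk (ζ 0))⁻¹ * v * (brk (z 0) ^ 4)⁻¹ := by positivity
  set P := x * y
  set R := (brk (ζ 1))⁻¹ * u * (brk (z 1) ^ 4)⁻¹
  set S := (brk (ζ 0))⁻¹ * v * (brk (z 0) ^ 4)⁻¹
  have : 0 ≤ A₁ * A₂ * (R + S) + B₁ * C₂ * S + C₁ * B₂ * R := by positivity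
  linarith

lemma KerBdd.add {K L : Plane → Plane → ℝ≥0∞} {a b a' b' : ℝ} (hK : KerBdd K a b a' b')
    (hL : KerBdd L a b a' b') (hm : Measurable (Function.uncurry K)) :
    KerBdd (fun x y => K x y + L x y) a b a' b' := by
  obtain ⟨A, hA, h₁⟩ := hK
  obtain ⟨B, hB, h₂⟩ := hL
  refine ⟨4 * (A + B), by finiteness, fun h hh => ?_⟩
  have hsq : ∀ u v : ℝ≥0∞, (u + v) ^ 2 ≤ 4 * (u ^ 2 + v ^ 2) := fun u v => by
    have h3 : u + v ≤ 2 * max u v := by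
      rw [two_mul]; exact add_le_add (le_max_left _ _) (le_max_right _ _)
    calc (u + v) ^ 2 ≤ (2 * max u v) ^ 2 := by gcongr
      _ = 4 * (max u v) ^ 2 := by ring
      _ ≤ _ := by
        gcongr
        rcases le_total u v with h | h
        · rw [max_eq_right h]; exact le_add_self
        · rw [max_eq_left h]; exact le_self_add
  have hKx : ∀ x, Measurable (K x) := fun x => hm.comp measurable_prodMk_left
  have hmK : AEMeasurable fun x => ∫⁻ y, K x y * h y := by
    have h1 : AEMeasurable (Function.uncurry fun x y => K x y * h y)
        ((volume : Measure Plane).prod volume) :=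
      hm.aemeasurable.mul (hh.comp_quasiMeasurePreserving Measure.quasiMeasurePreserving_snd)
    exact h1.lintegral_prod_right'
  calc _ ≤ ∫⁻ x, 4 * (pw a b x * (∫⁻ y, K x y * h y) ^ 2) +
        4 * (pw a b x * (∫⁻ y, L x y * h y) ^ 2) := by
        refine lintegral_mono fun x => ?_
        simp only [add_mul]
        rw [lintegral_add_left' ((hKx x).aemeasurable.fun_mul hh)]
        calc _ ≤ pw a b x * (4 * ((∫⁻ y, K x y * h y) ^ 2 + (∫⁻ y, L x y * h y) ^ 2)) := by
              gcongr; exact hsq _ _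
          _ = _ := by ring
    _ = 4 * (∫⁻ x, pw a b x * (∫⁻ y, K x y * h y) ^ 2) +
        4 * ∫⁻ x, pw a b x * (∫⁻ y, L x y * h y) ^ 2 := by
        rw [lintegral_add_left' (((measurable_pw a b).aemeasurable.fun_mul (hmK.pow_const 2)).const_mul 4),
          lintegral_const_mul' _ _ (by simp), lintegral_const_mul' _ _ (by simp)]
    _ ≤ 4 * (A * ∫⁻ y, pw a' b' y * h y ^ 2) + 4 * (B * ∫⁻ y, pw a' b' y * h y ^ 2) := by
        gcongr
        · exact h₁ h hh
        · exact h₂ h hh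
    _ = _ := by ring

lemma kerBdd_kerSum {r₁ r₂ : ℝ} (h1 : 1 / 2 < r₁) (h1' : r₁ < 1) (h2 : 1 / 2 < r₂)
    (h2' : r₂ < 1) (h : 3 / 2 < r₁ + r₂) : KerBdd kerSum r₁ r₂ (r₁ - 1) (r₂ - 1) :=
  ((kerBdd_kerProd h1 h1' h2 h2').add (kerBdd_kerα h1 h1' h le_rfl (by linarith))
    measurable_kerProd).add (kerBdd_kerβ h2 h2' h le_rfl (by linarith))
    (measurable_kerProd.add measurable_kerα)

/-! ### The Fourier density of the localised solution and its norm. -/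

lemma isFourierDensity_of_integrable {u : 𝓢'(Plane, Vec n)} {w : Plane → Vec n} (hw : Integrable w)
    (hu : ∀ θ : 𝓢(Plane, ℂ), u θ = ∫ p, θ p • w p) :
    IsFourierDensity u fun z => ∫ p : Plane, ex (-(p 0 * z 0 + p 1 * z 1)) • w p := by
  intro θ
  have hc : Continuous fun p : Plane × Plane => innerₗ Plane p.1 p.2 := continuous_inner
  have e : ∀ ζ : Plane, (∫ p : Plane, ex (-(p 0 * ((2 * Real.pi) • ζ) 0 +
      p 1 * ((2 * Real.pi) • ζ) 1)) • w p) =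
      VectorFourier.fourierIntegral Real.fourierChar volume (innerₗ Plane) w ζ := fun ζ => by
    rw [VectorFourier.fourierIntegral]
    congr 1; funext p
    rw [Circle.smul_def, Real.fourierChar_apply, ex, innerₗ_apply_apply, inner_plane]
    congr 2
    simp; ring
  simp only [e]
  constructor
  · refine ((θ.integrable (μ := volume)).norm.mul_const (∫ p, ‖w p‖)).mono'
      (θ.continuous.aestronglyMeasurable.smul (VectorFourier.fourierIntegral_continuous
        Real.continuous_fourierChar hc hw).aestronglyMeasurable) (ae_of_all _ fun ζ => ?_)
    rw [norm_smul]
    exact mul_le_mul_of_nonneg_left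
      (VectorFourier.norm_fourierIntegral_le_integral_norm _ _ _ _ _) (norm_nonneg _)
  · rw [TemperedDistribution.fourier_apply, hu]
    have := VectorFourier.integral_fourierIntegral_smul_eq_flip (L := innerₗ Plane) (μ := volume)
      (ν := volume) Real.continuous_fourierChar hc (θ.integrable (μ := volume)) hw
    rw [flip_innerₗ] at this
    rw [← this]
    rfl

lemma isFourierDensity_localized {g : Plane → Vec n} (hg : WtIntegrable g) {U : 𝓢'(Plane, Vec n)}
    (hU : IsGivenBy U (rep g)) (κ₁ κ₂ : 𝓢(ℝ, ℂ)) :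
    IsFourierDensity (TemperedDistribution.smulLeftCLM (Vec n) (tensorCLM κ₂ κ₁) U)
      fun z => cF • ∫ ζ, locE κ₁ κ₂ z ζ • g ζ := by
  set κ := tensorCLM κ₂ κ₁
  have h := isFourierDensity_of_integrable
    (u := TemperedDistribution.smulLeftCLM (Vec n) κ U) (hU κ).1 fun θ => by
      rw [TemperedDistribution.smulLeftCLM_apply_apply, (hU _).2]
      congr 1; funext p
      rw [SchwartzMap.smulLeftCLM_apply_apply κ.hasTemperateGrowth, smul_eq_mul, mul_comm, mul_smul]
  convert h using 2 with z
  have h := (integral_integral_smul_swap (μ := volume) (ν := volume)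
    (k := fun (p ζ : Plane) => (ex (-(p 0 * z 0 + p 1 * z 1)) * κ p) * Ek (ζ 0) (ζ 1) (p 0) (p 1))
    (G := g) (w := fun p : Plane => 5 * ((|p 0| + 2) ^ 2 * (|p 1| + 2) ^ 2) * ‖κ p‖) (v := wt)
    (by have := κ.continuous; unfold Function.uncurry; fun_prop) hg.meas (fun p ζ => ?_)
    (integrable_growth_mul κ) hg.integrable).2
  · refine (congrArg (cF • ·) h.symm).trans ?_
    simp only [rep, mul_smul, integral_smul]
    rw [← integral_smul]
    simp only [smul_comm cF]
  · rw [norm_mul, norm_mul, norm_ex, one_mul]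
    calc _ ≤ ‖κ p‖ * (5 * ((|p 0| + 2) ^ 2 * (|p 1| + 2) ^ 2) * wt ζ) :=
          mul_le_mul_of_nonneg_left (norm_Ek_le ζ _ _) (norm_nonneg _)
      _ = _ := by ring

/-- The density of the localised solution is dominated by the positive operator `kerSum` applied to
|g|, so the kernel bound transfers to the norms; its constant involves only the cut-offs and the
exponents. -/
lemma exists_localized_bound (n : ℕ) (κ₁ κ₂ : 𝓢(ℝ, ℂ)) {r₁ r₂ : ℝ} (h1 : 1 / 2 < r₁) (h1' : r₁ < 1)
    (h2 : 1 / 2 < r₂) (h2' : r₂ < 1) (h : 3 / 2 < r₁ + r₂) : ∃ A : ℝ≥0∞, A ≠ ∞ ∧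
      ∀ (f U : 𝓢'(Plane, Vec n)) (g : Plane → Vec n), IsFourierDensity f g → WtIntegrable g →
        IsGivenBy U (rep g) →
        prodSobolevSq r₁ r₂ (TemperedDistribution.smulLeftCLM (Vec n) (tensorCLM κ₂ κ₁) U) ≤
          A * prodSobolevSq (r₁ - 1) (r₂ - 1) f := by
  obtain ⟨C, hC⟩ := exists_enorm_locE_le κ₁ κ₂
  obtain ⟨A, hA, hker⟩ := kerBdd_kerSum h1 h1' h2 h2' h
  refine ⟨(‖cF‖ₑ * ENNReal.ofReal C) ^ 2 * A, by finiteness, fun f U g hf hg hU => ?_⟩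
  refine (prodSobolevSq_le_lintegral_pw (by linarith) (by linarith)
    (isFourierDensity_localized hg hU κ₁ κ₂)).trans ?_
  have hz : ∀ z, ‖cF • ∫ ζ, locE κ₁ κ₂ z ζ • g ζ‖ₑ ≤
      ‖cF‖ₑ * ENNReal.ofReal C * ∫⁻ ζ, kerSum z ζ * ‖g ζ‖ₑ := fun z => by
    rw [enorm_smul, mul_assoc]
    gcongr
    refine (enorm_integral_le_lintegral_enorm _).trans ?_
    rw [← lintegral_const_mul' _ _ ENNReal.ofReal_ne_top]
    refine lintegral_mono fun ζ => ?_
    rw [enorm_smul, ← mul_assoc]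
    gcongr
    exact hC z ζ
  calc _ ≤ ∫⁻ z, (‖cF‖ₑ * ENNReal.ofReal C) ^ 2 *
        (pw r₁ r₂ z * (∫⁻ ζ, kerSum z ζ * ‖g ζ‖ₑ) ^ 2) := by
        refine lintegral_mono fun z => ?_
        calc _ ≤ pw r₁ r₂ z * (‖cF‖ₑ * ENNReal.ofReal C * ∫⁻ ζ, kerSum z ζ * ‖g ζ‖ₑ) ^ 2 := by
              gcongr; exact hz z
          _ = _ := by ring
    _ = (‖cF‖ₑ * ENNReal.ofReal C) ^ 2 *
        ∫⁻ z, pw r₁ r₂ z * (∫⁻ ζ, kerSum z ζ * ‖g ζ‖ₑ) ^ 2 :=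
        lintegral_const_mul' _ _ (by finiteness)
    _ ≤ (‖cF‖ₑ * ENNReal.ofReal C) ^ 2 * (A * prodSobolevSq (r₁ - 1) (r₂ - 1) f) := by
        gcongr
        refine (hker _ hg.meas.enorm).trans ?_
        gcongr
        exact lintegral_pw_le_prodSobolevSq (by linarith) (by linarith) hf
    _ = _ := by ring

lemma IsCutoff.exists_schwartz {η : ℝ → ℝ} (hη : IsCutoff η) {T : ℝ} (hT : 0 < T) :
    ∃ κ : 𝓢(ℝ, ℂ), ∀ x, κ x = (η (x / T) : ℂ) := by
  have hs : HasCompactSupport fun x => (η (x / T) : ℂ) := by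
    refine HasCompactSupport.intro (isCompact_Icc (a := -(4 * T)) (b := 4 * T)) fun x hx => ?_
    have : x / T ∉ tsupport η := fun h => hx (by
      have := hη.tsupport_subset h
      rw [Set.mem_Icc, le_div_iff₀ hT, div_le_iff₀ hT] at this
      exact ⟨by linarith [this.1], this.2⟩)
    rw [image_eq_zero_of_notMem_tsupport this, Complex.ofReal_zero]
  exact ⟨hs.toSchwartzMap (Complex.ofRealCLM.contDiff.comp (hη.smooth.comp (by fun_prop))),
    fun x => rfl⟩

/-- The two summands of the norm are the preceding bound for (s, δ) and for (δ, s). Both exponents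
lie in (3/4, 1), so their sum exceeds 3/2. -/
lemma exists_hypNorm_localize_le (n : ℕ) {s δ : ℝ} (hδ : 3 / 4 < δ) (hδs : δ ≤ s) (hs : s < 1)
    {η χ : ℝ → ℝ} (hη : IsCutoff η) (hχ : IsCutoff χ) {T : ℝ} (hT : 0 < T) : ∃ C : ℝ, 0 < C ∧
      ∀ (f U : 𝓢'(Plane, Vec n)) (g : Plane → Vec n), IsFourierDensity f g → WtIntegrable g →
        IsGivenBy U (rep g) →
        hypNorm s δ (localize η χ T U) ≤ ENNReal.ofReal C * hypNorm (s - 1) (δ - 1) f := by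
  obtain ⟨κ₁, hκ₁⟩ := hη.exists_schwartz hT
  obtain ⟨κ₂, hκ₂⟩ := hχ.exists_schwartz hT
  obtain ⟨A, hA, h₁⟩ := exists_localized_bound n κ₁ κ₂ (r₁ := s) (r₂ := δ) (by linarith) hs
    (by linarith) (by linarith) (by linarith)
  obtain ⟨B, hB, h₂⟩ := exists_localized_bound n κ₁ κ₂ (r₁ := δ) (r₂ := s) (by linarith)
    (by linarith) (by linarith) hs (by linarith)
  set S := (A + B) ^ (1 / 2 : ℝ) with hS
  have hSt : S ≠ ∞ := ENNReal.rpow_ne_top_of_nonneg (by norm_num) (ENNReal.add_ne_top.2 ⟨hA, hB⟩)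
  -- The added 1 makes the constant positive even if S is zero.
  refine ⟨S.toReal + 1, by positivity, fun f U g hf hg hU => ?_⟩
  have hloc : localize η χ T U =
      TemperedDistribution.smulLeftCLM (Vec n) (tensorCLM κ₂ κ₁) U := by
    rw [localize]
    congr 2
    funext p
    simp [hκ₁, hκ₂]
  have hle : S ≤ ENNReal.ofReal (S.toReal + 1) := by
    conv_lhs => rw [← ENNReal.ofReal_toReal hSt]
    exact ENNReal.ofReal_le_ofReal (by linarith)
  refine le_trans ?_ (mul_le_mul_left hle _)
  rw [hypNorm, hypNorm, hS, ← ENNReal.mul_rpow_of_nonneg _ _ (by norm_num), hloc]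
  refine ENNReal.rpow_le_rpow ?_ (by norm_num)
  refine (add_le_add (h₁ f U g hf hg hU) (h₂ f U g hf hg hU)).trans ?_
  rw [add_mul, mul_add, mul_add]
  exact add_le_add le_self_add le_add_self

end NullWave

end

/-! ### Assembly. -/

theorem proposition4p1 (n : ℕ) (s δ : ℝ) (hδ : 3 / 4 < δ) (hδs : δ ≤ s) (hs : s < 1) :
    ∃ C : (ℝ → ℝ) → (ℝ → ℝ) → ℝ → ℝ,
      (∀ (η χ : ℝ → ℝ) (T : ℝ),
        NullWave.IsCutoff η → NullWave.IsCutoff χ → 0 < T → 0 < C η χ T) ∧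
      ∀ φ : ℕ → 𝓢(ℝ, ℂ), NullWave.IsDyadicPartition φ →
      ∀ f : 𝓢'(NullWave.Plane, NullWave.Vec n), NullWave.MemHyp (s - 1) (δ - 1) f →
        NullWave.FormulaWellDefined φ f ∧
        Continuous (fun p : ℝ × ℝ => NullWave.pathwiseIntegral φ f p.1 p.2) ∧
        (NullWave.IsRealDistribution f →
          ∀ α β i, (NullWave.pathwiseIntegral φ f α β i).im = 0) ∧
        (∀ α : ℝ, NullWave.pathwiseIntegral φ f α (-α) = 0) ∧
        ∃ U : 𝓢'(NullWave.Plane, NullWave.Vec n),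
          NullWave.IsGivenBy U (NullWave.pathwiseIntegral φ f) ∧
          NullWave.IsHomogeneousSolution f U ∧
          (∀ U' : 𝓢'(NullWave.Plane, NullWave.Vec n),
            NullWave.IsHomogeneousSolution f U' → U' = U) ∧
          ∀ (η χ : ℝ → ℝ) (T : ℝ),
            NullWave.IsCutoff η → NullWave.IsCutoff χ → 0 < T →
            NullWave.hypNorm s δ (NullWave.localize η χ T U) ≤
              ENNReal.ofReal (C η χ T) * NullWave.hypNorm (s - 1) (δ - 1) f := by
  have hC : ∀ (η χ : ℝ → ℝ) (T : ℝ), ∃ C : ℝ,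
      NullWave.IsCutoff η → NullWave.IsCutoff χ → 0 < T → 0 < C ∧
      ∀ (f U : 𝓢'(NullWave.Plane, NullWave.Vec n)) (g : NullWave.Plane → NullWave.Vec n),
        NullWave.IsFourierDensity f g → NullWave.WtIntegrable g →
        NullWave.IsGivenBy U (NullWave.rep g) →
        NullWave.hypNorm s δ (NullWave.localize η χ T U) ≤
          ENNReal.ofReal C * NullWave.hypNorm (s - 1) (δ - 1) f := fun η χ T => by
    -- The constant is fixed before φ and f appear, so it is independent of both; outside the
    -- admissible triples any value will do.
    by_cases h : NullWave.IsCutoff η ∧ NullWave.IsCutoff χ ∧ 0 < T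
    · obtain ⟨C, hC⟩ := NullWave.exists_hypNorm_localize_le n hδ hδs hs h.1 h.2.1 h.2.2
      exact ⟨C, fun _ _ _ => hC⟩
    · exact ⟨0, fun h1 h2 h3 => (h ⟨h1, h2, h3⟩).elim⟩
  choose C hC using hC
  refine ⟨C, fun η χ T h1 h2 h3 => (hC η χ T h1 h2 h3).1, fun φ hφ f hf => ?_⟩
  obtain ⟨hf1, -⟩ := NullWave.memHyp_iff.1 hf
  have hd := NullWave.isFourierDensity_fourierDensity hf1
  have hg : NullWave.WtIntegrable (NullWave.fourierDensity f) :=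
    hd.wtIntegrable (by linarith) hs.le (by linarith) (by linarith) (by linarith) hf1
  have hF : NullWave.pathwiseIntegral φ f = NullWave.rep (NullWave.fourierDensity f) :=
    funext fun α => funext fun β => NullWave.pathwiseIntegral_eq hφ hg α β
  obtain ⟨U, hU, hUθ⟩ := hg.exists_solution
  have hsol := hg.isHomogeneousSolution hd hUθ
  rw [hF]
  exact ⟨NullWave.formulaWellDefined hφ hg, hg.continuous_rep,
    fun hr α β i => NullWave.rep_im_eq_zero hg (hd.conj_neg hr) α β i,
    fun α => NullWave.rep_antidiag _ α, U, hU, hsol, fun U' hU' => hsol.unique hU',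
    fun η χ T h1 h2 h3 => (hC η χ T h1 h2 h3).2 f U _ hd hg hU⟩
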